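/- **Conventions.** Let $\mathcal O=\mathbb C[x_1,\dots,x_d]$. A (negatively graded) Lie $\infty$-algebroid over $\mathcal O$ is a family $(\mathcal E_i)_{i\le -1}$ of projective $\mathcal O$-modules with graded symmetric $\mathbb C$-multilinear brackets $\ell_n$ ($n\ge 1$) of degree $+1$ on $\mathcal E=\bigoplus_i\mathcal E_i$ and an $\mathcal O$-linear anchor $\rho:\mathcal E_{-1}\to \mathrm{Der}(\mathcal O)$ (extended by zero to $\mathcal E_{i}$, $i\le -2$), such that $\sum_{i=1}^{n}\sum_{\sigma\in \mathfrak S_{i,n-i}}\epsilon(\sigma)\,\ell_{n-i+1}(\ell_i(x_{\sigma(1)},\dots,x_{\sigma(i)}),x_{\sigma(i+1)},\dots,x_{\sigma(n)})=0$ for all $n\ge1$ and homogeneous $x_1,\dots,x_n$ (sum over shuffles, $\epsilon$ the Koszul sign); $\ell_n$ is $\mathcal O$-multilinear for $n\neq 2$; $\ell_2(x,fy)=\rho(x)[f]\,y+f\ell_2(x,y)$; $\rho\circ\ell_1=0$ on $\mathcal E_{-2}$; and $\rho(\ell_2(x,y))=[\rho(x),\rho(y)]$ on $\mathcal E_{-1}$.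 It is *universal* for a Lie–Rinehart algebra $\mathcal A$ through an $\mathcal O$-linear map $\pi:\mathcal E_{-1}\to\mathcal A$ (the hook) if $\rho_{\mathcal A}\circ\pi=\rho$, $[\pi(x),\pi(y)]_{\mathcal A}=\pi(\ell_2(x,y))$ on $\mathcal E_{-1}$, and $\cdots\xrightarrow{\ell_1}\mathcal E_{-2}\xrightarrow{\ell_1}\mathcal E_{-1}\xrightarrow{\pi}\mathcal A\to0$ is exact, i.e. a projective resolution of the $\mathcal O$-module $\mathcal A$. **Proposition.** Let $\varphi_1,\dots,\varphi_k\in\mathcal O$ be a regular sequence and let $\mathcal I=(\varphi_1,\dots,\varphi_k)$. Let $\mathcal K=\mathcal O[\mu_1,\dots,\mu_k]$ be the free graded commutative algebra on variables $\mu_i$ of degree $-1$ (the exterior algebra of $\mathcal O^k$), and for a list $J=(j_1,\dots,j_s)$ put $\mu_J=\mu_{j_1}\cdots\mu_{j_s}$. Then there is a unique Lie $\infty$-algebroid structure over $\mathcal O$ on the graded module $\mathcal E_{-j}=\mathcal K_{-j}\otimes_{\mathcal O}\mathrm{Der}(\mathcal O)$, $j\ge1$, whose anchor is given by $\mu_i\otimes\partial_{x_a}\mapsto\varphi_i\,\partial_{x_a}$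 and whose brackets on the generators $\mu_J\otimes\partial_{x_a}$, $|J|\ge 1$, are $$\ell_n\big(\mu_{J_1}\otimes\partial_{x_{a_1}},\dots,\mu_{J_n}\otimes\partial_{x_{a_n}}\big)=\sum_{l=1}^n\ \sum_{i\in J_l}\ \epsilon\ \frac{\partial^{n-1}\varphi_i}{\partial x_{a_1}\cdots\widehat{\partial x_{a_l}}\cdots\partial x_{a_n}}\ \mu_{J_1}\cdots\mu_{J_l\setminus i}\cdots\mu_{J_n}\otimes\partial_{x_{a_l}},$$ where $i$ runs over the entries of $J_l$ and $\epsilon$ is $(-1)^{n-1}$ times the sign for moving $\mu_i$ to the front of the product $\mu_{J_1}\cdots\mu_{J_n}$ (with $\ell_1=0$ on $\mathcal E_{-1}$). In particular $\ell_1=\partial\otimes\mathrm{id}$ on $\mathcal E_{-j}$, $j\ge 2$, with $\partial=\sum_i\varphi_i\,\partial/\partial\mu_i$. This Lie $\infty$-algebroid is universal for the Lie–Rinehart algebra $\mathcal I\,\mathrm{Der}(\mathcal O)$, the hook being the anchor. Moreover, let $N\subset\mathbb C^d$ be the affine variety defined by the sequence, i.e. $N$ is the common zero set of $\varphi_1,\dots,\varphi_k$,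 and suppose that $\mathcal I$ is the ideal $\mathcal I_N$ of all polynomials vanishing on $N$. Then the same Lie $\infty$-algebroid is universal, again with the anchor as hook, for the Lie–Rinehart algebra of polynomial vector fields on $\mathbb C^d$ that vanish at every point of $N$. -/

import Mathlib

open scoped DirectSum TensorProduct

noncomputable section

/-! ### Lie ∞-algebroids

A graded module `(𝓔_i)_{i ≤ -1}` is given by a family `E : ℕ → Type*`, where `E j` is the component
of degree `-(j + 1)`; thus `E 0` is the component of degree `-1`. -/

/-- The elements of `⨁ j, E j` which are homogeneous of degree `p`, where `E j` sits in
degree `-(j + 1)` (for `p ≥ 0`, this is only the zero element). -/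
def HasDegree {E : ℕ → Type*} [∀ j, AddCommGroup (E j)] (p : ℤ) (x : ⨁ j, E j) : Prop :=
  ∀ j : ℕ, -((j : ℤ) + 1) ≠ p → x j = 0

/-- The Koszul sign `ε(σ; x₁, …, xₙ)`, where `xᵢ` has degree `p i`: it is defined by
`x_{σ(1)} ⊙ ⋯ ⊙ x_{σ(n)} = ε(σ; x₁, …, xₙ) x₁ ⊙ ⋯ ⊙ xₙ`. -/
def koszulSign {n : ℕ} (p : Fin n → ℤ) (σ : Equiv.Perm (Fin n)) : ℤˣ :=
  ∏ i : Fin n, ∏ j : Fin n, if i < j ∧ σ j < σ i then Int.negOnePow (p (σ i) * p (σ j)) else 1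

/-- `(i, n - i)`-shuffles. -/
def IsShuffle {n : ℕ} (i : ℕ) (σ : Equiv.Perm (Fin n)) : Prop :=
  StrictMonoOn σ {t | (t : ℕ) < i} ∧ StrictMonoOn σ {t | i ≤ (t : ℕ)}

instance {n : ℕ} (i : ℕ) : DecidablePred (IsShuffle (n := n) i) := Classical.decPred _

/-- A (negatively graded) Lie ∞-algebroid structure over the `K`-algebra `O`, on the family `E`. -/
structure LieInftyAlgebroid (K O : Type*) [Field K] [CommRing O] [Algebra K O] (E : ℕ → Type*)
    [∀ j, AddCommGroup (E j)] [∀ j, Module O (E j)] [∀ j, Module K (E j)]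
    [∀ j, IsScalarTower K O (E j)] where
  projective : ∀ j, Module.Projective O (E j)
  /-- The `n`-ary bracket `ℓ_n`, for `n ≥ 1`. -/
  bracket : ∀ n : ℕ, MultilinearMap K (fun _ : Fin n => ⨁ j, E j) (⨁ j, E j)
  /-- The anchor, on the component of degree `-1`. -/
  anchor : E 0 →ₗ[O] Derivation K O O
  /-- There is no `0`-ary bracket. -/
  bracket_zero : bracket 0 = 0
  /-- The brackets have degree `+1`. -/
  bracket_degree : ∀ (n : ℕ) (x : Fin n → ⨁ j, E j) (p : Fin n → ℤ),
    (∀ i, HasDegree (p i) (x i)) → HasDegree ((∑ i, p i) + 1) (bracket n x)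
  /-- The brackets are graded symmetric. -/
  bracket_symm : ∀ (n : ℕ) (x : Fin n → ⨁ j, E j) (p : Fin n → ℤ),
    (∀ i, HasDegree (p i) (x i)) → ∀ σ : Equiv.Perm (Fin n),
      bracket n (fun i => x (σ i)) = (koszulSign p σ : ℤ) • bracket n x
  /-- The higher Jacobi identity; the inner bracket has arity `i + 1`. -/
  jacobi : ∀ (n : ℕ) (x : Fin n → ⨁ j, E j) (p : Fin n → ℤ),
    (∀ i, HasDegree (p i) (x i)) →
      ∑ i : Fin n, ∑ σ : Equiv.Perm (Fin n) with IsShuffle ((i : ℕ) + 1) σ,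
        (koszulSign p σ : ℤ) •
          bracket (n - (i + 1) + 1)
            (Fin.cons
              (bracket (i + 1) (fun t : Fin (i + 1) => x (σ ⟨t, by omega⟩)))
              (fun t : Fin (n - (i + 1)) => x (σ ⟨i + 1 + t, by omega⟩))) = 0
  /-- For `n ≠ 2`, the `n`-ary bracket is `O`-multilinear. -/
  bracket_smul : ∀ n : ℕ, n ≠ 2 → ∀ (x : Fin n → ⨁ j, E j) (i : Fin n) (f : O),
    bracket n (Function.update x i (f • x i)) = f • bracket n x
  /-- Leibniz identity; the anchor is extended by zero to the components of degree `≤ -2`. -/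
  leibniz : ∀ (x y : ⨁ j, E j) (f : O),
    bracket 2 ![x, f • y] = anchor (x 0) f • y + f • bracket 2 ![x, y]
  anchor_bracket_one : ∀ x : E 1, anchor (bracket 1 ![DirectSum.of E 1 x] 0) = 0
  anchor_bracket_two : ∀ x y : E 0,
    anchor (bracket 2 ![DirectSum.of E 0 x, DirectSum.of E 0 y] 0) = ⁅anchor x, anchor y⁆

namespace LieInftyAlgebroid

variable {K O : Type*} [Field K] [CommRing O] [Algebra K O] {E : ℕ → Type*}
  [∀ j, AddCommGroup (E j)] [∀ j, Module O (E j)] [∀ j, Module K (E j)]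
  [∀ j, IsScalarTower K O (E j)]

/-- The component `E_{-(j+2)} → E_{-(j+1)}` of the unary bracket. -/
def differential (U : LieInftyAlgebroid K O E) (j : ℕ) (x : E (j + 1)) : E j :=
  U.bracket 1 ![DirectSum.of E (j + 1) x] j

variable {A : Type*} [LieRing A] [Module O A] [LieRingModule A O] [LieRinehartRing O A]
  [LieAlgebra K A] [LieRinehartAlgebra K O A]

/-- `U` terminates at the Lie–Rinehart algebra `A` through the hook `π`. -/
structure TerminatesAt (U : LieInftyAlgebroid K O E) (π : E 0 →ₗ[O] A) : Prop where
  anchor_hook : ∀ x, LieRinehartAlgebra.anchor K O A (π x) = U.anchor x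
  lie_hook : ∀ x y,
    ⁅π x, π y⁆ = π (U.bracket 2 ![DirectSum.of E 0 x, DirectSum.of E 0 y] 0)

/-- `U` is universal for the Lie–Rinehart algebra `A` through the hook `π`: it terminates at `A`
and `⋯ → E_{-3} → E_{-2} → E_{-1} → A → 0` is a resolution of `A` (by projective modules,
as they always are in a Lie ∞-algebroid). -/
structure IsUniversalFor (U : LieInftyAlgebroid K O E) (π : E 0 →ₗ[O] A) : Prop
    extends U.TerminatesAt π where
  surjective_hook : Function.Surjective π
  exact_hook : Function.Exact (U.differential 0) π
  exact_differential : ∀ j, Function.Exact (U.differential (j + 1)) (U.differential j)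

end LieInftyAlgebroid

/-! ### Vector fields on `ℂᵈ` vanishing along a subvariety -/

/-- Polynomial functions on `ℂᵈ`. -/
abbrev PolyFun (d : ℕ) : Type := MvPolynomial (Fin d) ℂ

/-- Polynomial vector fields on `ℂᵈ`. -/
abbrev VF (d : ℕ) : Type := Derivation ℂ (PolyFun d) (PolyFun d)

theorem apply_mem_of_mem_ideal_smul {d : ℕ} {I : Ideal (PolyFun d)} {X : VF d}
    (hX : X ∈ I • (⊤ : Submodule (PolyFun d) (VF d))) (f : PolyFun d) : X f ∈ I := by
  induction hX using Submodule.smul_induction_on' with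
  | smul r hr Y _ => exact I.mul_mem_right _ hr
  | add Y _ Z _ hY hZ => exact I.add_mem hY hZ

/-- The Lie–Rinehart algebra `I Der(O)`. -/
def idealVF {d : ℕ} (I : Ideal (PolyFun d)) : LieRinehartSubalgebra (PolyFun d) (VF d) where
  toSubmodule := I • ⊤
  lie_mem' := by
    intro X Y hX hY
    change ⁅X, Y⁆ ∈ I • (⊤ : Submodule (PolyFun d) (VF d))
    change X ∈ I • (⊤ : Submodule (PolyFun d) (VF d)) at hX
    change Y ∈ I • (⊤ : Submodule (PolyFun d) (VF d)) at hY
    induction hY using Submodule.smul_induction_on' with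
    | smul r hr Y _ =>
      have h : ⁅X, r • Y⁆ = r • ⁅X, Y⁆ + X r • Y := LieRinehartRing.leibniz_smul_right X Y r
      rw [h]
      exact add_mem (Submodule.smul_mem_smul hr trivial)
        (Submodule.smul_mem_smul (apply_mem_of_mem_ideal_smul hX r) trivial)
    | add Y _ Z _ hY hZ =>
      have h : ⁅X, Y + Z⁆ = ⁅X, Y⁆ + ⁅X, Z⁆ := lie_add X Y Z
      rw [h]
      exact add_mem hY hZ

/-- The Lie–Rinehart algebra of vector fields `X` on `ℂᵈ` that vanish along `N`, i.e. whose value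
at every point of `N` is zero. -/
def vanishingVF {d : ℕ} (N : Set (Fin d → ℂ)) : LieRinehartSubalgebra (PolyFun d) (VF d) where
  carrier := {X | ∀ p ∈ N, ∀ f : PolyFun d, MvPolynomial.eval p (X f) = 0}
  add_mem' := by
    intro X Y hX hY p hp f
    simp [hX p hp f, hY p hp f]
  zero_mem' := by
    intro p hp f
    simp
  smul_mem' := by
    intro g X hX p hp f
    simp [hX p hp f]
  lie_mem' := by
    intro X Y hX hY p hp f
    simp [Derivation.commutator_apply, hX p hp (Y f), hY p hp (X f)]

/-! ### The Koszul algebra and the Lie ∞-algebroid on `𝒦 ⊗ Der(O)` -/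

/-- The Koszul algebra `𝒦 = O[μ₁, …, μ_k]`, with `μᵢ` of degree `-1`; its component of degree `-j`
is `⋀ʲ Oᵏ`. -/
abbrev KoszulAlgebra (d k : ℕ) : Type := ExteriorAlgebra (PolyFun d) (Fin k → PolyFun d)

/-- The variable `μᵢ` as a basis vector of `Oᵏ`. -/
def muVec (d : ℕ) {k : ℕ} (i : Fin k) : Fin k → PolyFun d := Pi.single i 1

/-- The monomial `μ_J = μ_{j₁} ⋯ μ_{jₛ}` in the Koszul algebra, for a list `J = (j₁, …, jₛ)`. -/
def muMonomial (d : ℕ) {k : ℕ} (J : List (Fin k)) : KoszulAlgebra d k :=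
  (J.map fun i => ExteriorAlgebra.ι (PolyFun d) (muVec d i)).prod

/-- The graded module `(𝒦_{-(j+1)} ⊗ Der(O))_{j ≥ 0}`. -/
abbrev KoszulVF (d k : ℕ) (j : ℕ) : Type :=
  (⋀[PolyFun d]^(j + 1) (Fin k → PolyFun d)) ⊗[PolyFun d] VF d

/-- The inclusion of `⨁_{j ≥ 1} 𝒦_{-j} ⊗ Der(O)` in `𝒦 ⊗ Der(O)`. -/
def koszulIncl (d k : ℕ) :
    (⨁ j, KoszulVF d k j) →ₗ[PolyFun d] KoszulAlgebra d k ⊗[PolyFun d] VF d :=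
  DirectSum.toModule (PolyFun d) ℕ _ fun j =>
    (Submodule.subtype (⋀[PolyFun d]^(j + 1) (Fin k → PolyFun d))).rTensor (VF d)

/-- The generator `μ_J ⊗ ∂/∂x_a` in degree `-(m + 1)`, for `J = (J 0, …, J m)`. -/
def koszulGen {d k m : ℕ} (J : Fin (m + 1) → Fin k) (a : Fin d) : KoszulVF d k m :=
  exteriorPower.ιMulti (PolyFun d) (m + 1) (fun t => muVec d (J t)) ⊗ₜ MvPolynomial.pderiv a

/-- Iterated partial derivative of `f` along the indices in the list `L`. -/
def iteratedPDeriv {d : ℕ} (L : List (Fin d)) (f : PolyFun d) : PolyFun d :=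
  L.foldr (fun b g => MvPolynomial.pderiv b g) f

/-- The explicit formula for the `n`-ary bracket of the generators `μ_{J_l} ⊗ ∂/∂x_{a_l}`,
`l = 0, …, n - 1`: the sum, over all `l` and all entries `i = J_l(t)` of the list `J_l`, of
`ε · ∂^{n-1}φ_i / ∂x_{a_0} ⋯ (omit a_l) ⋯ ∂x_{a_{n-1}} · μ_{J_0} ⋯ μ_{J_l \ i} ⋯ μ_{J_{n-1}} ⊗ ∂/∂x_{a_l}`.
Here `ε` is `(-1)^{n-1}` times the sign for moving `μ_i` to the front of `μ_{J_0} ⋯ μ_{J_{n-1}}`. -/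
def koszulBracketFormula {d k n : ℕ} (φ : Fin k → PolyFun d) (m : Fin n → ℕ)
    (J : ∀ l, Fin (m l + 1) → Fin k) (a : Fin n → Fin d) :
    KoszulAlgebra d k ⊗[PolyFun d] VF d :=
  ∑ l : Fin n, ∑ t : Fin (m l + 1),
    ((-1) ^ (n - 1) * (-1) ^ ((∑ s ∈ Finset.Iio l, (m s + 1)) + t) *
        iteratedPDeriv ((List.ofFn a).eraseIdx l) (φ (J l t))) •
      ((List.ofFn fun s : Fin n =>
          if s = l then muMonomial d ((List.ofFn (J l)).eraseIdx t)
          else muMonomial d (List.ofFn (J s))).prod ⊗ₜ MvPolynomial.pderiv (a l))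

/-- `U` is the explicit Lie ∞-algebroid structure on `𝒦 ⊗ Der(O)` attached to `φ`: its anchor and
its brackets take the prescribed values on the generators `μ_J ⊗ ∂/∂x_a`.
(For `n = 1` the formula is `∂ ⊗ id` with `∂ = ∑ φ_i ∂/∂μ_i`; on the component of degree `-1`, the
unary bracket vanishes for degree reasons.) -/
structure IsKoszulStructure {d k : ℕ} (φ : Fin k → PolyFun d)
    (U : LieInftyAlgebroid ℂ (PolyFun d) (KoszulVF d k)) : Prop where
  anchor_gen : ∀ (i : Fin k) (a : Fin d),
    U.anchor (koszulGen (fun _ => i) a) = φ i • MvPolynomial.pderiv a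
  bracket_gen : ∀ (n : ℕ) (m : Fin n → ℕ) (J : ∀ l, Fin (m l + 1) → Fin k) (a : Fin n → Fin d),
    (2 ≤ n ∨ ∃ l, 1 ≤ m l) →
      koszulIncl d k
          (U.bracket n fun l => DirectSum.of (KoszulVF d k) (m l) (koszulGen (J l) (a l))) =
        koszulBracketFormula φ m J a

end

/-!
# The Lie ∞-algebroid of a complete intersection

Sending `x ⊗ ∑ v_a ∂/∂x_a` to the tuple `(v_a x)_a` identifies `𝒦 ⊗ Der(O)` with the module of
`d`-tuples of elements of the exterior algebra `𝒦` (`koszulCoord`), and the graded module `⨁_{j ≥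
1} 𝒦_{-j} ⊗ Der(O)` with the tuples without component of degree zero. The brackets are defined on
all tuples (`fullBracket`) and followed by the projection which discards the component of degree
zero (`reduce`). The `n`-ary bracket is the `O`-multilinear extension of the prescribed formula
(`linPart`), which is built from the contractions `∂/∂μ_c`; for `n = 2` the derivatives of the
coefficients along the anchor are added (`derivPart`). It remains to prove the Jacobi identity,
uniqueness and exactness.

**Jacobi identity.** By multilinearity, it suffices to consider elements `x_s = f_s X_s ⊗
∂_{a(s)}`, where `X_s` is a product of variables `μ_c` (`multilinear_induction`). To keep track of
the factor from which a variable is removed, the variables of `X_s` get the tag `s`. In the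
exterior algebra on the tagged variables, put `W = ∏ X_s`. A bracket is then a combination of
contractions of `W`, and an iterated bracket is a combination of the `∂_q ∂_p W`, where the tagged
variable `p` is removed by the inner bracket and `q` by the outer one (`jacobi_term`). The Koszul
sign of a shuffle is the sign for reordering the product `W` (`prod_ofFn_perm`), and shuffles
correspond to the nonempty sets `S` of arguments of the inner bracket (`sum_shuffles`). Thus the
Jacobi expression is `∑_{p, q} (∑_S iterCoef S p q) ∂_q ∂_p W`. As `∂_q ∂_p W` is antisymmetric in
`p` and `q`, it suffices that the sum of the coefficients is symmetric (`sum_iterCoef_comm`),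
except where `∂_q ∂_p W` vanishes or has degree zero. For the terms in which no `f_s` is
differentiated, this symmetry comes from the involution `S ↦ {p} ∪ Sᶜ` (`sum_mainCoef_comm`). The
derivatives of the `f_s` in inner binary brackets add up, by the product rule, to the derivatives
in outer binary brackets with `p` and `q` exchanged (`sum_innerDerivCoef`); the term which
completes the product rule is the one with `S = {p}`, where the inner bracket is the unary bracket
in degree `-1`, which is zero by definition. With three arguments there are also second
derivatives, whose contribution is symmetric as well (`secondCoef_comm`).

**Uniqueness.** The elements `f μ_J ⊗ ∂/∂x_a` generate the module additively, so the `O`-linearity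
of the brackets and the Leibniz rule reduce the equality of two structures to their values on the
generators (`eq_of_isKoszulStructure`).

**Universality.** The unary bracket is the Koszul differential in each coordinate, and the anchor
is its last step `𝒦_{-1} ⊗ Der(O) → O ⊗ Der(O)`. The exactness of the Koszul complex of a regular
sequence (`exists_koszulD_eq`) gives the resolution. If the ideal is that of its zero set `N`, then
a vector field vanishes along `N` if and only if its coefficients lie in the ideal
(`mem_vanishingVF_iff`), so the two Lie–Rinehart algebras coincide.
-/

noncomputable section

/-! ### Contractions of the exterior algebra -/

namespace ExteriorAlgebra

variable {R M N : Type*} [CommRing R] [AddCommGroup M] [Module R M] [AddCommGroup N] [Module R N]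

open CliffordAlgebra in
/-- Contraction is an antiderivation of the exterior algebra. -/
theorem contractLeft_mul (d : Module.Dual R M) (x y : ExteriorAlgebra R M) :
    contractLeft d (x * y) = contractLeft d x * y + involute x * contractLeft d y := by
  induction x using CliffordAlgebra.left_induction with
  | algebraMap r =>
    simp [contractLeft_algebraMap_mul]
  | add a b ha hb => simp only [add_mul, map_add, ha, hb]; abel
  | ι_mul a m ha =>
    rw [mul_assoc, contractLeft_ι_mul, ha, contractLeft_ι_mul, map_mul, involute_ι]
    simp only [mul_add, sub_mul, smul_mul_assoc, mul_assoc, neg_mul]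
    abel

open CliffordAlgebra in
theorem contractLeft_map (f : M →ₗ[R] N) (d : Module.Dual R N) (x : ExteriorAlgebra R M) :
    contractLeft d (ExteriorAlgebra.map f x) = ExteriorAlgebra.map f (contractLeft (d ∘ₗ f) x) := by
  induction x using CliffordAlgebra.left_induction with
  | algebraMap r => simp
  | add a b ha hb => simp only [map_add, ha, hb]
  | ι_mul a m ha =>
    have h : ExteriorAlgebra.map f (CliffordAlgebra.ι 0 m) = CliffordAlgebra.ι 0 (f m) :=
      ExteriorAlgebra.map_apply_ι f m
    rw [map_mul, h, contractLeft_ι_mul, ha, contractLeft_ι_mul, map_sub, map_smul, map_mul, h]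
    rfl

open CliffordAlgebra in
theorem involute_map (f : M →ₗ[R] N) (x : ExteriorAlgebra R M) :
    involute (ExteriorAlgebra.map f x) = ExteriorAlgebra.map f (involute x) := by
  induction x using CliffordAlgebra.left_induction with
  | algebraMap r => simp
  | add a b ha hb => simp only [map_add, ha, hb]
  | ι_mul a m ha =>
    have h : ∀ m, ExteriorAlgebra.map f (CliffordAlgebra.ι 0 m) = CliffordAlgebra.ι 0 (f m) :=
      ExteriorAlgebra.map_apply_ι f
    simp only [map_mul, ha, involute_ι, h, map_neg]

/-- The `l`-th term of the Leibniz rule for the contraction `d` of the product of the family `Y`: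
the `l`-th factor is contracted, and the factors before it are replaced by their grade
involutes. -/
def leibnizTerm {m : ℕ} (d : Module.Dual R M) (l : Fin m) (Y : Fin m → ExteriorAlgebra R M) :
    ExteriorAlgebra R M :=
  (List.ofFn fun s => if s < l then CliffordAlgebra.involute (Y s)
    else if s = l then CliffordAlgebra.contractLeft d (Y s) else Y s).prod

theorem leibnizTerm_zero {m : ℕ} (d : Module.Dual R M) (Y : Fin (m + 1) → ExteriorAlgebra R M) :
    leibnizTerm d 0 Y =
      CliffordAlgebra.contractLeft d (Y 0) * (List.ofFn fun s : Fin m => Y s.succ).prod := by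
  simp [leibnizTerm, List.ofFn_succ, Fin.succ_ne_zero]

theorem leibnizTerm_succ {m : ℕ} (d : Module.Dual R M) (l : Fin m)
    (Y : Fin (m + 1) → ExteriorAlgebra R M) :
    leibnizTerm d l.succ Y =
      CliffordAlgebra.involute (Y 0) * leibnizTerm d l (fun s => Y s.succ) := by
  simp [leibnizTerm, List.ofFn_succ]

/-- The Leibniz rule for a product of arbitrary length. -/
theorem contractLeft_prod_ofFn {m : ℕ} (d : Module.Dual R M) (Y : Fin m → ExteriorAlgebra R M) :
    CliffordAlgebra.contractLeft d (List.ofFn Y).prod = ∑ l, leibnizTerm d l Y := by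
  induction m with
  | zero => simp
  | succ m ih =>
    rw [List.ofFn_succ, List.prod_cons, contractLeft_mul, ih, Fin.sum_univ_succ, leibnizTerm_zero,
      Finset.mul_sum]
    simp only [leibnizTerm_succ]

theorem leibnizTerm_eq_zero {m : ℕ} {d : Module.Dual R M} {l : Fin m}
    {Y : Fin m → ExteriorAlgebra R M} (h : CliffordAlgebra.contractLeft d (Y l) = 0) :
    leibnizTerm d l Y = 0 := by
  apply List.prod_eq_zero
  rw [List.mem_ofFn]
  exact ⟨l, by simp [h]⟩

theorem map_leibnizTerm {m : ℕ} (f : M →ₗ[R] N) (d : Module.Dual R N) (l : Fin m)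
    (Y : Fin m → ExteriorAlgebra R M) :
    leibnizTerm d l (fun s => ExteriorAlgebra.map f (Y s)) =
      ExteriorAlgebra.map f (leibnizTerm (d ∘ₗ f) l Y) := by
  rw [leibnizTerm, leibnizTerm, map_list_prod, List.map_ofFn]
  congr 2
  funext s
  simp only [Function.comp_apply, apply_ite (ExteriorAlgebra.map f), contractLeft_map, involute_map]

theorem leibnizTerm_sum {m : ℕ} {α : Type*} (t : Finset α) (d : α → Module.Dual R M) (l : Fin m)
    (Y : Fin m → ExteriorAlgebra R M) :
    leibnizTerm (∑ i ∈ t, d i) l Y = ∑ i ∈ t, leibnizTerm (d i) l Y := by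
  induction m with
  | zero => exact l.elim0
  | succ m ih =>
    induction l using Fin.cases with
    | zero => simp [leibnizTerm_zero, Finset.sum_mul]
    | succ l => simp [leibnizTerm_succ, ih, Finset.mul_sum]

/-! ### Degrees in the exterior algebra -/

open CliffordAlgebra in
theorem contractLeft_mem_exteriorPower (d : Module.Dual R M) {i : ℕ} {x : ExteriorAlgebra R M}
    (hx : x ∈ ⋀[R]^(i + 1) M) : contractLeft d x ∈ ⋀[R]^i M := by
  induction i generalizing x with
  | zero =>
    rw [zero_add, ExteriorAlgebra.exteriorPower, pow_one] at hx
    obtain ⟨m, rfl⟩ := hx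
    simp [ExteriorAlgebra.exteriorPower]
  | succ i ih =>
    rw [ExteriorAlgebra.exteriorPower, pow_succ'] at hx
    induction hx using Submodule.mul_induction_on' with
    | mem_mul_mem a ha b hb =>
      obtain ⟨m, rfl⟩ := ha
      rw [contractLeft_ι_mul]
      refine sub_mem (Submodule.smul_mem _ _ hb) ?_
      rw [ExteriorAlgebra.exteriorPower, pow_succ']
      exact Submodule.mul_mem_mul ⟨m, rfl⟩ (ih hb)
    | add a _ b _ ha hb => rw [map_add]; exact add_mem ha hb

theorem mem_exteriorPower_zero_iff {x : ExteriorAlgebra R M} :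
    x ∈ ⋀[R]^0 M ↔ x = algebraMap R _ (algebraMapInv x) := by
  rw [ExteriorAlgebra.exteriorPower, pow_zero, Submodule.mem_one]
  constructor
  · rintro ⟨y, rfl⟩
    rw [algebraMap_leftInverse]
  · intro h
    exact ⟨_, h.symm⟩

theorem contractLeft_eq_zero_of_mem (d : Module.Dual R M) {x : ExteriorAlgebra R M}
    (hx : x ∈ ⋀[R]^0 M) : CliffordAlgebra.contractLeft d x = 0 := by
  rw [mem_exteriorPower_zero_iff] at hx
  rw [hx]
  exact CliffordAlgebra.contractLeft_algebraMap _ _ _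

theorem involute_of_mem {i : ℕ} {x : ExteriorAlgebra R M} (hx : x ∈ ⋀[R]^i M) :
    CliffordAlgebra.involute x = (-1 : ℤ) ^ i • x := by
  induction i generalizing x with
  | zero =>
    rw [mem_exteriorPower_zero_iff] at hx
    rw [hx]; simp
  | succ i ih =>
    rw [ExteriorAlgebra.exteriorPower, pow_succ'] at hx
    induction hx using Submodule.mul_induction_on' with
    | mem_mul_mem a ha b hb =>
      obtain ⟨m, rfl⟩ := ha
      rw [map_mul, CliffordAlgebra.involute_ι, ih hb, pow_succ, mul_neg_one, neg_smul, neg_mul,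
        mul_smul_comm]
    | add a _ b _ ha hb => rw [map_add, ha, hb, smul_add]

theorem algebraMapInv_of_mem {i : ℕ} {x : ExteriorAlgebra R M} (hx : x ∈ ⋀[R]^(i + 1) M) :
    algebraMapInv x = 0 := by
  rw [ExteriorAlgebra.exteriorPower, pow_succ'] at hx
  induction hx using Submodule.mul_induction_on' with
  | mem_mul_mem a ha b hb =>
    obtain ⟨m, rfl⟩ := ha
    simp [algebraMapInv]
  | add a _ b _ ha hb => rw [map_add, ha, hb, add_zero]

/-- The exterior algebra is graded commutative. -/
theorem mul_comm_of_mem {i j : ℕ} {x y : ExteriorAlgebra R M} (hx : x ∈ ⋀[R]^i M)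
    (hy : y ∈ ⋀[R]^j M) : x * y = (-1 : ℤ) ^ (i * j) • (y * x) := by
  -- moving a single vector past `y`
  have key : ∀ (m : M) (j : ℕ) (y : ExteriorAlgebra R M), y ∈ ⋀[R]^j M →
      y * ι R m = (-1 : ℤ) ^ j • (ι R m * y) := by
    intro m j
    induction j with
    | zero =>
      intro y hy
      rw [mem_exteriorPower_zero_iff] at hy
      rw [hy, pow_zero, one_smul, Algebra.commutes]
    | succ j ih =>
      intro y hy
      rw [ExteriorAlgebra.exteriorPower, pow_succ'] at hy
      induction hy using Submodule.mul_induction_on' with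
      | mem_mul_mem a ha b hb =>
        obtain ⟨m', rfl⟩ := ha
        have h : ι R m' * ι R m = -(ι R m * ι R m') :=
          eq_neg_of_add_eq_zero_left (ι_add_mul_swap m' m)
        rw [mul_assoc, ih b hb, mul_smul_comm, ← mul_assoc, h, pow_succ]
        simp [mul_assoc]
      | add a _ b _ ha hb => rw [add_mul, ha, hb, mul_add, smul_add]
  induction i generalizing x with
  | zero =>
    rw [mem_exteriorPower_zero_iff] at hx
    rw [hx, zero_mul, pow_zero, one_smul, Algebra.commutes]
  | succ i ih =>
    rw [ExteriorAlgebra.exteriorPower, pow_succ'] at hx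
    induction hx using Submodule.mul_induction_on' with
    | mem_mul_mem a ha b hb =>
      obtain ⟨m, rfl⟩ := ha
      have h := key m j y hy
      rw [mul_assoc, ih hb, ← mul_assoc y, h, mul_smul_comm, smul_mul_assoc, smul_smul,
        ← mul_assoc, add_mul, one_mul, pow_add, mul_assoc ((-1 : ℤ) ^ (i * j)), ← pow_add,
        Even.neg_one_pow (Even.add_self j), mul_one]
    | add a _ b _ ha hb => rw [add_mul, ha, hb, mul_add, smul_add]

theorem map_mem_exteriorPower (f : M →ₗ[R] N) {i : ℕ} {x : ExteriorAlgebra R M}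
    (hx : x ∈ ⋀[R]^i M) : ExteriorAlgebra.map f x ∈ ⋀[R]^i N := by
  rw [ExteriorAlgebra.exteriorPower] at hx ⊢
  have h := Submodule.mem_map_of_mem (f := (ExteriorAlgebra.map f).toLinearMap) hx
  rw [Submodule.map_pow, ι_range_map_map] at h
  exact pow_le_pow_left' LinearMap.map_le_range i h

theorem prod_ofFn_mem_exteriorPower {m : ℕ} {Y : Fin m → ExteriorAlgebra R M} {p : Fin m → ℕ}
    (hY : ∀ s, Y s ∈ ⋀[R]^(p s) M) : (List.ofFn Y).prod ∈ ⋀[R]^(∑ s, p s) M := by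
  induction m with
  | zero => simp [ExteriorAlgebra.exteriorPower, Submodule.mem_one]
  | succ m ih =>
    rw [List.ofFn_succ, List.prod_cons, Fin.sum_univ_succ]
    exact SetLike.mul_mem_graded (hY 0) (ih fun s => hY s.succ)

end ExteriorAlgebra

/-! ### Koszul signs -/

/-- Composing `σ` with the transposition of `k` and `k + 1` changes its inversions only at this
pair, so the Koszul sign changes by the sign for exchanging two adjacent factors. -/
theorem koszulSign_mul_swap {n : ℕ} (p : Fin (n + 1) → ℤ) (σ : Equiv.Perm (Fin (n + 1)))
    (k : Fin n) :
    koszulSign p (σ * Equiv.swap k.castSucc k.succ) =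
      koszulSign p σ * Int.negOnePow (p (σ k.castSucc) * p (σ k.succ)) := by
  set a := k.castSucc with ha
  set b := k.succ with hb
  set τ := Equiv.swap a b with hτ
  have hab : a < b := Fin.castSucc_lt_succ
  set s : Fin (n + 1) → Fin (n + 1) → ℤˣ := fun i j => Int.negOnePow (p (σ i) * p (σ j)) with hs
  have hss : ∀ i j, s i j * s i j = 1 := fun i j => Int.units_mul_self _
  -- the quotient of the two signs, as a product over pairs: only `(a, b)` and `(b, a)` contribute
  set c : Fin (n + 1) × Fin (n + 1) → ℤˣ := fun x =>
    if x = (a, b) then (if σ b < σ a then s a b else 1)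
    else if x = (b, a) then (if σ a < σ b then s a b else 1) else 1 with hc
  have h1 : koszulSign p (σ * τ) =
      ∏ x : Fin (n + 1) × Fin (n + 1), if τ x.1 < τ x.2 ∧ σ x.2 < σ x.1 then s x.1 x.2 else 1 := by
    rw [koszulSign, ← Fintype.prod_prod_type', ← Equiv.prod_comp (τ.prodCongr τ)]
    refine Finset.prod_congr rfl fun x _ => ?_
    simp [hτ, hs]
  have h2 : koszulSign p σ =
      ∏ x : Fin (n + 1) × Fin (n + 1), if x.1 < x.2 ∧ σ x.2 < σ x.1 then s x.1 x.2 else 1 := by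
    rw [koszulSign, ← Fintype.prod_prod_type']
  have hlt : ∀ i j, (i, j) ≠ (a, b) → (i, j) ≠ (b, a) → (τ i < τ j ↔ i < j) := by
    intro i j h1 h2
    have e : (b : ℕ) = a + 1 := by simp [ha, hb]
    simp only [ne_eq, Prod.mk.injEq, not_and, Fin.ext_iff] at h1 h2
    simp only [hτ, Equiv.swap_apply_def, Fin.ext_iff, Fin.lt_def]
    split_ifs <;> omega
  have h3 : ∏ x, c x = s a b := by
    have hne : (a, b) ≠ (b, a) := by
      intro h; exact hab.ne (Prod.mk.inj h).1
    rw [← Finset.prod_subset (Finset.subset_univ {(a, b), (b, a)}), Finset.prod_pair hne]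
    · simp only [hc, if_true, hne.symm, if_false]
      rcases lt_trichotomy (σ a) (σ b) with h | h | h
      · simp [h, h.not_gt]
      · exact absurd (σ.injective h) hab.ne
      · simp [h, h.not_gt]
    · intro x _ hx
      simp only [Finset.mem_insert, Finset.mem_singleton, not_or] at hx
      simp [hc, hx.1, hx.2]
  rw [h1, h2]
  change _ = _ * s a b
  rw [← h3, ← Finset.prod_mul_distrib]
  refine Finset.prod_congr rfl fun x _ => ?_
  obtain ⟨i, j⟩ := x
  by_cases e1 : (i, j) = (a, b)
  · obtain ⟨rfl, rfl⟩ := Prod.mk.inj e1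
    have : ¬ τ a < τ b := by simp [hτ, hab.le]
    by_cases h : σ b < σ a <;> simp [hc, hab, this, h, hss]
  · by_cases e2 : (i, j) = (b, a)
    · obtain ⟨rfl, rfl⟩ := Prod.mk.inj e2
      have : τ b < τ a := by simp [hτ, hab]
      have hsc : s b a = s a b := by simp only [hs, mul_comm]
      by_cases h : σ a < σ b <;> simp [hc, hab.not_gt, this, h, hsc, hab.ne']
    · simp only [hlt i j e1 e2, hc, if_neg e1, if_neg e2, mul_one]

theorem koszulSign_one {n : ℕ} (p : Fin n → ℤ) : koszulSign p 1 = 1 := by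
  refine Finset.prod_eq_one fun i _ => Finset.prod_eq_one fun j _ => if_neg ?_
  rintro ⟨h1, h2⟩
  exact lt_asymm h1 h2

theorem koszulSign_mul_self {n : ℕ} (p : Fin n → ℤ) (σ : Equiv.Perm (Fin n)) :
    (koszulSign p σ : ℤ) * (koszulSign p σ : ℤ) = 1 := by
  rw [← Units.val_mul, Int.units_mul_self, Units.val_one]

namespace ExteriorAlgebra

variable {R M : Type*} [CommRing R] [AddCommGroup M] [Module R M]

theorem prod_ofFn_swap {n : ℕ} (k : Fin n) {Y : Fin (n + 1) → ExteriorAlgebra R M}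
    {p : Fin (n + 1) → ℕ} (hY : ∀ s, Y s ∈ ⋀[R]^(p s) M) :
    (List.ofFn fun s => Y (Equiv.swap k.castSucc k.succ s)).prod =
      (-1 : ℤ) ^ (p k.castSucc * p k.succ) • (List.ofFn Y).prod := by
  induction n with
  | zero => exact k.elim0
  | succ n ih =>
    induction k using Fin.cases with
    | zero =>
      have h : ∀ s : Fin n, Equiv.swap (0 : Fin (n + 2)) 1 s.succ.succ = s.succ.succ := fun s =>
        Equiv.swap_apply_of_ne_of_ne (Fin.succ_ne_zero _) (by simp [Fin.ext_iff])
      simp only [List.ofFn_succ, List.prod_cons, Fin.castSucc_zero, Fin.succ_zero_eq_one,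
        Equiv.swap_apply_left, Equiv.swap_apply_right, h]
      rw [← mul_assoc, mul_comm_of_mem (hY 1) (hY 0), smul_mul_assoc, mul_assoc, mul_comm (p 1)]
    | succ k =>
      have h : ∀ s : Fin (n + 1), Equiv.swap k.succ.castSucc k.succ.succ s.succ =
          (Equiv.swap k.castSucc k.succ s).succ := by
        intro s
        simp only [Equiv.swap_apply_def, Fin.ext_iff, Fin.val_succ, Fin.val_castSucc,
          apply_ite Fin.succ]
        split_ifs <;> simp_all
      have h0 : Equiv.swap k.succ.castSucc k.succ.succ 0 = 0 :=
        Equiv.swap_apply_of_ne_of_ne (by simp [Fin.ext_iff]) (by simp [Fin.ext_iff])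
      rw [List.ofFn_succ, List.prod_cons, h0]
      simp only [h]
      rw [ih k (Y := fun s => Y s.succ) (p := fun s => p s.succ) (fun s => hY _),
        List.ofFn_succ (f := Y), List.prod_cons, mul_smul_comm]
      rfl

/-- Permuting the factors of a product of homogeneous elements produces the Koszul sign: this holds
for adjacent transpositions, which generate the permutations. -/
theorem prod_ofFn_perm {n : ℕ} {Y : Fin n → ExteriorAlgebra R M} {q : Fin n → ℕ} {p : Fin n → ℤ}
    (hY : ∀ s, Y s ∈ ⋀[R]^(q s) M) (hp : ∀ s, p s = -(q s : ℤ)) (σ : Equiv.Perm (Fin n)) :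
    (List.ofFn fun s => Y (σ s)).prod = (koszulSign p σ : ℤ) • (List.ofFn Y).prod := by
  obtain _ | n := n
  · simp [koszulSign]
  have hσ : σ ∈ Submonoid.closure (Set.range fun i : Fin n => Equiv.swap i.castSucc i.succ) := by
    rw [Equiv.Perm.mclosure_swap_castSucc_succ]; trivial
  induction hσ using Submonoid.closure_induction_right with
  | one => simp [koszulSign_one]
  | mul_right σ _ τ hτ ih =>
    obtain ⟨k, rfl⟩ := hτ
    have h := prod_ofFn_swap k (Y := fun s => Y (σ s)) (p := fun s => q (σ s)) (fun s => hY _)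
    simp only [Equiv.Perm.mul_apply]
    rw [h, ih, koszulSign_mul_swap, smul_smul, Units.val_mul, mul_comm, hp, hp, neg_mul_neg,
      ← Nat.cast_mul, Int.negOnePow_def, zpow_natCast]
    simp

end ExteriorAlgebra

/-! ### The Koszul complex -/

namespace ExteriorAlgebra

section Contraction

variable (R : Type*) [CommRing R] {ι : Type*}

/-- The odd derivation `∂/∂μᵢ` of the exterior algebra of `ι → R`. -/
def dmu (i : ι) : ExteriorAlgebra R (ι → R) →ₗ[R] ExteriorAlgebra R (ι → R) :=
  CliffordAlgebra.contractLeft (LinearMap.proj i)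

variable {R}

theorem dmu_dmu (i : ι) (x : ExteriorAlgebra R (ι → R)) : dmu R i (dmu R i x) = 0 :=
  CliffordAlgebra.contractLeft_contractLeft _ _

theorem dmu_comm (i j : ι) (x : ExteriorAlgebra R (ι → R)) :
    dmu R i (dmu R j x) = -dmu R j (dmu R i x) :=
  CliffordAlgebra.contractLeft_comm _ _ _

section

variable [Fintype ι]

/-- The Koszul differential `∂ = ∑ φᵢ ∂/∂μᵢ`. -/
def koszulD (φ : ι → R) : ExteriorAlgebra R (ι → R) →ₗ[R] ExteriorAlgebra R (ι → R) :=
  ∑ i, φ i • dmu R i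

theorem koszulD_eq (φ : ι → R) :
    koszulD φ = CliffordAlgebra.contractLeft (∑ i, φ i • LinearMap.proj i) := by
  rw [map_sum]
  simp only [map_smul]
  rfl

theorem koszulD_koszulD (φ : ι → R) (x : ExteriorAlgebra R (ι → R)) :
    koszulD φ (koszulD φ x) = 0 := by
  rw [koszulD_eq]
  exact CliffordAlgebra.contractLeft_contractLeft _ _

theorem dmu_koszulD (φ : ι → R) (i : ι) (x : ExteriorAlgebra R (ι → R)) :
    dmu R i (koszulD φ x) = -koszulD φ (dmu R i x) := by
  rw [koszulD_eq]
  exact CliffordAlgebra.contractLeft_comm _ _ _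

theorem koszulD_algebraMap (φ : ι → R) (r : R) : koszulD φ (algebraMap R _ r) = 0 := by
  rw [koszulD_eq]
  exact CliffordAlgebra.contractLeft_algebraMap _ _ _

theorem koszulD_mem_exteriorPower (φ : ι → R) {n : ℕ} {x : ExteriorAlgebra R (ι → R)}
    (hx : x ∈ ⋀[R]^(n + 1) (ι → R)) : koszulD φ x ∈ ⋀[R]^n (ι → R) := by
  rw [koszulD_eq]
  exact contractLeft_mem_exteriorPower _ hx

end

variable [DecidableEq ι]

variable (R) in
/-- The variable `μᵢ` of the exterior algebra of `ι → R`. -/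
def mu (i : ι) : ExteriorAlgebra R (ι → R) := ExteriorAlgebra.ι R (Pi.single i 1)

theorem dmu_mu_mul (i j : ι) (x : ExteriorAlgebra R (ι → R)) :
    dmu R i (mu R j * x) = (if i = j then x else 0) - mu R j * dmu R i x := by
  have h := CliffordAlgebra.contractLeft_ι_mul (Q := (0 : QuadraticForm R (ι → R)))
    (LinearMap.proj i) (Pi.single j 1) x
  rw [dmu, mu]
  refine h.trans ?_
  by_cases e : i = j <;> simp [e]

theorem mu_mul_mu_mul_self (i : ι) (x : ExteriorAlgebra R (ι → R)) : mu R i * (mu R i * x) = 0 := by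
  rw [← mul_assoc, mu, ι_sq_zero, zero_mul]

variable (R) in
/-- The projection of `ι → R` which sets the `i`-th coordinate to zero. -/
def killCoord (i : ι) : (ι → R) →ₗ[R] (ι → R) :=
  LinearMap.id - (LinearMap.single R (fun _ => R) i) ∘ₗ LinearMap.proj i

/-- Setting `μᵢ` to zero is the operator `z ↦ z - μᵢ ∂z/∂μᵢ`. -/
theorem map_killCoord (i : ι) (z : ExteriorAlgebra R (ι → R)) :
    ExteriorAlgebra.map (killCoord R i) z =
      z - mu R i * dmu R i z := by
  induction z using CliffordAlgebra.left_induction with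
  | algebraMap r => simp [dmu]
  | add a b ha hb => simp only [map_add, ha, hb, mul_add]; abel
  | ι_mul x m hx =>
    have h1 := CliffordAlgebra.contractLeft_ι_mul (Q := (0 : QuadraticForm R (ι → R)))
      (LinearMap.proj i) m x
    have h2 : killCoord R i m = m - m i • Pi.single i (1 : R) := by
      simp [killCoord, ← Pi.single_smul]
    have h3 : ExteriorAlgebra.ι R m * mu R i = -(mu R i * ExteriorAlgebra.ι R m) :=
      eq_neg_of_add_eq_zero_left (ι_add_mul_swap m _)
    change ExteriorAlgebra.map _ (ExteriorAlgebra.ι R m * x) =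
      ExteriorAlgebra.ι R m * x - mu R i * dmu R i (CliffordAlgebra.ι 0 m * x)
    rw [dmu, h1, map_mul, map_apply_ι, h2, map_sub, map_smul, hx]
    change (ExteriorAlgebra.ι R m - m i • mu R i) * (x - mu R i * dmu R i x) =
      ExteriorAlgebra.ι R m * x - mu R i * (m i • x - ExteriorAlgebra.ι R m * dmu R i x)
    rw [sub_mul, mul_sub, mul_sub, mul_sub, smul_mul_assoc, smul_mul_assoc, mu_mul_mu_mul_self,
      ← mul_assoc, h3, mul_smul_comm, smul_zero, sub_zero, neg_mul, mul_assoc]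
    abel

variable [Fintype ι]

theorem koszulD_mu_mul (φ : ι → R) (j : ι) (x : ExteriorAlgebra R (ι → R)) :
    koszulD φ (mu R j * x) = φ j • x - mu R j * koszulD φ x := by
  simp [koszulD, dmu_mu_mul, smul_sub, Finset.sum_sub_distrib, Finset.mul_sum]

/-- An element killed by all `∂/∂μᵢ` is a constant: it does not change when the variables are set
to zero one after the other. -/
theorem eq_algebraMap_of_dmu_eq_zero {z : ExteriorAlgebra R (ι → R)} (hz : ∀ i, dmu R i z = 0) :
    z = algebraMap R _ (algebraMapInv z) := by
  have key : ∀ s : Finset ι, ∃ f : (ι → R) →ₗ[R] (ι → R),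
      (∀ v, ∀ i ∈ s, f v i = 0) ∧ ExteriorAlgebra.map f z = z := by
    intro s
    induction s using Finset.induction_on with
    | empty => exact ⟨LinearMap.id, by simp, by simp [map_id]⟩
    | insert i s hi ih =>
      obtain ⟨f, hf, hfz⟩ := ih
      refine ⟨killCoord R i ∘ₗ f, ?_, ?_⟩
      · intro v j hj
        by_cases e : j = i
        · subst e; simp [killCoord]
        · simp [killCoord, e, hf v j (Finset.mem_of_mem_insert_of_ne hj e)]
      · rw [← map_comp_map, AlgHom.comp_apply, hfz, map_killCoord, hz, mul_zero, sub_zero]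
  obtain ⟨f, hf, hfz⟩ := key Finset.univ
  have hf0 : f = 0 := by
    refine LinearMap.ext fun v => funext fun i => ?_
    simp [hf]
  have h0 : ∀ x : ExteriorAlgebra R (ι → R),
      ExteriorAlgebra.map (0 : (ι → R) →ₗ[R] (ι → R)) x = algebraMap R _ (algebraMapInv x) := by
    intro x
    induction x using CliffordAlgebra.left_induction with
    | algebraMap r => simp
    | add a b ha hb => simp only [map_add, ha, hb]
    | ι_mul x m hx =>
      change ExteriorAlgebra.map _ (ExteriorAlgebra.ι R m * x) =
        algebraMap R _ (algebraMapInv (ExteriorAlgebra.ι R m * x))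
      simp [algebraMapInv, map_apply_ι]
  rw [← h0, ← hf0, hfz]

end Contraction

/-- The Koszul complex of a regular sequence is exact, in an elementwise form: a cycle is a boundary
if its component of degree zero lies in the ideal. The elements which do not involve `μᵢ` for
`i ≥ j`, i.e. which are killed by these `∂/∂μᵢ`, form the Koszul complex of the first `j` terms of
the sequence; the proof is by induction on `j`. -/
theorem exists_koszulD_eq {R : Type*} [CommRing R] {k : ℕ} (φ : Fin k → R)
    (hφ : ∀ (i : Fin k) (f : R), φ i * f ∈ Ideal.span (φ '' {t | t < i}) →
      f ∈ Ideal.span (φ '' {t | t < i}))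
    (z : ExteriorAlgebra R (Fin k → R)) (hz : koszulD φ z = 0)
    (hz0 : algebraMapInv z ∈ Ideal.span (Set.range φ)) : ∃ w, koszulD φ w = z := by
  -- boundaries have their component of degree zero in the ideal
  have hε : ∀ (j : ℕ) (w : ExteriorAlgebra R (Fin k → R)),
      (∀ i : Fin k, j ≤ i → dmu R i w = 0) →
      algebraMapInv (koszulD φ w) ∈ Ideal.span (φ '' {t | (t : ℕ) < j}) := by
    intro j w hw
    simp only [koszulD, LinearMap.sum_apply, LinearMap.smul_apply, map_sum, map_smul]
    refine sum_mem fun i _ => ?_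
    by_cases h : (i : ℕ) < j
    · rw [smul_eq_mul]
      exact Ideal.mul_mem_right _ _ (Ideal.subset_span ⟨i, h, rfl⟩)
    · simp [hw i (not_lt.mp h)]
  have key : ∀ (j : ℕ) (_ : j ≤ k) (z : ExteriorAlgebra R (Fin k → R)),
      (∀ i : Fin k, j ≤ i → dmu R i z = 0) → koszulD φ z = 0 →
      algebraMapInv z ∈ Ideal.span (φ '' {t | (t : ℕ) < j}) →
      ∃ w, (∀ i : Fin k, j ≤ i → dmu R i w = 0) ∧ koszulD φ w = z := by
    intro j
    induction j with
    | zero =>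
      intro _ z hD _ hz0
      have h := eq_algebraMap_of_dmu_eq_zero fun i => hD i (Nat.zero_le _)
      have h0 : algebraMapInv z = 0 := by simpa using hz0
      refine ⟨0, by simp, ?_⟩
      rw [h, h0]; simp
    | succ j ih =>
      intro hj z hD hz hz0
      -- `z = u + μⱼ v`, where `u` and `v` do not involve `μᵢ` for `i ≥ j`
      set jj : Fin k := ⟨j, hj⟩ with hjj
      set v := dmu R jj z with hv
      set u := z - mu R jj * v with hu
      have hvD : ∀ i : Fin k, j ≤ i → dmu R i v = 0 := by
        intro i hi
        rcases hi.eq_or_lt with h | h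
        · have : i = jj := Fin.ext h.symm
          rw [this, hv, dmu_dmu]
        · rw [hv, dmu_comm, hD i h, map_zero, neg_zero]
      have huD : ∀ i : Fin k, j ≤ i → dmu R i u = 0 := by
        intro i hi
        rw [hu, map_sub, dmu_mu_mul, hvD i hi, mul_zero, sub_zero]
        rcases hi.eq_or_lt with h | h
        · have : i = jj := Fin.ext h.symm
          rw [if_pos this, this, ← hv, sub_self]
        · rw [if_neg (fun e => by rw [e] at h; exact lt_irrefl _ h), sub_zero, hD i h]
      have hdv : koszulD φ v = 0 := by
        have h := dmu_koszulD φ jj z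
        rw [hz, map_zero, ← hv] at h
        exact neg_eq_zero.mp h.symm
      have hdu : koszulD φ u = -(φ jj • v) := by
        rw [hu, map_sub, hz, koszulD_mu_mul, hdv, mul_zero, sub_zero, zero_sub]
      have hset : {t : Fin k | t < jj} = {t : Fin k | (t : ℕ) < j} := rfl
      -- `φⱼ v = -∂u`, so regularity puts the constant term of the cycle `v` in the ideal of the
      -- first `j` terms
      have hv0 : algebraMapInv v ∈ Ideal.span (φ '' {t | (t : ℕ) < j}) := by
        have h := hε j u huD
        rw [hdu, map_neg, map_smul, smul_eq_mul, neg_mem_iff, ← hset] at h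
        rw [← hset]
        exact hφ jj _ h
      obtain ⟨w, hwD, hw⟩ := ih (by omega) v hvD hdv hv0
      have hset' : {t : Fin k | (t : ℕ) < j + 1} = insert jj {t : Fin k | (t : ℕ) < j} := by
        ext t
        simp only [Set.mem_ofPred_eq, Set.mem_insert_iff, Fin.ext_iff, hjj]
        omega
      have hεu : algebraMapInv u = algebraMapInv z := by
        rw [hu, map_sub, map_mul]
        simp [mu, algebraMapInv]
      rw [hset', Set.image_insert_eq, Ideal.mem_span_insert, ← hεu] at hz0
      obtain ⟨a, b, hb, hab⟩ := hz0
      -- `w` is changed by a constant so that `u + φⱼ w'` has its constant term in the same ideal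
      set w' := w - algebraMap R _ (a + algebraMapInv w) with hw'
      have hw'D : ∀ i : Fin k, j ≤ i → dmu R i w' = 0 := by
        intro i hi
        rw [hw', map_sub, hwD i hi, zero_sub, neg_eq_zero]
        exact CliffordAlgebra.contractLeft_algebraMap _ _ _
      have hw'd : koszulD φ w' = v := by
        rw [hw', map_sub, hw, koszulD_algebraMap, sub_zero]
      have hw'ε : algebraMapInv w' = -a := by
        rw [hw', map_sub, algebraMap_leftInverse]; ring
      obtain ⟨x, hxD, hx⟩ := ih (by omega) (u + φ jj • w')
        (fun i hi => by rw [map_add, map_smul, huD i hi, hw'D i hi, smul_zero, add_zero])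
        (by rw [map_add, map_smul, hdu, hw'd]; simp)
        (by
          rw [map_add, map_smul, hw'ε, hab]
          have e : a * φ jj + b + φ jj • -a = b := by rw [smul_eq_mul]; ring
          rwa [e])
      refine ⟨x - mu R jj * w', fun i hi => ?_, ?_⟩
      · have hij : i ≠ jj := fun e => by rw [e] at hi; simp [hjj] at hi
        rw [map_sub, dmu_mu_mul, hxD i (by omega), hw'D i (by omega), if_neg hij]
        simp
      · rw [map_sub, hx, koszulD_mu_mul, hw'd, hu]
        abel
  obtain ⟨w, -, hw⟩ := key k le_rfl z (fun i hi => absurd hi (by omega)) hz (by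
    have : {t : Fin k | (t : ℕ) < k} = Set.univ := by ext t; simp
    rwa [this, Set.image_univ])
  exact ⟨w, hw⟩

end ExteriorAlgebra

/-- Weak regularity in terms of the ideals generated by the initial segments of the sequence. -/
theorem RingTheory.Sequence.IsWeaklyRegular.mem_span_of_mul_mem {R : Type*} [CommRing R] {k : ℕ}
    {φ : Fin k → R} (hφ : RingTheory.Sequence.IsWeaklyRegular R (List.ofFn φ)) (i : Fin k) (f : R)
    (hf : φ i * f ∈ Ideal.span (φ '' {t | t < i})) : f ∈ Ideal.span (φ '' {t | t < i}) := by
  have h := hφ.regular_mod_prev i (by simp)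
  have hI : Ideal.ofList (List.take i (List.ofFn φ)) = Ideal.span (φ '' {t | t < i}) := by
    rw [Ideal.ofList]
    congr 1
    ext r
    simp only [List.mem_take_iff_getElem, Set.mem_ofPred_eq, Set.mem_image]
    constructor
    · rintro ⟨j, hj, rfl⟩
      rw [List.length_ofFn] at hj
      exact ⟨⟨j, by omega⟩, Fin.lt_def.mpr (by simp only; omega), by simp⟩
    · rintro ⟨t, ht, rfl⟩
      exact ⟨t, by rw [List.length_ofFn]; omega, by simp⟩
  have hI' : (Ideal.ofList (List.take i (List.ofFn φ)) • ⊤ : Submodule R R) =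
      Ideal.span (φ '' {t | t < i}) := by
    rw [hI, smul_eq_mul, Ideal.mul_top]
  rw [isSMulRegular_quotient_iff_mem_of_smul_mem] at h
  rw [hI'] at h
  simp only [List.getElem_ofFn, Fin.eta] at h
  exact h f hf

/-! ### Coordinates on the module of Koszul vector fields -/

namespace KoszulLie

open ExteriorAlgebra

variable {d k : ℕ}

/-- The graded module `⨁_{j ≥ 1} 𝒦_{-j} ⊗ Der(O)`. Its additive structure is spelled out as the one
which occurs in `LieInftyAlgebroid`. -/
abbrev KoszulSum (d k : ℕ) : Type :=
  @DirectSum ℕ (KoszulVF d k) fun _ => AddCommGroup.toAddCommMonoid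

-- Shortcuts to instances on the modules in question, whose synthesis from scratch is slow.
scoped instance : CommRing (PolyFun d) := inferInstance
scoped instance : CommSemiring (PolyFun d) := inferInstance
scoped instance : Semiring (PolyFun d) := inferInstance
scoped instance : AddCommMonoid (PolyFun d) := inferInstance
scoped instance : Module (PolyFun d) (PolyFun d) := inferInstance
scoped instance : Ring (KoszulAlgebra d k) := inferInstance
scoped instance : Semiring (KoszulAlgebra d k) := inferInstance
scoped instance : Algebra (PolyFun d) (KoszulAlgebra d k) := inferInstance
scoped instance : AddCommGroup (KoszulAlgebra d k) := inferInstance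
scoped instance : AddCommMonoid (KoszulAlgebra d k) := inferInstance
scoped instance : Module (PolyFun d) (KoszulAlgebra d k) := inferInstance
scoped instance : AddCommGroup (VF d) := inferInstance
scoped instance : AddCommMonoid (VF d) := inferInstance
scoped instance : Module (PolyFun d) (VF d) := inferInstance
scoped instance (j : ℕ) : AddCommGroup (KoszulVF d k j) := inferInstance
scoped instance (j : ℕ) : AddCommMonoid (KoszulVF d k j) := inferInstance
scoped instance (j : ℕ) : Module (PolyFun d) (KoszulVF d k j) := inferInstance
scoped instance : AddCommGroup (KoszulSum d k) := inferInstance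
scoped instance : AddCommMonoid (KoszulSum d k) := inferInstance
scoped instance : Module (PolyFun d) (KoszulSum d k) := inferInstance
scoped instance : Algebra ℂ (PolyFun d) := inferInstance
scoped instance : Module ℂ (VF d) := inferInstance
scoped instance (j : ℕ) : Module ℂ (KoszulVF d k j) := inferInstance
scoped instance : Module ℂ (KoszulSum d k) := inferInstance
scoped instance : SMul (PolyFun d) (VF d) := inferInstance
scoped instance (j : ℕ) : SMul (PolyFun d) (KoszulVF d k j) := inferInstance
scoped instance : SMul (PolyFun d) (KoszulSum d k) := inferInstance
scoped instance (j : ℕ) : SMul ℂ (KoszulVF d k j) := inferInstance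
scoped instance (j : ℕ) : IsScalarTower ℂ (PolyFun d) (KoszulVF d k j) := inferInstance
scoped instance : SMul ℂ (KoszulSum d k) := inferInstance
scoped instance : IsScalarTower ℂ (PolyFun d) (KoszulSum d k) := inferInstance
scoped instance (j : ℕ) : Zero (KoszulVF d k j) := inferInstance
scoped instance : Zero (KoszulSum d k) := inferInstance

/-- Vector fields are given by their coefficients. -/
def vfCoord (d : ℕ) : VF d ≃ₗ[PolyFun d] (Fin d → PolyFun d) where
  toFun V a := V (MvPolynomial.X a)
  map_add' _ _ := rfl
  map_smul' _ _ := rfl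
  invFun f := MvPolynomial.mkDerivation ℂ f
  left_inv _ := MvPolynomial.derivation_ext fun a => MvPolynomial.mkDerivation_X ℂ _ a
  right_inv f := funext fun a => MvPolynomial.mkDerivation_X ℂ f a

theorem VF.eq_sum (V : VF d) : V = ∑ a, V (MvPolynomial.X a) • MvPolynomial.pderiv a := by
  refine MvPolynomial.derivation_ext fun b => ?_
  have h : ∀ (s : Finset (Fin d)) (g : Fin d → VF d), (∑ a ∈ s, g a) (MvPolynomial.X b) =
      ∑ a ∈ s, g a (MvPolynomial.X b) := fun s g =>
    map_sum (AddMonoidHom.mk' (fun V : VF d => V (MvPolynomial.X b)) fun _ _ => rfl) g s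
  rw [h, Finset.sum_eq_single b]
  · simp
  · intro a _ hab
    simp [MvPolynomial.pderiv_X_of_ne hab.symm]
  · simp

/-- `𝒦 ⊗ Der(O)` as the module of `d`-tuples of elements of `𝒦`: the coordinates are the
coefficients of the `∂/∂x_a`. -/
def koszulCoord (d k : ℕ) :
    KoszulAlgebra d k ⊗[PolyFun d] VF d ≃ₗ[PolyFun d] (Fin d → KoszulAlgebra d k) :=
  (LinearEquiv.lTensor (KoszulAlgebra d k) (vfCoord d)).trans
    (TensorProduct.piScalarRight (PolyFun d) (PolyFun d) (KoszulAlgebra d k) (Fin d))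

theorem koszulCoord_tmul (x : KoszulAlgebra d k) (V : VF d) (a : Fin d) :
    koszulCoord d k (x ⊗ₜ V) a = V (MvPolynomial.X a) • x := rfl

theorem koszulCoord_tmul_pderiv (x : KoszulAlgebra d k) (b : Fin d) :
    koszulCoord d k (x ⊗ₜ MvPolynomial.pderiv b) = Pi.single b x := by
  funext a
  rw [koszulCoord_tmul]
  by_cases h : a = b
  · subst h; simp
  · simp [h, MvPolynomial.pderiv_X_of_ne h]

/-- The inclusion of `⨁_{j ≥ 1} 𝒦_{-j} ⊗ Der(O)` in `𝒦 ⊗ Der(O)`, in coordinates. -/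
def coordIncl (d k : ℕ) : KoszulSum d k →ₗ[PolyFun d] (Fin d → KoszulAlgebra d k) :=
  (koszulCoord d k).toLinearMap ∘ₗ koszulIncl d k

theorem coordIncl_of_tmul (j : ℕ) (x : ⋀[PolyFun d]^(j + 1) (Fin k → PolyFun d)) (V : VF d)
    (a : Fin d) :
    coordIncl d k (DirectSum.of (KoszulVF d k) j (x ⊗ₜ V)) a =
      V (MvPolynomial.X a) • (x : KoszulAlgebra d k) := by
  have h : koszulIncl d k (DirectSum.of (KoszulVF d k) j (x ⊗ₜ V)) =
      (x : KoszulAlgebra d k) ⊗ₜ V := by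
    rw [koszulIncl, ← DirectSum.lof_eq_of (PolyFun d), DirectSum.toModule_lof]
    rfl
  rw [coordIncl, LinearMap.comp_apply, h]
  rfl

theorem coordIncl_of_mem (j : ℕ) (x : KoszulVF d k j) (a : Fin d) :
    coordIncl d k (DirectSum.of (KoszulVF d k) j x) a ∈
      ⋀[PolyFun d]^(j + 1) (Fin k → PolyFun d) := by
  induction x using TensorProduct.induction_on with
  | zero => simp
  | tmul x V => rw [coordIncl_of_tmul]; exact Submodule.smul_mem _ _ x.2
  | add x y hx hy =>
    rw [AddMonoidHom.map_add, LinearMap.map_add]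
    exact add_mem hx hy

theorem coordIncl_koszulGen {m : ℕ} (J : Fin (m + 1) → Fin k) (a : Fin d) :
    coordIncl d k (DirectSum.of (KoszulVF d k) m (koszulGen J a)) =
      Pi.single a (muMonomial d (List.ofFn J)) := by
  have h : ((exteriorPower.ιMulti (PolyFun d) (m + 1) fun t => muVec d (J t) :
      ⋀[PolyFun d]^(m + 1) (Fin k → PolyFun d)) : KoszulAlgebra d k) =
      muMonomial d (List.ofFn J) := by
    rw [exteriorPower.ιMulti_apply_coe, ιMulti_apply, muMonomial, List.map_ofFn]
    rfl
  funext b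
  rw [koszulGen, coordIncl_of_tmul, h]
  by_cases e : b = a
  · subst e; simp
  · simp [e, MvPolynomial.pderiv_X_of_ne e]

theorem muMonomial_mem (J : List (Fin k)) :
    muMonomial d J ∈ ⋀[PolyFun d]^J.length (Fin k → PolyFun d) := by
  induction J with
  | nil => simp [muMonomial, ExteriorAlgebra.exteriorPower, Submodule.mem_one]
  | cons i J ih =>
    rw [muMonomial, List.map_cons, List.prod_cons, List.length_cons, ExteriorAlgebra.exteriorPower,
      pow_succ']
    exact Submodule.mul_mem_mul ⟨_, rfl⟩ ih

/-- Drops the component of degree zero of `x ∈ 𝒦` and sends the other ones to `x ⊗ ∂/∂x_a`. -/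
def truncTmul (k : ℕ) (a : Fin d) : KoszulAlgebra d k →ₗ[PolyFun d] KoszulSum d k :=
  (DirectSum.toModule (PolyFun d) ℕ (KoszulSum d k) fun i => match i with
    | 0 => 0
    | j + 1 => DirectSum.lof (PolyFun d) ℕ (KoszulVF d k) j ∘ₗ
        (TensorProduct.mk (PolyFun d) (⋀[PolyFun d]^(j + 1) (Fin k → PolyFun d)) (VF d)).flip
          (MvPolynomial.pderiv a)) ∘ₗ
    (DirectSum.decomposeLinearEquiv fun i : ℕ => ⋀[PolyFun d]^i (Fin k → PolyFun d)).toLinearMap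

theorem truncTmul_of_mem (a : Fin d) {j : ℕ} {x : KoszulAlgebra d k}
    (hx : x ∈ ⋀[PolyFun d]^(j + 1) (Fin k → PolyFun d)) :
    truncTmul k a x = DirectSum.of (KoszulVF d k) j (⟨x, hx⟩ ⊗ₜ MvPolynomial.pderiv a) := by
  rw [truncTmul, LinearMap.comp_apply, LinearEquiv.coe_coe, DirectSum.decomposeLinearEquiv_apply,
    DirectSum.decompose_of_mem (fun i : ℕ => ⋀[PolyFun d]^i (Fin k → PolyFun d)) hx,
    ← DirectSum.lof_eq_of (PolyFun d), DirectSum.toModule_lof]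
  rfl

theorem truncTmul_of_mem_zero (a : Fin d) {x : KoszulAlgebra d k}
    (hx : x ∈ ⋀[PolyFun d]^0 (Fin k → PolyFun d)) : truncTmul k a x = 0 := by
  rw [truncTmul, LinearMap.comp_apply, LinearEquiv.coe_coe, DirectSum.decomposeLinearEquiv_apply,
    DirectSum.decompose_of_mem (fun i : ℕ => ⋀[PolyFun d]^i (Fin k → PolyFun d)) hx,
    ← DirectSum.lof_eq_of (PolyFun d), DirectSum.toModule_lof]
  rfl

/-- The projection of `𝒦 ⊗ Der(O)` onto `⨁_{j ≥ 1} 𝒦_{-j} ⊗ Der(O)`, in coordinates. -/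
def coordProj (d k : ℕ) : (Fin d → KoszulAlgebra d k) →ₗ[PolyFun d] KoszulSum d k :=
  ∑ a, truncTmul k a ∘ₗ LinearMap.proj a

theorem coordProj_apply (ξ : Fin d → KoszulAlgebra d k) :
    coordProj d k ξ = ∑ a, truncTmul k a (ξ a) := by
  simp [coordProj]

theorem coordProj_coordIncl (x : KoszulSum d k) : coordProj d k (coordIncl d k x) = x := by
  induction x using DirectSum.induction_on with
  | zero => simp
  | add x y hx hy => rw [map_add, map_add, hx, hy]
  | of j x =>
    induction x using TensorProduct.induction_on with
    | zero => simp
    | add x y hx hy => rw [AddMonoidHom.map_add, LinearMap.map_add, LinearMap.map_add, hx, hy]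
    | tmul x V =>
      rw [coordProj_apply]
      simp only [coordIncl_of_tmul, map_smul, truncTmul_of_mem _ x.2]
      conv_rhs => rw [VF.eq_sum V, TensorProduct.tmul_sum, map_sum]
      refine Finset.sum_congr rfl fun a _ => ?_
      rw [TensorProduct.tmul_smul, ← DirectSum.lof_eq_of (PolyFun d),
        ← DirectSum.lof_eq_of (PolyFun d), map_smul]

theorem coordIncl_injective : Function.Injective (coordIncl d k) :=
  Function.LeftInverse.injective coordProj_coordIncl

theorem coordIncl_truncTmul (a : Fin d) (x : KoszulAlgebra d k) :
    coordIncl d k (truncTmul k a x) = Pi.single a (x - algebraMap _ _ (algebraMapInv x)) := by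
  induction x using DirectSum.Decomposition.inductionOn
    fun i : ℕ => ⋀[PolyFun d]^i (Fin k → PolyFun d) with
  | zero => simp
  | add x y hx hy =>
    rw [map_add, map_add, hx, hy, ← Pi.single_add]
    congr 1
    simp only [map_add]
    abel
  | @homogeneous i x =>
    obtain _ | j := i
    · rw [truncTmul_of_mem_zero a x.2, ← mem_exteriorPower_zero_iff.mp x.2]
      simp
    · rw [truncTmul_of_mem a x.2, algebraMapInv_of_mem x.2, map_zero, sub_zero]
      funext b
      rw [coordIncl_of_tmul]
      by_cases e : b = a
      · subst e; simp
      · simp [e, MvPolynomial.pderiv_X_of_ne e]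

theorem coordIncl_coordProj (ξ : Fin d → KoszulAlgebra d k) (a : Fin d) :
    coordIncl d k (coordProj d k ξ) a = ξ a - algebraMap _ _ (algebraMapInv (ξ a)) := by
  rw [coordProj_apply, map_sum, Finset.sum_apply]
  simp [coordIncl_truncTmul]

theorem algebraMapInv_coordIncl (x : KoszulSum d k) (a : Fin d) :
    algebraMapInv (coordIncl d k x a) = 0 := by
  have h := coordIncl_coordProj (coordIncl d k x) a
  rw [coordProj_coordIncl] at h
  have h' := congrArg algebraMapInv h
  rw [map_sub, algebraMap_leftInverse, sub_self] at h'
  exact h'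

theorem hasDegree_of_coordIncl_mem {x : KoszulSum d k} {j : ℕ}
    (hx : ∀ a, coordIncl d k x a ∈ ⋀[PolyFun d]^(j + 1) (Fin k → PolyFun d)) :
    HasDegree (E := KoszulVF d k) (-((j : ℤ) + 1)) x := by
  intro i hi
  have hij : j ≠ i := fun h => hi (by rw [h])
  rw [← coordProj_coordIncl x, coordProj_apply, DirectSum.sum_apply]
  refine Finset.sum_eq_zero fun a _ => ?_
  rw [truncTmul_of_mem a (hx a), DirectSum.of_eq_of_ne _ _ _ hij.symm]

theorem eq_of_hasDegree {x : KoszulSum d k} {j : ℕ}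
    (hx : HasDegree (E := KoszulVF d k) (-((j : ℤ) + 1)) x) :
    x = DirectSum.of (KoszulVF d k) j (x j) := by
  refine DFinsupp.ext fun i => ?_
  by_cases h : i = j
  · subst h; exact (DirectSum.of_eq_same _ _).symm
  · exact (hx i (fun e => h (by omega))).trans (DirectSum.of_eq_of_ne _ _ _ h).symm

theorem span_koszulGen (j : ℕ) : Submodule.span (PolyFun d)
    (Set.range fun x : (Fin (j + 1) → Fin k) × Fin d => koszulGen x.1 x.2) =
      (⊤ : Submodule (PolyFun d) (KoszulVF d k j)) := by
  rw [eq_top_iff]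
  rintro x -
  induction x using TensorProduct.induction_on with
  | zero => exact zero_mem _
  | add x y hx hy => exact add_mem hx hy
  | tmul x V =>
    rw [VF.eq_sum V, TensorProduct.tmul_sum]
    refine sum_mem fun a _ => ?_
    rw [TensorProduct.tmul_smul]
    refine Submodule.smul_mem _ _ ?_
    rw [← ((Pi.basisFun (PolyFun d) (Fin k)).exteriorPower (j + 1)).sum_repr x,
      TensorProduct.sum_tmul]
    refine sum_mem fun s _ => ?_
    rw [← TensorProduct.smul_tmul']
    refine Submodule.smul_mem _ _ (Submodule.subset_span ?_)
    refine ⟨(Set.powersetCard.ofFinEmbEquiv.symm s, a), ?_⟩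
    rw [exteriorPower.basis_apply]
    simp only [koszulGen, exteriorPower.ιMulti_family]
    congr 2
    funext t
    simp [muVec]

/-- The elements of `⨁_{j ≥ 1} 𝒦_{-j} ⊗ Der(O)` of the form `f μ_J ⊗ ∂/∂x_a` and of degree `p`. -/
def pureElements (d k : ℕ) (p : ℤ) : Set (KoszulSum d k) :=
  {w | ∃ (m : ℕ) (J : Fin (m + 1) → Fin k) (a : Fin d) (f : PolyFun d),
    p = -((m : ℤ) + 1) ∧ w = f • DirectSum.of (KoszulVF d k) m (koszulGen J a)}

theorem mem_closure_pureElements {x : KoszulSum d k} {p : ℤ}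
    (hx : HasDegree (E := KoszulVF d k) p x) :
    x ∈ AddSubmonoid.closure (pureElements d k p) := by
  by_cases hp : ∃ j : ℕ, p = -((j : ℤ) + 1)
  · obtain ⟨j, rfl⟩ := hp
    rw [eq_of_hasDegree hx]
    generalize x j = y
    have h : y ∈ Submodule.span (PolyFun d)
        (Set.range fun x : (Fin (j + 1) → Fin k) × Fin d => koszulGen x.1 x.2) := by
      rw [span_koszulGen]; trivial
    induction h using Submodule.closure_induction with
    | zero => rw [AddMonoidHom.map_zero]; exact zero_mem _
    | add _ _ _ _ hy hz => rw [AddMonoidHom.map_add]; exact add_mem hy hz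
    | smul_mem f _ hy =>
      obtain ⟨⟨J, a⟩, rfl⟩ := hy
      refine AddSubmonoid.subset_closure ⟨j, J, a, f, rfl, ?_⟩
      exact (DirectSum.lof (PolyFun d) ℕ (KoszulVF d k) j).map_smul f (koszulGen J a)
  · have : x = 0 := DFinsupp.ext fun j => hx j fun e => hp ⟨j, e.symm⟩
    rw [this]
    exact zero_mem _

end KoszulLie

namespace KoszulLie

open ExteriorAlgebra

/-! ### Tagged variables -/

section Tags

variable (R : Type*) [CommRing R] {T ι : Type*} [DecidableEq T]

/-- The inclusion of vectors whose variables carry the tag `s`. -/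
def tagLin (s : T) : (ι → R) →ₗ[R] (T × ι → R) :=
  LinearMap.pi fun x => if x.1 = s then LinearMap.proj x.2 else 0

/-- Forgetting tags, on vectors. -/
def untagLin (T ι : Type*) [Fintype T] : (T × ι → R) →ₗ[R] (ι → R) :=
  LinearMap.pi fun c => ∑ s : T, LinearMap.proj (s, c)

/-- The inclusion of the exterior algebra on the variables `μ_c` in the exterior algebra on
tagged variables `μ_{s,c}`, all of its variables getting the tag `s`. -/
def tag (s : T) : ExteriorAlgebra R (ι → R) →ₐ[R] ExteriorAlgebra R (T × ι → R) :=
  ExteriorAlgebra.map (tagLin R s)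

/-- The algebra morphism `μ_{s,c} ↦ μ_c`. -/
def untag (T ι : Type*) [Fintype T] :
    ExteriorAlgebra R (T × ι → R) →ₐ[R] ExteriorAlgebra R (ι → R) :=
  ExteriorAlgebra.map (untagLin R T ι)

variable {R}

theorem dmu_tag (s t : T) (c : ι) (x : ExteriorAlgebra R (ι → R)) :
    dmu R (t, c) (tag R s x) = if t = s then tag R s (dmu R c x) else 0 := by
  rw [dmu, tag, contractLeft_map]
  split_ifs with h
  · have : (LinearMap.proj (t, c) : (T × ι → R) →ₗ[R] R) ∘ₗ tagLin R s = LinearMap.proj c := by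
      refine LinearMap.ext fun v => ?_
      simp [tagLin, h]
    rw [this]; rfl
  · have : (LinearMap.proj (t, c) : (T × ι → R) →ₗ[R] R) ∘ₗ tagLin R s = 0 := by
      refine LinearMap.ext fun v => ?_
      simp [tagLin, h]
    rw [this]; simp

theorem untag_tag [Fintype T] (s : T) (x : ExteriorAlgebra R (ι → R)) :
    untag R T ι (tag R s x) = x := by
  have h : untagLin R T ι ∘ₗ tagLin R s = LinearMap.id := by
    refine LinearMap.ext fun v => funext fun c => ?_
    simp only [untagLin, tagLin, LinearMap.comp_apply, LinearMap.pi_apply, LinearMap.sum_apply,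
      LinearMap.proj_apply, LinearMap.id_apply]
    rw [Finset.sum_eq_single s]
    · simp
    · intro t _ ht; simp [ht]
    · simp
  rw [untag, tag, ← AlgHom.comp_apply, map_comp_map, h, map_id]
  rfl

end Tags

/-- The terms of the Leibniz rule, computed in the exterior algebra on tagged variables: if only the
`l`-th factor involves variables with tags in `B`, and it involves no other variables, then
contracting the `l`-th factor is contracting the whole product. -/
theorem leibnizTerm_untag {R : Type*} [CommRing R] {T ι : Type*} [Fintype T] {m : ℕ}
    (c : ι) (l : Fin m) (B : Finset T)
    (Y : Fin m → ExteriorAlgebra R (T × ι → R))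
    (h1 : ∀ s ∈ B, ∀ t, t ≠ l → dmu R (s, c) (Y t) = 0) (h2 : ∀ s ∉ B, dmu R (s, c) (Y l) = 0) :
    leibnizTerm (LinearMap.proj c) l (fun t => untag R T ι (Y t)) =
      ∑ s ∈ B, untag R T ι (dmu R (s, c) (List.ofFn Y).prod) := by
  have h : (LinearMap.proj c : (ι → R) →ₗ[R] R) ∘ₗ untagLin R T ι =
      ∑ s : T, LinearMap.proj (s, c) := by
    refine LinearMap.ext fun v => ?_
    simp [untagLin]
  rw [untag, map_leibnizTerm, h, leibnizTerm_sum, map_sum]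
  rw [← Finset.sum_subset (Finset.subset_univ B)]
  · refine Finset.sum_congr rfl fun s hs => ?_
    rw [dmu, contractLeft_prod_ofFn, Finset.sum_eq_single l]
    · intro t _ ht
      exact leibnizTerm_eq_zero (h1 s hs t ht)
    · simp
  · intro s _ hs
    rw [leibnizTerm_eq_zero (h2 s hs), map_zero]

/-! ### Iterated derivatives -/

section Brackets

variable {K R : Type*} [CommRing K] [CommRing R] [Algebra K R] {d k : ℕ}
  (D : Fin d → Derivation K R R)

/-- The iterated derivative `∏_{s ∈ S} D_{a(s)}` of `f`. The order of the factors, which is that of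
`S.toList`, does not matter when the derivations `D_a` commute. -/
def pd {T : Type*} (a : T → Fin d) (S : Finset T) (f : R) : R :=
  (S.toList.map a).foldr (fun b g => D b g) f

variable {D}

theorem foldr_perm (hD : ∀ a b f, D a (D b f) = D b (D a f)) {L₁ L₂ : List (Fin d)}
    (h : L₁.Perm L₂) (f : R) :
    L₁.foldr (fun b g => D b g) f = L₂.foldr (fun b g => D b g) f := by
  induction h with
  | nil => rfl
  | cons x _ ih => simp only [List.foldr_cons, ih]
  | swap x y l => simp only [List.foldr_cons, hD]
  | trans _ _ h1 h2 => rw [h1, h2]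

theorem pd_empty {T : Type*} (a : T → Fin d) (f : R) : pd D a ∅ f = f := by
  simp [pd]

theorem pd_insert (hD : ∀ a b f, D a (D b f) = D b (D a f)) {T : Type*} [DecidableEq T]
    (a : T → Fin d) {S : Finset T} {s : T} (hs : s ∉ S) (f : R) :
    pd D a (insert s S) f = D (a s) (pd D a S f) := by
  have h := foldr_perm hD ((Finset.toList_insert hs).map a) f
  rw [pd, h]
  rfl

theorem pd_map (hD : ∀ a b f, D a (D b f) = D b (D a f)) {T T' : Type*}
    (g : T' ↪ T) (a : T → Fin d) (S : Finset T') (f : R) :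
    pd D (fun t => a (g t)) S f = pd D a (S.map g) f := by
  classical
  induction S using Finset.induction_on with
  | empty => simp [pd_empty]
  | insert s S hs ih =>
    rw [pd_insert hD _ hs, Finset.map_insert, pd_insert hD _ (by simpa using hs), ih]

/-! ### Derivatives of coefficients -/

/-- The basis of the exterior algebra given by the products of the variables. -/
abbrev extBasis (R : Type*) [CommRing R] (k : ℕ) :
    Module.Basis (Finset (Fin k)) R (ExteriorAlgebra R (Fin k → R)) :=
  (Pi.basisFun R (Fin k)).ExteriorAlgebra

/-- The derivation `δ`, applied to the coefficients with respect to the basis `μ_J`. -/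
def coefDeriv (δ : Derivation K R R) :
    ExteriorAlgebra R (Fin k → R) →ₗ[K] ExteriorAlgebra R (Fin k → R) where
  toFun x := ∑ s, δ ((extBasis R k).repr x s) • extBasis R k s
  map_add' x y := by
    simp [add_smul, Finset.sum_add_distrib]
  map_smul' c x := by
    rw [← algebraMap_smul R c x, ← algebraMap_smul R (RingHom.id K c), Finset.smul_sum]
    refine Finset.sum_congr rfl fun s _ => ?_
    rw [map_smul, Finsupp.smul_apply, algebraMap_smul, Derivation.map_smul, ← algebraMap_smul R c,
      smul_assoc]
    rfl

theorem coefDeriv_smul (δ : Derivation K R R) (f : R) (x : ExteriorAlgebra R (Fin k → R)) :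
    coefDeriv δ (f • x) = δ f • x + f • coefDeriv δ x := by
  have h : x = ∑ s, (extBasis R k).repr x s • extBasis R k s := ((extBasis R k).sum_repr x).symm
  change ∑ s, δ ((extBasis R k).repr (f • x) s) • extBasis R k s =
    δ f • x + f • ∑ s, δ ((extBasis R k).repr x s) • extBasis R k s
  conv_rhs => rw [h]
  rw [Finset.smul_sum, Finset.smul_sum, ← Finset.sum_add_distrib]
  refine Finset.sum_congr rfl fun s _ => ?_
  rw [map_smul, Finsupp.smul_apply, smul_eq_mul, Derivation.leibniz]
  simp only [h.symm, smul_eq_mul, add_smul, smul_smul]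
  rw [add_comm, mul_comm (δ f)]

theorem coefDeriv_basis (δ : Derivation K R R) (s : Finset (Fin k)) :
    coefDeriv δ (extBasis R k s) = 0 := by
  change ∑ t, δ ((extBasis R k).repr (extBasis R k s) t) • extBasis R k t = 0
  refine Finset.sum_eq_zero fun t _ => ?_
  rw [Module.Basis.repr_self]
  by_cases h : s = t <;> simp [h]

theorem coefDeriv_mu_mul (δ : Derivation K R R) (i : Fin k) (x : ExteriorAlgebra R (Fin k → R)) :
    coefDeriv δ (mu R i * x) = mu R i * coefDeriv δ x := by
  have hmu : mu R i = extBasis R k ({i} : Finset (Fin k)) := by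
    rw [basis_apply_ofCard _ (Finset.card_singleton i), ιMulti_family, ιMulti_apply]
    simp [Set.powersetCard.ofFinEmbEquiv_symm_apply, mu]
  have hb : ∀ s : Finset (Fin k), coefDeriv δ (mu R i * extBasis R k s) = 0 := by
    intro s
    rw [hmu]
    by_cases h : Disjoint ({i} : Finset (Fin k)) s
    · have := basis_mul_of_disjoint (Pi.basisFun R (Fin k))
        (Set.powersetCard.ofCard (Finset.card_singleton i)) (Set.powersetCard.ofCard (s := s) rfl) h
      simp only [Set.powersetCard.val_ofCard] at this
      rw [this, Units.smul_def, map_zsmul, coefDeriv_basis, smul_zero]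
    · have := basis_mul_of_not_disjoint (Pi.basisFun R (Fin k))
        (Set.powersetCard.ofCard (Finset.card_singleton i)) (Set.powersetCard.ofCard (s := s) rfl) h
      simp only [Set.powersetCard.val_ofCard] at this
      rw [this, map_zero]
  rw [← (extBasis R k).sum_repr x]
  simp only [Finset.mul_sum, map_sum, mul_smul_comm, coefDeriv_smul, hb, coefDeriv_basis, smul_zero,
    add_zero]

/-- The elements of the exterior algebra over `R` with coefficients in the base ring `K`, on whose
image all `K`-derivations of `R` vanish. -/
def constants (K R : Type*) [CommRing K] [CommRing R] [Algebra K R] (k : ℕ) :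
    Subalgebra K (ExteriorAlgebra R (Fin k → R)) :=
  Algebra.adjoin K (Set.range (mu R))

theorem coefDeriv_constants_mul (δ : Derivation K R R) {x : ExteriorAlgebra R (Fin k → R)}
    (hx : x ∈ constants K R k) (y : ExteriorAlgebra R (Fin k → R)) :
    coefDeriv δ (x * y) = x * coefDeriv δ y := by
  induction hx using Algebra.adjoin_induction generalizing y with
  | mem x hx => obtain ⟨i, rfl⟩ := hx; exact coefDeriv_mu_mul δ i y
  | algebraMap c => rw [← Algebra.smul_def, map_smul, ← Algebra.smul_def]
  | add x x' _ _ h h' => rw [add_mul, map_add, h, h', add_mul]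
  | mul x x' _ _ h h' => rw [mul_assoc, h, h', mul_assoc]

theorem coefDeriv_constants (δ : Derivation K R R) {x : ExteriorAlgebra R (Fin k → R)}
    (hx : x ∈ constants K R k) : coefDeriv δ x = 0 := by
  have h1 : coefDeriv δ (1 : ExteriorAlgebra R (Fin k → R)) = 0 := by
    have : (1 : ExteriorAlgebra R (Fin k → R)) = extBasis R k (∅ : Finset (Fin k)) := by
      rw [basis_apply_ofCard _ Finset.card_empty, ιMulti_family, ιMulti_zero_apply]
    rw [this, coefDeriv_basis]
  rw [← mul_one x, coefDeriv_constants_mul δ hx, h1, mul_zero]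

theorem involute_mem_constants {x : ExteriorAlgebra R (Fin k → R)} (hx : x ∈ constants K R k) :
    CliffordAlgebra.involute x ∈ constants K R k := by
  induction hx using Algebra.adjoin_induction with
  | mem x hx =>
    obtain ⟨i, rfl⟩ := hx
    rw [mu, CliffordAlgebra.involute_ι]
    exact neg_mem (Algebra.subset_adjoin ⟨i, rfl⟩)
  | algebraMap c =>
    have : algebraMap K (ExteriorAlgebra R (Fin k → R)) c =
        algebraMap R _ (algebraMap K R c) := IsScalarTower.algebraMap_apply _ _ _ _
    rw [this, AlgHom.commutes, ← this]
    exact Subalgebra.algebraMap_mem _ _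
  | add x x' _ _ h h' => rw [map_add]; exact add_mem h h'
  | mul x x' _ _ h h' => rw [map_mul]; exact mul_mem h h'

theorem dmu_mem_constants (c : Fin k) {x : ExteriorAlgebra R (Fin k → R)}
    (hx : x ∈ constants K R k) : dmu R c x ∈ constants K R k := by
  induction hx using Algebra.adjoin_induction with
  | mem x hx =>
    obtain ⟨i, rfl⟩ := hx
    have h := dmu_mu_mul (R := R) c i 1
    rw [mul_one] at h
    have h1 : dmu R c (1 : ExteriorAlgebra R (Fin k → R)) = 0 :=
      CliffordAlgebra.contractLeft_one _ _
    rw [h, h1, mul_zero, sub_zero]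
    split_ifs
    · exact one_mem _
    · exact zero_mem _
  | algebraMap c' =>
    have : algebraMap K (ExteriorAlgebra R (Fin k → R)) c' =
        algebraMap R _ (algebraMap K R c') := IsScalarTower.algebraMap_apply _ _ _ _
    have h : dmu R c (algebraMap K (ExteriorAlgebra R (Fin k → R)) c') = 0 := by
      rw [this]; exact CliffordAlgebra.contractLeft_algebraMap _ _ _
    rw [h]
    exact zero_mem _
  | add x x' _ _ h h' => rw [map_add]; exact add_mem h h'
  | mul x x' hx hx' h h' =>
    have e : dmu R c (x * x') = dmu R c x * x' + CliffordAlgebra.involute x * dmu R c x' :=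
      contractLeft_mul _ _ _
    rw [e]
    exact add_mem (mul_mem h hx') (mul_mem (involute_mem_constants hx) h')

theorem leibnizTerm_mem_constants {m : ℕ} (c : Fin k) (l : Fin m)
    {Y : Fin m → ExteriorAlgebra R (Fin k → R)} (hY : ∀ s, Y s ∈ constants K R k) :
    leibnizTerm (LinearMap.proj c) l Y ∈ constants K R k := by
  refine list_prod_mem fun x hx => ?_
  obtain ⟨s, rfl⟩ := List.mem_ofFn.mp hx
  split_ifs
  · exact involute_mem_constants (hY s)
  · exact dmu_mem_constants c (hY s)
  · exact hY s

end Brackets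
end KoszulLie

/-! ### The brackets in coordinates -/

namespace KoszulLie

open ExteriorAlgebra

section Brackets

variable {K R : Type*} [CommRing K] [CommRing R] [Algebra K R] {d k : ℕ}

/-- The tuple `(v_b z)_b`, which stands for `z ⊗ ∑ v_b ∂/∂x_b`. -/
def vecMul (R : Type*) [CommRing R] (d k : ℕ) :
    (Fin d → R) →ₗ[R] ExteriorAlgebra R (Fin k → R) →ₗ[R] Fin d → ExteriorAlgebra R (Fin k → R) :=
  LinearMap.mk₂ R (fun v z b => v b • z)
    (fun _ _ _ => funext fun _ => add_smul _ _ _) (fun _ _ _ => funext fun _ => mul_smul _ _ _)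
    (fun _ _ _ => funext fun _ => smul_add _ _ _) (fun _ _ _ => funext fun _ => smul_comm _ _ _)

theorem vecMul_apply (v : Fin d → R) (z : ExteriorAlgebra R (Fin k → R)) (b : Fin d) :
    vecMul R d k v z b = v b • z := rfl

theorem vecMul_single (a : Fin d) (r : R) (z : ExteriorAlgebra R (Fin k → R)) :
    vecMul R d k (Pi.single a r) z = r • Pi.single a z := by
  funext b
  by_cases h : b = a
  · subst h; simp [vecMul_apply]
  · simp [vecMul_apply, h]

variable (R) in
/-- The `l`-th term of the Leibniz rule for `∂/∂μ_c`, as a multilinear map of the factors. -/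
def leibnizMultilinear {m : ℕ} (l : Fin m) (c : Fin k) :
    MultilinearMap R (fun _ : Fin m => ExteriorAlgebra R (Fin k → R))
      (ExteriorAlgebra R (Fin k → R)) :=
  (MultilinearMap.mkPiAlgebraFin R m (ExteriorAlgebra R (Fin k → R))).compLinearMap fun s =>
    if s < l then CliffordAlgebra.involute.toLinearMap else if s = l then dmu R c else LinearMap.id

theorem leibnizMultilinear_apply {m : ℕ} (l : Fin m) (c : Fin k)
    (Y : Fin m → ExteriorAlgebra R (Fin k → R)) :
    leibnizMultilinear R l c Y = leibnizTerm (LinearMap.proj c) l Y := by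
  rw [leibnizMultilinear, MultilinearMap.compLinearMap_apply, MultilinearMap.mkPiAlgebraFin_apply,
    leibnizTerm]
  congr 2
  funext s
  split_ifs <;> rfl

variable (D : Fin d → Derivation K R R) (φ : Fin k → R)

/-- The `O`-multilinear part of the `m`-ary bracket, given by the explicit formula. -/
def linPart (m : ℕ) :
    MultilinearMap R (fun _ : Fin m => Fin d → ExteriorAlgebra R (Fin k → R))
      (Fin d → ExteriorAlgebra R (Fin k → R)) :=
  ∑ a : Fin m → Fin d, ∑ l : Fin m, ∑ c : Fin k,
    ((-1) ^ (m - 1) * pd D a (Finset.univ.erase l) (φ c)) •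
      (LinearMap.single R (fun _ => ExteriorAlgebra R (Fin k → R)) (a l)).compMultilinearMap
        ((leibnizMultilinear R l c).compLinearMap fun s => LinearMap.proj (a s))

theorem linPart_pure {m : ℕ} (f : Fin m → R) (a : Fin m → Fin d)
    (X : Fin m → ExteriorAlgebra R (Fin k → R)) :
    linPart D φ m (fun s => f s • Pi.single (a s) (X s)) = ∑ l, ∑ c,
      vecMul R d k (Pi.single (a l)
        ((-1) ^ (m - 1) * (∏ s, f s) * pd D a (Finset.univ.erase l) (φ c)))
        (leibnizTerm (LinearMap.proj c) l X) := by
  rw [MultilinearMap.map_smul_univ]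
  simp only [linPart, sum_apply, smul_apply,
    LinearMap.compMultilinearMap_apply, MultilinearMap.compLinearMap_apply]
  rw [Finset.sum_eq_single a]
  · rw [Finset.smul_sum]
    refine Finset.sum_congr rfl fun l _ => ?_
    rw [Finset.smul_sum]
    refine Finset.sum_congr rfl fun c _ => ?_
    rw [vecMul_single, leibnizMultilinear_apply, smul_smul]
    simp only [LinearMap.proj_apply, Pi.single_eq_same, LinearMap.single_apply]
    congr 1
    ring
  · intro a' _ ha'
    obtain ⟨s, hs⟩ := Function.ne_iff.mp ha'
    refine Finset.sum_eq_zero fun l _ => Finset.sum_eq_zero fun c _ => ?_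
    rw [MultilinearMap.map_coord_zero _ s (by simp [hs]), map_zero, smul_zero]
  · simp

/-- The coefficients of the anchor `∂ ⊗ id : 𝒦_{-1} ⊗ Der(O) → Der(O)`, extended by zero. -/
def anchorCoeff : (Fin d → ExteriorAlgebra R (Fin k → R)) →ₗ[R] Fin d → R :=
  LinearMap.pi fun a => algebraMapInv.toLinearMap ∘ₗ koszulD φ ∘ₗ LinearMap.proj a

theorem anchorCoeff_apply (ξ : Fin d → ExteriorAlgebra R (Fin k → R)) (a : Fin d) :
    anchorCoeff φ ξ a = algebraMapInv (koszulD φ (ξ a)) := rfl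

/-- The derivative of the coefficients of `η` along the anchor of `ξ`. -/
def anchorDeriv (ξ η : Fin d → ExteriorAlgebra R (Fin k → R)) :
    Fin d → ExteriorAlgebra R (Fin k → R) :=
  fun b => ∑ a, anchorCoeff φ ξ a • coefDeriv (D a) (η b)

theorem anchorDeriv_add_left (ξ ξ' η : Fin d → ExteriorAlgebra R (Fin k → R)) :
    anchorDeriv D φ (ξ + ξ') η = anchorDeriv D φ ξ η + anchorDeriv D φ ξ' η := by
  funext b
  simp [anchorDeriv, add_smul, Finset.sum_add_distrib]

theorem anchorDeriv_add_right (ξ η η' : Fin d → ExteriorAlgebra R (Fin k → R)) :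
    anchorDeriv D φ ξ (η + η') = anchorDeriv D φ ξ η + anchorDeriv D φ ξ η' := by
  funext b
  simp [anchorDeriv, smul_add, Finset.sum_add_distrib]

theorem anchorDeriv_smul_left (r : R) (ξ η : Fin d → ExteriorAlgebra R (Fin k → R)) :
    anchorDeriv D φ (r • ξ) η = r • anchorDeriv D φ ξ η := by
  funext b
  simp [anchorDeriv, Finset.smul_sum, smul_smul]

theorem anchorDeriv_smul_right (r : R) (ξ η : Fin d → ExteriorAlgebra R (Fin k → R)) :
    anchorDeriv D φ ξ (r • η) =
      (∑ a, anchorCoeff φ ξ a * D a r) • η + r • anchorDeriv D φ ξ η := by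
  funext b
  change ∑ a, anchorCoeff φ ξ a • coefDeriv (D a) (r • η b) =
    (∑ a, anchorCoeff φ ξ a * D a r) • η b + r • ∑ a, anchorCoeff φ ξ a • coefDeriv (D a) (η b)
  simp only [coefDeriv_smul, smul_add, Finset.sum_add_distrib, Finset.smul_sum, Finset.sum_smul,
    smul_smul]
  simp only [mul_comm r]

theorem anchorDeriv_smul_left' (c : K) (ξ η : Fin d → ExteriorAlgebra R (Fin k → R)) :
    anchorDeriv D φ (c • ξ) η = c • anchorDeriv D φ ξ η := by
  rw [← algebraMap_smul R c ξ, anchorDeriv_smul_left, algebraMap_smul]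

theorem anchorDeriv_smul_right' (c : K) (ξ η : Fin d → ExteriorAlgebra R (Fin k → R)) :
    anchorDeriv D φ ξ (c • η) = c • anchorDeriv D φ ξ η := by
  rw [← algebraMap_smul R c η, anchorDeriv_smul_right, algebraMap_smul]
  simp

theorem anchorDeriv_single {ξ : Fin d → ExteriorAlgebra R (Fin k → R)} (a : Fin d)
    {X : ExteriorAlgebra R (Fin k → R)} (hX : X ∈ constants K R k) :
    anchorDeriv D φ ξ (Pi.single a X) = 0 := by
  funext b
  refine Finset.sum_eq_zero fun c _ => ?_
  by_cases h : b = a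
  · subst h; rw [Pi.single_eq_same, coefDeriv_constants _ hX, smul_zero]
  · rw [Pi.single_eq_of_ne h, map_zero, smul_zero]

/-- The grade involution on the tuples of elements of the exterior algebra. -/
def involuteF : (Fin d → ExteriorAlgebra R (Fin k → R)) →ₗ[R]
    Fin d → ExteriorAlgebra R (Fin k → R) :=
  LinearMap.pi fun a => CliffordAlgebra.involute.toLinearMap ∘ₗ LinearMap.proj a

theorem involuteF_single (a : Fin d) (X : ExteriorAlgebra R (Fin k → R)) :
    involuteF (Pi.single a X) = Pi.single a (CliffordAlgebra.involute X) := by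
  funext b
  by_cases h : b = a
  · subst h; simp [involuteF]
  · simp [involuteF, h]

/-- The part of the binary bracket which differentiates the coefficients; it is not
`O`-bilinear. The second term is the first one with the arguments exchanged; as the anchor only
sees elements of degree one, the Koszul sign is accounted for by the grade involution. -/
def derivPart : MultilinearMap K (fun _ : Fin 2 => Fin d → ExteriorAlgebra R (Fin k → R))
    (Fin d → ExteriorAlgebra R (Fin k → R)) :=
  MultilinearMap.mk'
    (fun v => anchorDeriv D φ (v 0) (v 1) + anchorDeriv D φ (v 1) (involuteF (v 0)))
    (by
      intro v i x y
      fin_cases i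
      · simp [anchorDeriv_add_left, anchorDeriv_add_right]; abel
      · simp [anchorDeriv_add_left, anchorDeriv_add_right]; abel)
    (by
      have hinv : ∀ (c : K) (ξ : Fin d → ExteriorAlgebra R (Fin k → R)),
          involuteF (c • ξ) = c • involuteF ξ := by
        intro c ξ
        rw [← algebraMap_smul R c ξ, map_smul, algebraMap_smul]
      intro v i c x
      fin_cases i
      · simp [anchorDeriv_smul_left', anchorDeriv_smul_right', hinv]
      · simp [anchorDeriv_smul_left', anchorDeriv_smul_right'])

theorem derivPart_apply (v : Fin 2 → Fin d → ExteriorAlgebra R (Fin k → R)) :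
    derivPart D φ v = anchorDeriv D φ (v 0) (v 1) + anchorDeriv D φ (v 1) (involuteF (v 0)) := rfl

/-- The part of the `m`-ary bracket which differentiates the coefficients. -/
def corrPart : (m : ℕ) → MultilinearMap K
    (fun _ : Fin m => Fin d → ExteriorAlgebra R (Fin k → R))
    (Fin d → ExteriorAlgebra R (Fin k → R))
  | 2 => derivPart D φ
  | _ => 0

theorem corrPart_of_ne {m : ℕ} (hm : m ≠ 2) : corrPart D φ m = 0 := by
  match m, hm with
  | 0, _ => rfl
  | 1, _ => rfl
  | m + 3, _ => rfl

/-- The `m`-ary bracket on `𝒦 ⊗ Der(O)`, in coordinates. It may have components of degree `0`, which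
are discarded in the bracket on `⨁_{j ≥ 1} 𝒦_{-j} ⊗ Der(O)`. -/
def fullBracket (m : ℕ) : MultilinearMap K
    (fun _ : Fin m => Fin d → ExteriorAlgebra R (Fin k → R))
    (Fin d → ExteriorAlgebra R (Fin k → R)) :=
  (linPart D φ m).restrictScalars K + corrPart D φ m

theorem fullBracket_apply (m : ℕ) (v : Fin m → Fin d → ExteriorAlgebra R (Fin k → R)) :
    fullBracket D φ m v = linPart D φ m v + corrPart D φ m v := rfl

/-- The coefficients of the bracket of the elements `f_s X_s ⊗ ∂_{a(s)}`, `s ∈ S`, where `X_s` has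
degree `dg s`: the coefficient of `p = (l, c)` and `l'` belongs to the contraction of `X_l` by
`∂/∂μ_c` and to the vector field `∂_{a(l')}`. -/
def coef {T : Type*} [DecidableEq T] (S : Finset T) (f : T → R) (a : T → Fin d) (dg : T → ℕ)
    (p : T × Fin k) (l' : T) : R :=
  if l' = p.1 then (-1) ^ (S.card - 1) * (∏ s ∈ S, f s) * pd D a (S.erase p.1) (φ p.2)
  else if S.card = 2 ∧ dg p.1 = 1 then f p.1 * φ p.2 * D (a p.1) (f l') else 0

variable {D φ}

/-- The contraction of an element of degree one is a scalar. -/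
theorem algebraMapInv_dmu_smul {i : ℕ} {X : ExteriorAlgebra R (Fin k → R)} (hi : 1 ≤ i)
    (hX : X ∈ ⋀[R]^i (Fin k → R)) (c : Fin k) (Y : ExteriorAlgebra R (Fin k → R)) :
    algebraMapInv (dmu R c X) • Y = if i = 1 then dmu R c X * Y else 0 := by
  obtain _ | _ | i := i
  · omega
  · rw [if_pos rfl]
    have h := mem_exteriorPower_zero_iff.mp (contractLeft_mem_exteriorPower (LinearMap.proj c) hX)
    change dmu R c X = _ at h
    rw [Algebra.smul_def]
    exact congrArg (· * Y) h.symm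
  · rw [if_neg (by omega)]
    have h := algebraMapInv_of_mem (contractLeft_mem_exteriorPower (LinearMap.proj c) hX)
    change algebraMapInv (dmu R c X) = 0 at h
    rw [h, zero_smul]

theorem anchorDeriv_pure {f g : R} {a b : Fin d} {X Y : ExteriorAlgebra R (Fin k → R)}
    {i : ℕ} (hi : 1 ≤ i) (hX : X ∈ ⋀[R]^i (Fin k → R)) (hY : Y ∈ constants K R k) :
    anchorDeriv D φ (f • Pi.single a X) (g • Pi.single b Y) =
      ∑ c, if i = 1 then vecMul R d k (Pi.single b (f * φ c * D a g)) (dmu R c X * Y) else 0 := by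
  rw [anchorDeriv_smul_right, anchorDeriv_single D φ b hY, smul_zero, add_zero,
    Finset.sum_eq_single a]
  · have h : anchorCoeff φ (f • Pi.single a X) a = ∑ c, f * φ c * algebraMapInv (dmu R c X) := by
      rw [map_smul, Pi.smul_apply, anchorCoeff_apply, Pi.single_eq_same, koszulD]
      simp [Finset.mul_sum, mul_assoc]
    rw [h, Finset.sum_mul, Finset.sum_smul]
    refine Finset.sum_congr rfl fun c _ => ?_
    have h' := algebraMapInv_dmu_smul hi hX c Y
    have e : (f * φ c * algebraMapInv (dmu R c X) * D a g) • (Pi.single b Y : Fin d → _) =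
        (f * φ c * D a g) • Pi.single b (algebraMapInv (dmu R c X) • Y) := by
      rw [Pi.single_smul, smul_smul]
      congr 1
      ring
    rw [e, h', vecMul_single]
    split_ifs
    · rfl
    · simp
  · intro c _ hc
    rw [map_smul, Pi.smul_apply, anchorCoeff_apply, Pi.single_eq_of_ne hc]
    simp
  · simp

/-- The bracket of the elements `f_s X_s ⊗ ∂_{a(s)}`, where `X_s` has constant coefficients. The
derivative of `f_{l'}` along the anchor of the `l`-th element multiplies the same contraction of
`∏ X_s` as the explicit formula, since `X_l` has degree one when its anchor does not vanish. -/
theorem fullBracket_pure {m : ℕ} (f : Fin m → R) (a : Fin m → Fin d) {dg : Fin m → ℕ}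
    (hdg : ∀ s, 1 ≤ dg s) {X : Fin m → ExteriorAlgebra R (Fin k → R)}
    (hX : ∀ s, X s ∈ ⋀[R]^(dg s) (Fin k → R)) (hX' : ∀ s, X s ∈ constants K R k) :
    fullBracket D φ m (fun s => f s • Pi.single (a s) (X s)) =
      ∑ p : Fin m × Fin k, ∑ l', vecMul R d k
        (Pi.single (a l') (coef D φ Finset.univ f a dg p l'))
        (leibnizTerm (LinearMap.proj p.2) p.1 X) := by
  -- the terms with `l' ≠ l` come from `corrPart`, those with `l' = l` from `linPart`
  have hcorr : corrPart D φ m (fun s => f s • Pi.single (a s) (X s)) =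
      ∑ l, ∑ c, ∑ l' ∈ Finset.univ.erase l, vecMul R d k
        (Pi.single (a l') (coef D φ Finset.univ f a dg (l, c) l'))
        (leibnizTerm (LinearMap.proj c) l X) := by
    by_cases hm : m = 2
    · subst hm
      have e0 : (Finset.univ : Finset (Fin 2)).erase 0 = {1} := rfl
      have e1 : (Finset.univ : Finset (Fin 2)).erase 1 = {0} := rfl
      have hl0 : ∀ c, leibnizTerm (LinearMap.proj c) 0 X = dmu R c (X 0) * X 1 := by
        intro c; rw [leibnizTerm_zero]; simp [dmu]
      have hl1 : ∀ c, leibnizTerm (LinearMap.proj c) 1 X =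
          dmu R c (X 1) * CliffordAlgebra.involute (X 0) ∨ dg 1 ≠ 1 := by
        intro c
        by_cases h : dg 1 = 1
        · left
          have h1 := hX 1
          rw [h] at h1
          have hs := mem_exteriorPower_zero_iff.mp
            (contractLeft_mem_exteriorPower (LinearMap.proj c) h1)
          have : leibnizTerm (LinearMap.proj c) 1 X =
              CliffordAlgebra.involute (X 0) * dmu R c (X 1) := by
            have := leibnizTerm_succ (LinearMap.proj c) 0 X
            rw [leibnizTerm_zero] at this
            simpa [dmu] using this
          rw [this]
          change dmu R c (X 1) = _ at hs
          rw [hs, Algebra.commutes]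
        · right; exact h
      change derivPart D φ _ = _
      rw [derivPart_apply, map_smul, involuteF_single,
        anchorDeriv_pure (hdg 0) (hX 0) (hX' 1),
        anchorDeriv_pure (hdg 1) (hX 1) (involute_mem_constants (hX' 0)), Fin.sum_univ_two, e0, e1]
      simp only [Finset.sum_singleton]
      congr 1
      · refine Finset.sum_congr rfl fun c _ => ?_
        rw [hl0]
        by_cases h : dg 0 = 1 <;> simp [coef, h]
      · refine Finset.sum_congr rfl fun c _ => ?_
        by_cases h : dg 1 = 1
        · rw [(hl1 c).resolve_right (not_not.mpr h)]
          simp [coef, h]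
        · simp [coef, h]
    · rw [corrPart_of_ne D φ hm]
      symm
      refine Finset.sum_eq_zero fun l _ => Finset.sum_eq_zero fun c _ =>
        Finset.sum_eq_zero fun l' hl' => ?_
      simp [coef, Finset.ne_of_mem_erase hl', hm]
  rw [fullBracket_apply, linPart_pure, hcorr, Fintype.sum_prod_type, ← Finset.sum_add_distrib]
  refine Finset.sum_congr rfl fun l _ => ?_
  rw [← Finset.sum_add_distrib]
  refine Finset.sum_congr rfl fun c _ => ?_
  rw [← Finset.add_sum_erase _ _ (Finset.mem_univ l)]
  simp [coef]

end Brackets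
end KoszulLie

/-! ### Iterated brackets of pure elements -/

namespace KoszulLie

open ExteriorAlgebra

section Brackets

variable {K R : Type*} [CommRing K] [CommRing R] [Algebra K R] {d k : ℕ}
  {D : Fin d → Derivation K R R} {φ : Fin k → R}

theorem coef_map (hD : ∀ a b f, D a (D b f) = D b (D a f)) {T T' : Type*} [DecidableEq T]
    [DecidableEq T'] (g : T' ↪ T) (S : Finset T') (f : T → R) (a : T → Fin d) (dg : T → ℕ)
    (l : T') (c : Fin k) (l' : T') :
    coef D φ S (fun t => f (g t)) (fun t => a (g t)) (fun t => dg (g t)) (l, c) l' =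
      coef D φ (S.map g) f a dg (g l, c) (g l') := by
  simp only [coef, Finset.card_map, Finset.prod_map, pd_map hD, Finset.map_erase,
    g.injective.eq_iff]

/-- The bracket of the elements `f_o X_o ⊗ ∂_{a(o)}`, `o ∈ S`, when `X_o` is obtained by forgetting
the tags in `Y_o`, and `Y_o` only involves variables with tags `s` such that `own s = o`. All the
contractions that occur are contractions of the product of the `Y_o`. -/
theorem fullBracket_untag (hD : ∀ a b f, D a (D b f) = D b (D a f)) {T T' : Type*} [Fintype T]
    [DecidableEq T'] {m : ℕ} (h : Fin m ↪ T') (own : T → T') (f : T' → R) (a : T' → Fin d)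
    {dg : T' → ℕ} {Y : T' → ExteriorAlgebra R (T × Fin k → R)}
    (hY : ∀ t s c, own s ≠ h t → dmu R (s, c) (Y (h t)) = 0)
    (hdg : ∀ t, 1 ≤ dg (h t)) (hX : ∀ t, untag R T _ (Y (h t)) ∈ ⋀[R]^(dg (h t)) (Fin k → R))
    (hX' : ∀ t, untag R T _ (Y (h t)) ∈ constants K R k) :
    fullBracket D φ m (fun t => f (h t) • Pi.single (a (h t)) (untag R T _ (Y (h t)))) =
      ∑ q : T × Fin k, if own q.1 ∈ Finset.univ.map h then ∑ l' ∈ Finset.univ.map h, vecMul R d k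
        (Pi.single (a l') (coef D φ (Finset.univ.map h) f a dg (own q.1, q.2) l'))
        (untag R T _ (dmu R q (List.ofFn fun t => Y (h t)).prod)) else 0 := by
  classical
  rw [fullBracket_pure (fun t => f (h t)) (fun t => a (h t)) hdg hX hX', Fintype.sum_prod_type,
    Fintype.sum_prod_type, Finset.sum_comm, Finset.sum_comm (s := (Finset.univ : Finset T))]
  refine Finset.sum_congr rfl fun c _ => ?_
  have h1 : ∀ l : Fin m, leibnizTerm (LinearMap.proj c) l (fun t => untag R T _ (Y (h t))) =
      ∑ s, if own s = h l then
        untag R T _ (dmu R (s, c) (List.ofFn fun t => Y (h t)).prod) else 0 := by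
    intro l
    rw [leibnizTerm_untag c l (Finset.univ.filter fun s => own s = h l) (fun t => Y (h t)),
      Finset.sum_filter]
    · intro s hs t ht
      refine hY _ _ _ ?_
      rw [(Finset.mem_filter.mp hs).2]
      exact fun e => ht (h.injective e).symm
    · intro s hs
      refine hY _ _ _ fun e => hs ?_
      simp [e]
  simp only [h1, map_sum, coef_map hD h Finset.univ f a dg]
  calc _ = ∑ l : Fin m, ∑ s, if own s = h l then ∑ l' ∈ Finset.univ.map h, vecMul R d k
        (Pi.single (a l') (coef D φ (Finset.univ.map h) f a dg (own s, c) l'))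
        (untag R T _ (dmu R (s, c) (List.ofFn fun t => Y (h t)).prod)) else 0 := by
        refine Finset.sum_congr rfl fun l _ => ?_
        rw [Finset.sum_comm]
        refine Finset.sum_congr rfl fun s _ => ?_
        split_ifs with e
        · rw [e, Finset.sum_map]
        · simp
    _ = _ := by
        rw [Finset.sum_comm]
        refine Finset.sum_congr rfl fun s _ => ?_
        split_ifs with e
        · obtain ⟨l, -, hl⟩ := Finset.mem_map.mp e
          rw [Finset.sum_eq_single l, if_pos hl.symm]
          · intro l' _ hl'
            exact if_neg fun e' => hl' (h.injective (e'.symm.trans hl.symm))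
          · simp
        · refine Finset.sum_eq_zero fun l _ => if_neg fun e' => e ?_
          rw [e']
          exact Finset.mem_map_of_mem _ (Finset.mem_univ _)

variable (R d k) in
/-- The projection of `𝒦 ⊗ Der(O)` which removes the component of degree `0`, in coordinates. -/
def reduce : (Fin d → ExteriorAlgebra R (Fin k → R)) →ₗ[R]
    Fin d → ExteriorAlgebra R (Fin k → R) :=
  LinearMap.pi fun a => (LinearMap.id - Algebra.linearMap R _ ∘ₗ algebraMapInv.toLinearMap) ∘ₗ
    LinearMap.proj a

theorem reduce_apply (ξ : Fin d → ExteriorAlgebra R (Fin k → R)) (a : Fin d) :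
    reduce R d k ξ a = ξ a - algebraMap _ _ (algebraMapInv (ξ a)) := rfl

theorem reduce_vecMul_of_mem_succ (v : Fin d → R) {i : ℕ} {z : ExteriorAlgebra R (Fin k → R)}
    (hz : z ∈ ⋀[R]^(i + 1) (Fin k → R)) :
    reduce R d k (vecMul R d k v z) = vecMul R d k v z := by
  funext a
  rw [reduce_apply, vecMul_apply, map_smul, algebraMapInv_of_mem hz, smul_zero, map_zero, sub_zero]

theorem reduce_vecMul_of_mem_zero (v : Fin d → R) {z : ExteriorAlgebra R (Fin k → R)}
    (hz : z ∈ ⋀[R]^0 (Fin k → R)) : reduce R d k (vecMul R d k v z) = 0 := by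
  funext a
  rw [reduce_apply, vecMul_apply, map_smul, smul_eq_mul, map_mul,
    ← mem_exteriorPower_zero_iff.mp hz, Algebra.smul_def, sub_self]
  rfl

/-- The block of a tag, when the tags in `S` are merged into one block. -/
def mergedBlock {T : Type*} [DecidableEq T] (S : Finset T) (s : T) : Option T :=
  if s ∈ S then none else some s

/-- The coefficients of the iterated bracket `ℓ(ℓ(x_s, s ∈ S), x_s, s ∉ S)` of the elements
`x_s = f_s X_s ⊗ ∂_{a(s)}` which belong to the contraction of the product of all the `X_s` by
`p`, in the inner bracket, and by `q`, in the outer one. -/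
def iterCoef (D : Fin d → Derivation K R R) (φ : Fin k → R) {T : Type*} [Fintype T] [DecidableEq T]
    (f : T → R) (a : T → Fin d) (dg : T → ℕ) (S : Finset T) (p q : T × Fin k) : Fin d → R :=
  ∑ l ∈ S, ∑ l' ∈ Finset.insertNone Sᶜ, Pi.single (l'.elim (a l) a)
    (coef D φ (Finset.insertNone Sᶜ) (fun o => o.elim (coef D φ S f a dg p l) f)
      (fun o => o.elim (a l) a) (fun o => o.elim (∑ s ∈ S, dg s - 1) dg)
      (mergedBlock S q.1, q.2) l')

/-- The iterated bracket `ℓ(ℓ(x_{g(1)}, …), x_{h(1)}, …)` of the elements `x_s = f_s X_s ⊗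
∂_{a(s)}`, as a combination of iterated contractions of the product of all the `X_s`. It vanishes
if the elements of the inner bracket have total degree one, since the inner bracket then has degree
zero and is discarded. -/
theorem jacobi_term (hD : ∀ a b f, D a (D b f) = D b (D a f)) {T : Type*} [Fintype T]
    [DecidableEq T] {m r : ℕ} (hm : 0 < m) (g : Fin m ↪ T) (h : Fin r ↪ T)
    (hgh : Finset.univ.map h = (Finset.univ.map g)ᶜ)
    (f : T → R) (a : T → Fin d) {dg : T → ℕ} (hdg : ∀ s, 1 ≤ dg s)
    {X : T → ExteriorAlgebra R (Fin k → R)}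
    (hX : ∀ s, X s ∈ ⋀[R]^(dg s) (Fin k → R)) (hX' : ∀ s, X s ∈ constants K R k) :
    fullBracket D φ (r + 1) (Fin.cons
      (reduce R d k (fullBracket D φ m (fun t => f (g t) • Pi.single (a (g t)) (X (g t)))))
      (fun t => f (h t) • Pi.single (a (h t)) (X (h t)))) =
    if ∑ s ∈ Finset.univ.map g, dg s = 1 then 0 else
      ∑ p : T × Fin k, if p.1 ∈ Finset.univ.map g then ∑ q : T × Fin k,
        vecMul R d k (iterCoef D φ f a dg (Finset.univ.map g) p q)
          (untag R T _ (dmu R q (dmu R p ((List.ofFn fun t => tag R (g t) (X (g t))).prod *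
            (List.ofFn fun t => tag R (h t) (X (h t))).prod)))) else 0 := by
  classical
  set S := Finset.univ.map g with hS
  set Wg := (List.ofFn fun t => tag R (g t) (X (g t))).prod with hWg
  set Wh := (List.ofFn fun t => tag R (h t) (X (h t))).prod with hWh
  have hdegS : ∑ s ∈ S, dg s = ∑ t, dg (g t) := by rw [hS, Finset.sum_map]
  have hWgdeg : Wg ∈ ⋀[R]^(∑ s ∈ S, dg s) (T × Fin k → R) := by
    rw [hdegS]
    exact prod_ofFn_mem_exteriorPower fun t => map_mem_exteriorPower _ (hX (g t))
  have hSpos : 1 ≤ ∑ s ∈ S, dg s := by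
    rw [hdegS]
    exact (hdg _).trans (Finset.single_le_sum (f := fun t => dg (g t)) (fun _ _ => Nat.zero_le _)
      (Finset.mem_univ (⟨0, hm⟩ : Fin m)))
  obtain ⟨e, he⟩ : ∃ e, ∑ s ∈ S, dg s = e + 1 := ⟨_, (Nat.sub_add_cancel hSpos).symm⟩
  have hDWg : ∀ p : T × Fin k, untag R T _ (dmu R p Wg) ∈ ⋀[R]^e (Fin k → R) := by
    intro p
    rw [he] at hWgdeg
    exact map_mem_exteriorPower _ (contractLeft_mem_exteriorPower _ hWgdeg)
  have hDprod : ∀ (r : ℕ) (h : Fin r ↪ T) (p : T × Fin k), p.1 ∉ Finset.univ.map h →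
      dmu R p (List.ofFn fun t => tag R (h t) (X (h t))).prod = 0 := by
    intro r h p hp
    rw [dmu, contractLeft_prod_ofFn]
    refine Finset.sum_eq_zero fun l _ => leibnizTerm_eq_zero ?_
    refine (dmu_tag (h l) p.1 p.2 (X (h l))).trans (if_neg fun e => hp ?_)
    rw [e]
    exact Finset.mem_map_of_mem _ (Finset.mem_univ _)
  have hDWgc : ∀ p : T × Fin k, p.1 ∈ S → untag R T _ (dmu R p Wg) ∈ constants K R k := by
    intro p hp
    obtain ⟨l, -, hl⟩ := Finset.mem_map.mp hp
    have := leibnizTerm_untag (R := R) p.2 l {p.1} (fun t => tag R (g t) (X (g t)))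
      (by
        intro s hs t ht
        rw [Finset.mem_singleton] at hs
        rw [dmu_tag, if_neg]
        rw [hs, ← hl]
        exact fun e => ht (g.injective e).symm)
      (by
        intro s hs
        rw [Finset.mem_singleton] at hs
        rw [dmu_tag, if_neg]
        rw [hl]
        exact hs)
    rw [Finset.sum_singleton] at this
    change _ = untag R T _ (dmu R p Wg) at this
    rw [← this]
    exact leibnizTerm_mem_constants _ _ fun t => by rw [untag_tag]; exact hX' _
  -- the inner bracket
  have hinner : fullBracket D φ m (fun t => f (g t) • Pi.single (a (g t)) (X (g t))) =
      ∑ p : T × Fin k, if p.1 ∈ S then ∑ l ∈ S, vecMul R d k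
        (Pi.single (a l) (coef D φ S f a dg p l)) (untag R T _ (dmu R p Wg)) else 0 := by
    have := fullBracket_untag (φ := φ) hD g id f a (dg := dg) (Y := fun s => tag R s (X s))
      (fun t s c hs => (dmu_tag (g t) s c (X (g t))).trans (if_neg hs))
      (fun _ => hdg _) (fun _ => by rw [untag_tag]; exact hX _)
      (fun _ => by rw [untag_tag]; exact hX' _)
    simp only [untag_tag, id] at this
    exact this
  rw [hinner]
  split_ifs with hS1
  · have : reduce R d k (∑ p : T × Fin k, if p.1 ∈ S then ∑ l ∈ S, vecMul R d k
        (Pi.single (a l) (coef D φ S f a dg p l)) (untag R T _ (dmu R p Wg)) else 0) = 0 := by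
      rw [map_sum]
      refine Finset.sum_eq_zero fun p _ => ?_
      split_ifs
      · rw [map_sum]
        refine Finset.sum_eq_zero fun l _ => reduce_vecMul_of_mem_zero _ ?_
        have he0 : e = 0 := by omega
        have := hDWg p
        rwa [he0] at this
      · exact map_zero _
    rw [this]
    exact MultilinearMap.map_coord_zero _ 0 rfl
  obtain ⟨e, rfl⟩ : ∃ e', e = e' + 1 := ⟨e - 1, by omega⟩
  have hred : reduce R d k (∑ p : T × Fin k, if p.1 ∈ S then ∑ l ∈ S, vecMul R d k
        (Pi.single (a l) (coef D φ S f a dg p l)) (untag R T _ (dmu R p Wg)) else 0) =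
      ∑ p : T × Fin k, if p.1 ∈ S then ∑ l ∈ S, coef D φ S f a dg p l •
        Pi.single (a l) (untag R T _ (dmu R p Wg)) else 0 := by
    rw [map_sum]
    refine Finset.sum_congr rfl fun p _ => ?_
    split_ifs
    · rw [map_sum]
      refine Finset.sum_congr rfl fun l _ => ?_
      rw [reduce_vecMul_of_mem_succ _ (hDWg p), vecMul_single]
    · exact map_zero _
  rw [hred]
  change (fullBracket D φ (r + 1)).curryLeft _ _ = _
  rw [map_sum, sum_apply]
  refine Finset.sum_congr rfl fun p _ => ?_
  split_ifs with hp
  swap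
  · rw [map_zero]; rfl
  rw [map_sum, sum_apply]
  -- the outer bracket, in which the tags in `S` have been merged
  set hO : Fin (r + 1) ↪ Option T :=
    ⟨Fin.cons none fun t => some (h t), by
      rw [Fin.cons_injective_iff]
      exact ⟨by simp, fun x y e => h.injective (Option.some.inj e)⟩⟩ with hhO
  have hO0 : hO 0 = none := rfl
  have hOs : ∀ t : Fin r, hO t.succ = some (h t) := fun t => rfl
  have hOmap : Finset.univ.map hO = Finset.insertNone Sᶜ := by
    ext o
    rw [← hgh]
    cases o with
    | none => simp only [Finset.none_mem_insertNone, iff_true]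
              exact Finset.mem_map.mpr ⟨0, Finset.mem_univ _, rfl⟩
    | some s =>
      simp only [Finset.some_mem_insertNone, Finset.mem_map, Finset.mem_univ, true_and,
        Fin.exists_fin_succ, hO0, hOs]
      simp
  have houter : ∀ l, ((fullBracket D φ (r + 1)).curryLeft (coef D φ S f a dg p l •
      Pi.single (a l) (untag R T _ (dmu R p Wg))))
        (fun t => f (h t) • Pi.single (a (h t)) (X (h t)))
      = ∑ q : T × Fin k, ∑ l' ∈ Finset.insertNone Sᶜ, vecMul R d k (Pi.single (l'.elim (a l) a)
    (coef D φ (Finset.insertNone Sᶜ) (fun o => o.elim (coef D φ S f a dg p l) f)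
      (fun o => o.elim (a l) a) (fun o => o.elim (∑ s ∈ S, dg s - 1) dg)
      (mergedBlock S q.1, q.2) l')) (untag R T _ (dmu R q (dmu R p (Wg * Wh)))) := by
    intro l
    have hpW : dmu R p (Wg * Wh) = dmu R p Wg * Wh := by
      have h1 : dmu R p (Wg * Wh) = dmu R p Wg * Wh + CliffordAlgebra.involute Wg * dmu R p Wh :=
        contractLeft_mul _ _ _
      rw [h1, hDprod r h p (by rw [hgh]; simpa using hp), mul_zero, add_zero]
    have := fullBracket_untag (φ := φ) hD hO (mergedBlock S)
      (fun o => o.elim (coef D φ S f a dg p l) f) (fun o => o.elim (a l) a)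
      (dg := fun o => o.elim (∑ s ∈ S, dg s - 1) dg)
      (Y := fun o => o.elim (dmu R p Wg) fun s => tag R s (X s))
      (by
        intro t s c hs
        induction t using Fin.cases with
        | zero =>
          have hs' : s ∉ S := fun e => hs (by rw [hO0]; simp [mergedBlock, e])
          change dmu R (s, c) (dmu R p Wg) = 0
          rw [dmu_comm, hDprod m g (s, c) hs', map_zero, neg_zero]
        | succ t =>
          have hS' : h t ∉ S := by
            rw [← Finset.mem_compl, ← hgh]
            exact Finset.mem_map_of_mem _ (Finset.mem_univ _)
          refine (dmu_tag (h t) s c (X (h t))).trans (if_neg fun e => hs ?_)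
          rw [hOs, e]
          simp [mergedBlock, hS'])
      (by
        intro t
        induction t using Fin.cases with
        | zero => rw [hO0]; simp only [Option.elim_none]; omega
        | succ t => rw [hOs]; exact hdg _)
      (by
        intro t
        induction t using Fin.cases with
        | zero =>
          rw [hO0]; simp only [Option.elim_none]
          have : ∑ s ∈ S, dg s - 1 = e + 1 := by omega
          rw [this]
          exact hDWg p
        | succ t => rw [hOs]; simp only [Option.elim_some]; rw [untag_tag]; exact hX _)
      (by
        intro t
        induction t using Fin.cases with
        | zero => rw [hO0]; exact hDWgc p hp
        | succ t => rw [hOs]; simp only [Option.elim_some]; rw [untag_tag]; exact hX' _)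
    rw [hOmap] at this
    have hlist : (List.ofFn fun t => (hO t).elim (dmu R p Wg) fun s => tag R s (X s)).prod =
        dmu R p (Wg * Wh) := by
      rw [List.ofFn_succ, List.prod_cons, hpW]
      rfl
    have htuple : (fun t => (hO t).elim (coef D φ S f a dg p l) f •
        (Pi.single ((hO t).elim (a l) a)
          (untag R T (Fin k) ((hO t).elim (dmu R p Wg) fun s => tag R s (X s))) :
            Fin d → ExteriorAlgebra R (Fin k → R))) =
        Fin.cons (coef D φ S f a dg p l • Pi.single (a l) (untag R T _ (dmu R p Wg)))
          (fun t => f (h t) • Pi.single (a (h t)) (X (h t))) := by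
      funext t
      induction t using Fin.cases with
      | zero => rfl
      | succ t => rw [hOs]; simp only [Option.elim_some, Fin.cons_succ, untag_tag]
    rw [hlist, htuple] at this
    rw [MultilinearMap.curryLeft_apply, this]
    refine Finset.sum_congr rfl fun q _ => if_pos ?_
    rw [mergedBlock]
    split_ifs with hq
    · simp
    · simpa using hq
  rw [Finset.sum_congr rfl fun l _ => houter l, Finset.sum_comm]
  refine Finset.sum_congr rfl fun q _ => ?_
  rw [iterCoef, map_sum, LinearMap.sum_apply]
  refine Finset.sum_congr rfl fun l _ => ?_
  rw [map_sum, LinearMap.sum_apply]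

end Brackets
end KoszulLie

namespace KoszulLie

open ExteriorAlgebra

/-! ### The coefficients in the Jacobi identity -/

section Coefficients

variable {K R : Type*} [CommRing K] [CommRing R] [Algebra K R] {d k : ℕ}
  {D : Fin d → Derivation K R R} {φ : Fin k → R} {T : Type*}

variable (D φ) in
/-- The contribution of the second derivatives when there are three elements, of which `p` and `q`
have degree one. -/
def secondCoef (f : T → R) (a : T → Fin d) (p q : T × Fin k) (r : T) : Fin d → R :=
  (-(f p.1 * f q.1 * D (a q.1) (φ p.2)) * φ q.2 * D (a p.1) (f r) +
    f p.1 * φ p.2 * D (a p.1) (f q.1) * φ q.2 * D (a q.1) (f r) +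
    f q.1 * φ q.2 * D (a q.1) (f p.1 * φ p.2 * D (a p.1) (f r))) • Pi.single (a r) 1

theorem secondCoef_comm (hD : ∀ a b f, D a (D b f) = D b (D a f)) (f : T → R) (a : T → Fin d)
    (p q : T × Fin k) (r : T) : secondCoef D φ f a p q r = secondCoef D φ f a q p r := by
  simp only [secondCoef, Derivation.leibniz, smul_eq_mul, hD (a p.1) (a q.1)]
  congr 1
  ring

variable [DecidableEq T]

theorem coef_self (f : T → R) (a : T → Fin d) (dg : T → ℕ) (S : Finset T) (p : T × Fin k) :
    coef D φ S f a dg p p.1 =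
      (-1) ^ (S.card - 1) * (∏ s ∈ S, f s) * pd D a (S.erase p.1) (φ p.2) := if_pos rfl

theorem coef_of_card_ne {f : T → R} {a : T → Fin d} {dg : T → ℕ} {S : Finset T} {p : T × Fin k}
    {l : T} (hl : l ≠ p.1) (h : ¬ (S.card = 2 ∧ dg p.1 = 1)) : coef D φ S f a dg p l = 0 := by
  rw [coef, if_neg hl, if_neg h]

theorem coef_pair {f : T → R} {a : T → Fin d} {dg : T → ℕ} {p : T × Fin k}
    {l : T} (hl : l ≠ p.1) (h : dg p.1 = 1) :
    coef D φ {p.1, l} f a dg p l = f p.1 * φ p.2 * D (a p.1) (f l) := by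
  rw [coef, if_neg hl, if_pos ⟨Finset.card_pair hl.symm, h⟩]

theorem map_prod_derivation (δ : Derivation K R R) (s : Finset T) (f : T → R) :
    δ (∏ i ∈ s, f i) = ∑ i ∈ s, δ (f i) * ∏ j ∈ s.erase i, f j := by
  induction s using Finset.induction_on with
  | empty => simp
  | insert i s hi ih =>
    rw [Finset.prod_insert hi, Derivation.leibniz, Finset.sum_insert hi, Finset.erase_insert hi,
      ih, smul_eq_mul, smul_eq_mul, Finset.mul_sum, add_comm]
    congr 1
    · exact mul_comm _ _
    · refine Finset.sum_congr rfl fun j hj => ?_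
      have hij : i ≠ j := fun h => hi (h ▸ hj)
      rw [Finset.erase_insert_of_ne hij, Finset.prod_insert (by simp [hi])]
      ring

variable [Fintype T]

/-- Both contractions concern factors of the inner bracket: the outer one acts on the merged block.
-/
theorem iterCoef_of_mem (hD : ∀ a b f, D a (D b f) = D b (D a f)) (f : T → R) (a : T → Fin d)
    {dg : T → ℕ} {S : Finset T} {p q : T × Fin k} (hq : q.1 ∈ S) :
    iterCoef D φ f a dg S p q = ∑ l ∈ S,
      (((-1) ^ Sᶜ.card * (coef D φ S f a dg p l * ∏ s ∈ Sᶜ, f s) * pd D a Sᶜ (φ q.2)) •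
          (Pi.single (a l) 1 : Fin d → R) +
        if Sᶜ.card = 1 ∧ ∑ s ∈ S, dg s = 2 then ∑ r ∈ Sᶜ,
          (coef D φ S f a dg p l * φ q.2 * D (a l) (f r)) • (Pi.single (a r) 1 : Fin d → R)
        else 0) := by
  refine Finset.sum_congr rfl fun l hl => ?_
  generalize coef D φ S f a dg p l = c
  have hm : mergedBlock S q.1 = none := if_pos hq
  have h2 : (∑ s ∈ S, dg s - 1 = 1) ↔ ∑ s ∈ S, dg s = 2 := by omega
  have hmap := pd_map hD Function.Embedding.some (fun o : Option T => o.elim (a l) a) Sᶜ (φ q.2)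
  simp only [Function.Embedding.some_apply, Option.elim_some] at hmap
  rw [Finset.insertNone]
  simp only [OrderEmbedding.coe_ofMapLEIff, Finset.sum_cons, Finset.sum_map, Option.elim_none,
    Function.Embedding.some_apply, Option.elim_some, coef, hm, Finset.card_cons, Finset.card_map,
    Finset.prod_cons, Finset.prod_map, Finset.erase_cons, h2, if_true, reduceCtorEq, if_false,
    ← Pi.single_smul, smul_eq_mul, mul_one, hmap, Nat.add_sub_cancel, Nat.reduceEqDiff]
  congr 1
  split_ifs with h
  · rfl
  · simp

/-- The outer contraction concerns a factor outside the inner bracket. The second summand is the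
derivative of the coefficient of the inner bracket along the anchor of that factor, which occurs
only when the outer bracket is binary. -/
theorem iterCoef_of_notMem (hD : ∀ a b f, D a (D b f) = D b (D a f)) (f : T → R) (a : T → Fin d)
    {dg : T → ℕ} {S : Finset T} {p q : T × Fin k} (hq : q.1 ∉ S) :
    iterCoef D φ f a dg S p q = ∑ l ∈ S,
      (((-1) ^ Sᶜ.card * (coef D φ S f a dg p l * ∏ s ∈ Sᶜ, f s) *
          D (a l) (pd D a (Sᶜ.erase q.1) (φ q.2))) • (Pi.single (a q.1) 1 : Fin d → R) +
        if Sᶜ.card = 1 ∧ dg q.1 = 1 then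
          (f q.1 * φ q.2 * D (a q.1) (coef D φ S f a dg p l)) • (Pi.single (a l) 1 : Fin d → R)
        else 0) := by
  refine Finset.sum_congr rfl fun l hl => ?_
  generalize coef D φ S f a dg p l = c
  have hm : mergedBlock S q.1 = some q.1 := if_neg hq
  have hq' : q.1 ∈ Sᶜ := by simpa using hq
  have hmap := pd_map hD Function.Embedding.some (fun o : Option T => o.elim (a l) a)
    (Sᶜ.erase q.1) (φ q.2)
  simp only [Function.Embedding.some_apply, Option.elim_some] at hmap
  have hset : (Finset.insertNone Sᶜ).erase (some q.1) =
      insert none ((Sᶜ.erase q.1).map Function.Embedding.some) := by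
    ext o
    cases o <;> simp
  have hpd : pd D (fun o : Option T => o.elim (a l) a) ((Finset.insertNone Sᶜ).erase (some q.1))
      (φ q.2) = D (a l) (pd D a (Sᶜ.erase q.1) (φ q.2)) := by
    rw [hset, pd_insert hD _ (by simp), ← hmap]
    rfl
  rw [← Finset.add_sum_erase _ _ (Finset.some_mem_insertNone.mpr hq'), hset,
    Finset.sum_insert (by simp), Finset.sum_eq_zero (s := Finset.map _ _), add_zero]
  · simp only [coef, hm, hpd, if_true, reduceCtorEq, if_false, Option.elim_none, Option.elim_some]
    simp only [Finset.insertNone, OrderEmbedding.coe_ofMapLEIff, Finset.card_cons, Finset.card_map,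
      Finset.prod_cons, Finset.prod_map, Function.Embedding.some_apply, Option.elim_none,
      Option.elim_some, ← Pi.single_smul, smul_eq_mul, mul_one, Nat.add_sub_cancel,
      Nat.reduceEqDiff]
    congr 1
    split_ifs with h
    · rfl
    · simp
  · intro o ho
    obtain ⟨s, hs, rfl⟩ := Finset.mem_map.mp ho
    have hne := Finset.ne_of_mem_erase hs
    have hc : ¬ ((Finset.insertNone Sᶜ).card = 2 ∧ dg q.1 = 1) := by
      rintro ⟨hc, -⟩
      rw [Finset.card_insertNone] at hc
      have := Finset.one_lt_card.mpr ⟨s, Finset.mem_of_mem_erase hs, q.1, hq', hne⟩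
      omega
    rw [hm, coef]
    exact (congrArg _ ((if_neg fun e => hne (Option.some.inj e)).trans (if_neg hc))).trans
      (Pi.single_zero _)

variable (D φ) in
/-- The coefficient of `p` and `q` in the iterated brackets of arity `(S, Sᶜ)` when no coefficient
`f_s` is differentiated. -/
def mainCoef (f : T → R) (a : T → Fin d) (S : Finset T) (p q : T × Fin k) : Fin d → R :=
  if q.1 ∈ S then
    ((-1) ^ (Sᶜ.card + (S.card - 1)) * (∏ s, f s) *
      (pd D a (S.erase p.1) (φ p.2) * pd D a Sᶜ (φ q.2))) • Pi.single (a p.1) 1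
  else
    ((-1) ^ (Sᶜ.card + (S.card - 1)) * (∏ s, f s) *
      (pd D a (S.erase p.1) (φ p.2) * pd D a ((insert p.1 Sᶜ).erase q.1) (φ q.2))) •
      Pi.single (a q.1) 1

variable (D φ) in
/-- The contribution of the derivative of `f_m` in the inner bracket with `S = {p, m}`. -/
def innerDerivCoef (f : T → R) (a : T → Fin d) (p q : T × Fin k) (m : T) : Fin d → R :=
  ((-1) ^ ({p.1, m}ᶜ : Finset T).card * (f p.1 * φ p.2 * D (a p.1) (f m) *
    ∏ s ∈ {p.1, m}ᶜ, f s) * pd D a {p.1, q.1}ᶜ (φ q.2)) • Pi.single (a q.1) 1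

/-- Both contractions concern distinct factors of the inner bracket. The corrections to `mainCoef`
need an inner bracket with the two arguments `p.1` and `q.1` only. -/
theorem iterCoef_of_mem_of_ne (hD : ∀ a b f, D a (D b f) = D b (D a f)) (f : T → R) (a : T → Fin d)
    {dg : T → ℕ} (hdg : ∀ s, 1 ≤ dg s) {S : Finset T} {p q : T × Fin k} (hpq : q.1 ≠ p.1)
    (hp : p.1 ∈ S) (hq : q.1 ∈ S) :
    iterCoef D φ f a dg S p q = mainCoef D φ f a S p q +
      if S = {p.1, q.1} then (if dg p.1 = 1 then innerDerivCoef D φ f a p q q.1 else 0) +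
        (if ({p.1, q.1}ᶜ : Finset T).card = 1 ∧ dg p.1 = 1 ∧ dg q.1 = 1 then
          ∑ r ∈ ({p.1, q.1}ᶜ : Finset T), (-(f p.1 * f q.1 * D (a q.1) (φ p.2)) * φ q.2 *
            D (a p.1) (f r) + f p.1 * φ p.2 * D (a p.1) (f q.1) * φ q.2 * D (a q.1) (f r)) •
            Pi.single (a r) 1 else 0)
      else 0 := by
  rw [iterCoef_of_mem hD f a hq, ← Finset.add_sum_erase _ _ hp, coef_self]
  have hmain : ((-1) ^ Sᶜ.card * ((-1) ^ (S.card - 1) * (∏ s ∈ S, f s) *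
      pd D a (S.erase p.1) (φ p.2) * ∏ s ∈ Sᶜ, f s) * pd D a Sᶜ (φ q.2)) •
        (Pi.single (a p.1) 1 : Fin d → R) = mainCoef D φ f a S p q := by
    rw [mainCoef, if_pos hq, ← Finset.prod_mul_prod_compl S f, pow_add]
    congr 1
    ring
  rw [hmain, add_assoc]
  congr 1
  by_cases hS : S = {p.1, q.1}
  · subst hS
    have he : ({p.1, q.1} : Finset T).erase p.1 = {q.1} := by
      ext x; simp; grind
    have hsum : ∑ s ∈ ({p.1, q.1} : Finset T), dg s = 2 ↔ dg p.1 = 1 ∧ dg q.1 = 1 := by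
      rw [Finset.sum_pair hpq.symm]
      have := hdg p.1
      have := hdg q.1
      omega
    rw [if_pos rfl, he, Finset.sum_singleton]
    simp only [hsum]
    by_cases h1 : dg p.1 = 1
    · rw [coef_pair hpq h1, if_pos h1, innerDerivCoef, Finset.card_pair hpq.symm,
        Finset.prod_pair hpq.symm, pd, Finset.toList_singleton]
      simp only [Nat.add_one_sub_one, pow_one, List.map_cons, List.map_nil, List.foldr_cons,
        List.foldr_nil]
      split_ifs with h2
      · rw [add_left_comm, ← Finset.sum_add_distrib]
        congr 1
        refine Finset.sum_congr rfl fun r _ => ?_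
        module
      · module
    · have h2 : ¬ (({p.1, q.1} : Finset T).card = 2 ∧ dg p.1 = 1) := fun h => h1 h.2
      rw [coef_of_card_ne hpq h2, if_neg (by tauto), if_neg (by tauto), if_neg h1,
        if_neg (by tauto)]
      simp
  · rw [if_neg hS]
    have hsub : {p.1, q.1} ⊆ S := by
      intro x hx
      simp only [Finset.mem_insert, Finset.mem_singleton] at hx
      rcases hx with rfl | rfl <;> assumption
    have hcard : 2 < S.card := by
      rw [← Finset.card_pair hpq.symm]
      exact Finset.card_lt_card (hsub.ssubset_of_ne (Ne.symm hS))
    have hsum : 2 < ∑ s ∈ S, dg s := by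
      refine hcard.trans_le ?_
      rw [Finset.card_eq_sum_ones]
      exact Finset.sum_le_sum fun s _ => hdg s
    have hsum' : ¬ (Sᶜ.card = 1 ∧ ∑ s ∈ S, dg s = 2) := by omega
    rw [if_neg hsum', zero_add]
    refine Finset.sum_eq_zero fun l hl => ?_
    rw [coef_of_card_ne (Finset.ne_of_mem_erase hl) (by omega), if_neg hsum']
    simp

/-- The corrections to `mainCoef` need an outer bracket which is binary, or an inner bracket which
is binary and whose other argument `m` has its coefficient differentiated. -/
theorem iterCoef_of_notMem_of_ne (hD : ∀ a b f, D a (D b f) = D b (D a f)) (f : T → R)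
    (a : T → Fin d) {dg : T → ℕ} {S : Finset T} {p q : T × Fin k}
    (hp : p.1 ∈ S) (hq : q.1 ∉ S) :
    iterCoef D φ f a dg S p q = mainCoef D φ f a S p q +
      ((if S = Finset.univ.erase q.1 then (if dg q.1 = 1 then
        (f q.1 * φ q.2 * D (a q.1) ((-1) ^ ({p.1, q.1}ᶜ : Finset T).card *
          (∏ s ∈ Finset.univ.erase q.1, f s) * pd D a {p.1, q.1}ᶜ (φ p.2))) •
            Pi.single (a p.1) 1 else 0) else 0) +
      ∑ m ∈ ({p.1, q.1}ᶜ : Finset T), if S = {p.1, m} then (if dg p.1 = 1 then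
        (innerDerivCoef D φ f a p q m + if ({p.1, q.1}ᶜ : Finset T).card = 1 ∧ dg q.1 = 1 then
          (f q.1 * φ q.2 * D (a q.1) (f p.1 * φ p.2 * D (a p.1) (f m))) •
            Pi.single (a m) 1 else 0) else 0) else 0) := by
  have hpq : p.1 ≠ q.1 := fun h => hq (h ▸ hp)
  rw [iterCoef_of_notMem hD f a hq, ← Finset.add_sum_erase _ _ hp, coef_self]
  have hq' : q.1 ∈ Sᶜ := by simpa using hq
  have hins : insert p.1 (Sᶜ.erase q.1) = (insert p.1 Sᶜ).erase q.1 := by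
    rw [Finset.erase_insert_of_ne hpq]
  have hmain : ((-1) ^ Sᶜ.card * ((-1) ^ (S.card - 1) * (∏ s ∈ S, f s) *
      pd D a (S.erase p.1) (φ p.2) * ∏ s ∈ Sᶜ, f s) * D (a p.1) (pd D a (Sᶜ.erase q.1) (φ q.2))) •
        (Pi.single (a q.1) 1 : Fin d → R) = mainCoef D φ f a S p q := by
    rw [mainCoef, if_neg hq, ← Finset.prod_mul_prod_compl S f, pow_add, ← hins,
      pd_insert hD _ (by simp [hp])]
    congr 1
    ring
  rw [hmain, add_assoc]
  congr 2
  · have hS : S = Finset.univ.erase q.1 ↔ Sᶜ.card = 1 := by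
      rw [Finset.card_eq_one]
      constructor
      · rintro rfl
        exact ⟨q.1, by ext; simp⟩
      · rintro ⟨x, hx⟩
        rw [hx, Finset.mem_singleton] at hq'
        rw [← compl_compl S, hx, hq']
        ext; simp
    rw [← ite_and]
    simp only [hS]
    split_ifs with h
    · obtain rfl := hS.mpr h.1
      have e1 : (Finset.univ.erase q.1).erase p.1 = ({p.1, q.1}ᶜ : Finset T) := by
        ext; simp
      rw [e1, ← e1, Finset.card_erase_of_mem hp]
    · rfl
  · by_cases hS : S.card = 2 ∧ dg p.1 = 1
    · obtain ⟨m, hm⟩ : ∃ m, S.erase p.1 = {m} := by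
        rw [← Finset.card_eq_one, Finset.card_erase_of_mem hp, hS.1]
      have hSm : S = {p.1, m} := by rw [← Finset.insert_erase hp, hm]
      have hmp : m ≠ p.1 :=
        Finset.ne_of_mem_erase (hm ▸ Finset.mem_singleton_self m : m ∈ S.erase p.1)
      subst hSm
      have hqm : q.1 ≠ m := fun h => hq (by simp [h])
      rw [hm, Finset.sum_singleton, coef_pair hmp hS.2, Finset.sum_eq_single m, if_pos rfl,
        if_pos hS.2, innerDerivCoef]
      · have e1 : insert m (({p.1, m}ᶜ : Finset T).erase q.1) = {p.1, q.1}ᶜ := by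
          ext x; simp; grind
        have e2 : ({p.1, m}ᶜ : Finset T).card = ({p.1, q.1}ᶜ : Finset T).card := by
          rw [Finset.card_compl, Finset.card_compl, Finset.card_pair hmp.symm, Finset.card_pair hpq]
        rw [← e1, pd_insert hD _ (by simp), e2, e1]
      · intro m' _ hm'
        refine if_neg fun e => hm' ?_
        have : m ∈ ({p.1, m'} : Finset T) := e ▸ by simp
        simp only [Finset.mem_insert, Finset.mem_singleton] at this
        exact (this.resolve_left hmp).symm
      · intro h
        exact absurd (by simp [hmp, hqm.symm]) h
    · rw [Finset.sum_eq_zero, Finset.sum_eq_zero]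
      · intro m hm
        split_ifs with h1 h2 h3 <;> try rfl
        all_goals
          subst h1
          refine absurd ⟨Finset.card_pair ?_, h2⟩ hS
          simp only [Finset.mem_compl, Finset.mem_insert, not_or] at hm
          exact Ne.symm hm.1
      · intro l hl
        rw [coef_of_card_ne (Finset.ne_of_mem_erase hl) hS]
        simp

/-- The involution `S ↦ {p} ∪ Sᶜ` exchanges the roles of the two contractions in the terms which do
not differentiate the coefficients `f_s`. -/
theorem sum_mainCoef_comm (f : T → R) (a : T → Fin d)
    (p q : T × Fin k) :
    ∑ S : Finset T with p.1 ∈ S, mainCoef D φ f a S p q =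
      ∑ S : Finset T with q.1 ∈ S, mainCoef D φ f a S q p := by
  have hsign : ∀ {S : Finset T} {s : T}, s ∈ S → Sᶜ.card + (S.card - 1) = Fintype.card T - 1 := by
    intro S s hs
    have h1 := Finset.card_add_card_compl S
    have h2 := Finset.card_pos.mpr ⟨s, hs⟩
    omega
  by_cases hpq : p.1 = q.1
  · have hinv : ∀ S : Finset T, p.1 ∈ S → insert p.1 Sᶜ = (S.erase p.1)ᶜ := by
      intro S hS; ext x; simp; try grind
    rw [← hpq]
    refine Finset.sum_nbij' (fun S => insert p.1 Sᶜ) (fun S => insert p.1 Sᶜ) ?_ ?_ ?_ ?_ ?_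
    · intro S _
      simp
    · intro S _
      simp
    · intro S hS
      have hS := (Finset.mem_filter.mp hS).2
      rw [hinv S hS, compl_compl, Finset.insert_erase hS]
    · intro S hS
      have hS := (Finset.mem_filter.mp hS).2
      rw [hinv S hS, compl_compl, Finset.insert_erase hS]
    · intro S hS
      have hS := (Finset.mem_filter.mp hS).2
      have h1 : p.1 ∈ insert p.1 Sᶜ := Finset.mem_insert_self _ _
      have h2 : (insert p.1 Sᶜ).erase p.1 = Sᶜ := Finset.erase_insert (by simpa using hS)
      have h3 : (insert p.1 Sᶜ)ᶜ = S.erase p.1 := by rw [hinv S hS, compl_compl]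
      rw [mainCoef, mainCoef, if_pos (hpq ▸ hS), if_pos (hpq ▸ h1), hsign hS, hsign h1, ← hpq,
        h2, h3]
      module
  · have key : ∀ p q : T × Fin k, p.1 ≠ q.1 →
        ∑ S : Finset T with p.1 ∈ S, mainCoef D φ f a S p q =
        ∑ S : Finset T with p.1 ∈ S ∧ q.1 ∈ S, mainCoef D φ f a S p q +
        ∑ S : Finset T with p.1 ∈ S ∧ q.1 ∈ S, mainCoef D φ f a S q p := by
      intro p q hpq
      rw [← Finset.sum_filter_add_sum_filter_not _ (fun S => q.1 ∈ S), Finset.filter_filter,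
        Finset.filter_filter]
      congr 1
      have hinv : ∀ S : Finset T, p.1 ∈ S → insert p.1 Sᶜ = (S.erase p.1)ᶜ := by
        intro S hS; ext x; simp; try grind
      refine Finset.sum_nbij' (fun S => insert p.1 Sᶜ) (fun S => insert p.1 Sᶜ) ?_ ?_ ?_ ?_ ?_
      · intro S hS
        simp only [Finset.mem_filter_univ] at hS ⊢
        simp [hS.2]
      · intro S hS
        simp only [Finset.mem_filter_univ] at hS ⊢
        simp [hS.2, Ne.symm hpq]
      · intro S hS
        have hS := (Finset.mem_filter.mp hS).2.1
        rw [hinv S hS, compl_compl, Finset.insert_erase hS]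
      · intro S hS
        have hS := (Finset.mem_filter.mp hS).2.1
        rw [hinv S hS, compl_compl, Finset.insert_erase hS]
      · intro S hS
        obtain ⟨hp, hq⟩ := (Finset.mem_filter.mp hS).2
        have h1 : p.1 ∈ insert p.1 Sᶜ := Finset.mem_insert_self _ _
        have h3 : (insert p.1 Sᶜ)ᶜ = S.erase p.1 := by rw [hinv S hp, compl_compl]
        rw [mainCoef, mainCoef, if_neg hq, if_pos h1, hsign hp, hsign h1, h3]
        module
    rw [key p q hpq, key q p (Ne.symm hpq), add_comm]
    simp only [and_comm]

variable (D φ) in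
/-- The total contribution of the derivatives along the anchor of the factor of `p`, which has
degree one. -/
def anchorTerm (f : T → R) (a : T → Fin d) (p q : T × Fin k) : Fin d → R :=
  (f p.1 * φ p.2 * D (a p.1) ((-1) ^ ({q.1, p.1}ᶜ : Finset T).card *
    (∏ s ∈ Finset.univ.erase p.1, f s) * pd D a {q.1, p.1}ᶜ (φ q.2))) • Pi.single (a q.1) 1

/-- The derivatives of the coefficients `f_m` in the inner brackets with `S = {p, m}` add up to the
derivative of their product; the term of `mainCoef` with `S = {p}`, where the inner bracket is unary
of degree zero and has to be left out, supplies the derivative of `φ`. -/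
theorem sum_innerDerivCoef (hD : ∀ a b f, D a (D b f) = D b (D a f)) (f : T → R) (a : T → Fin d)
    {p q : T × Fin k} (hpq : p.1 ≠ q.1) :
    innerDerivCoef D φ f a p q q.1 + ∑ m ∈ ({p.1, q.1}ᶜ : Finset T), innerDerivCoef D φ f a p q m -
      mainCoef D φ f a {p.1} p q = anchorTerm D φ f a p q := by
  have h1 : ∀ m, m ≠ p.1 → innerDerivCoef D φ f a p q m = (D (a p.1) (f m) *
      ∏ s ∈ (Finset.univ.erase p.1).erase m, f s) • ((-1) ^ ({q.1, p.1}ᶜ : Finset T).card *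
        f p.1 * φ p.2 * pd D a {q.1, p.1}ᶜ (φ q.2)) • (Pi.single (a q.1) 1 : Fin d → R) := by
    intro m hm
    have e1 : (Finset.univ.erase p.1).erase m = ({p.1, m}ᶜ : Finset T) := by
      ext x; simp; grind
    have e2 : ({p.1, m}ᶜ : Finset T).card = ({q.1, p.1}ᶜ : Finset T).card := by
      rw [Finset.card_compl, Finset.card_compl, Finset.card_pair hm.symm,
        Finset.card_pair hpq.symm]
    rw [innerDerivCoef, e1, e2, Finset.pair_comm q.1 p.1, smul_smul]
    congr 1
    ring
  have h2 : innerDerivCoef D φ f a p q q.1 +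
      ∑ m ∈ ({p.1, q.1}ᶜ : Finset T), innerDerivCoef D φ f a p q m =
      D (a p.1) (∏ s ∈ Finset.univ.erase p.1, f s) • ((-1) ^ ({q.1, p.1}ᶜ : Finset T).card *
        f p.1 * φ p.2 * pd D a {q.1, p.1}ᶜ (φ q.2)) • (Pi.single (a q.1) 1 : Fin d → R) := by
    have e : ({p.1, q.1}ᶜ : Finset T) = (Finset.univ.erase p.1).erase q.1 := by
      ext x; simp; grind
    rw [e, Finset.add_sum_erase _ _ (by simp [hpq.symm]), map_prod_derivation, Finset.sum_smul]
    exact Finset.sum_congr rfl fun m hm => h1 m (Finset.ne_of_mem_erase hm)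
  have h3 : mainCoef D φ f a {p.1} p q = (-(-1) ^ ({q.1, p.1}ᶜ : Finset T).card * ∏ s, f s) •
      (φ p.2 * D (a p.1) (pd D a {q.1, p.1}ᶜ (φ q.2))) • (Pi.single (a q.1) 1 : Fin d → R) := by
    have e1 : insert p.1 ({q.1, p.1}ᶜ : Finset T) = (insert p.1 ({p.1}ᶜ : Finset T)).erase q.1 := by
      ext x; simp; grind
    have e2 : ({p.1}ᶜ : Finset T).card = ({q.1, p.1}ᶜ : Finset T).card + 1 := by
      have := Finset.card_add_card_compl ({p.1} : Finset T)
      have := Finset.card_add_card_compl ({q.1, p.1} : Finset T)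
      rw [Finset.card_singleton] at *
      rw [Finset.card_pair hpq.symm] at *
      omega
    rw [mainCoef, if_neg (by simpa using hpq.symm), ← e1, pd_insert hD _ (by simp), e2,
      Finset.erase_eq_empty_iff .. |>.mpr (Or.inr rfl), pd_empty, smul_smul]
    congr 1
    rw [Finset.card_singleton, Nat.sub_self, pow_succ]
    ring
  have hsgn : ∀ (n : ℕ) (x : R), D (a p.1) ((-1) ^ n * x) = (-1) ^ n * D (a p.1) x := by
    intro n x
    rcases neg_one_pow_eq_or R n with h | h <;> simp [h]
  rw [h2, h3, anchorTerm, mul_assoc ((-1) ^ ({q.1, p.1}ᶜ : Finset T).card)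
    (∏ s ∈ Finset.univ.erase p.1, f s), hsgn, Derivation.leibniz, ← Finset.mul_prod_erase _ _
    (Finset.mem_univ p.1)]
  simp only [smul_eq_mul]
  module

/-- The sum of the coefficients over all inner blocks `S` that contain the factor of the inner
contraction, for contractions of distinct factors. -/
theorem sum_iterCoef (hD : ∀ a b f, D a (D b f) = D b (D a f)) (f : T → R) (a : T → Fin d)
    {dg : T → ℕ} (hdg : ∀ s, 1 ≤ dg s) {p q : T × Fin k} (hpq : p.1 ≠ q.1) :
    ∑ S : Finset T with p.1 ∈ S, iterCoef D φ f a dg S p q =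
      ∑ S : Finset T with p.1 ∈ S, mainCoef D φ f a S p q +
      (if dg p.1 = 1 then innerDerivCoef D φ f a p q q.1 +
        ∑ m ∈ ({p.1, q.1}ᶜ : Finset T), innerDerivCoef D φ f a p q m else 0) +
      (if dg q.1 = 1 then anchorTerm D φ f a q p else 0) +
      (if ({p.1, q.1}ᶜ : Finset T).card = 1 ∧ dg p.1 = 1 ∧ dg q.1 = 1 then
        ∑ r ∈ ({p.1, q.1}ᶜ : Finset T), secondCoef D φ f a p q r else 0) := by
  set X : Fin d → R := (if dg p.1 = 1 then innerDerivCoef D φ f a p q q.1 else 0) +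
    (if ({p.1, q.1}ᶜ : Finset T).card = 1 ∧ dg p.1 = 1 ∧ dg q.1 = 1 then
      ∑ r ∈ ({p.1, q.1}ᶜ : Finset T), (-(f p.1 * f q.1 * D (a q.1) (φ p.2)) * φ q.2 *
        D (a p.1) (f r) + f p.1 * φ p.2 * D (a p.1) (f q.1) * φ q.2 * D (a q.1) (f r)) •
        Pi.single (a r) 1 else 0) with hX
  set Y : Fin d → R := if dg q.1 = 1 then anchorTerm D φ f a q p else 0 with hY
  set Z : T → Fin d → R := fun m => if dg p.1 = 1 then
    (innerDerivCoef D φ f a p q m + if ({p.1, q.1}ᶜ : Finset T).card = 1 ∧ dg q.1 = 1 then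
      (f q.1 * φ q.2 * D (a q.1) (f p.1 * φ p.2 * D (a p.1) (f m))) •
        Pi.single (a m) 1 else 0) else 0 with hZ
  have h : ∀ S ∈ (Finset.univ : Finset (Finset T)).filter (p.1 ∈ ·),
      iterCoef D φ f a dg S p q = mainCoef D φ f a S p q +
      ((if S = {p.1, q.1} then X else 0) + (if S = Finset.univ.erase q.1 then Y else 0) +
        ∑ m ∈ ({p.1, q.1}ᶜ : Finset T), if S = {p.1, m} then Z m else 0) := by
    intro S hS
    have hp := (Finset.mem_filter.mp hS).2
    by_cases hq : q.1 ∈ S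
    · rw [iterCoef_of_mem_of_ne hD f a hdg hpq.symm hp hq,
        if_neg (c := S = Finset.univ.erase q.1) (fun e => by simp [e] at hq), add_zero]
      suffices h0 : ∑ m ∈ ({p.1, q.1}ᶜ : Finset T), (if S = {p.1, m} then Z m else 0) = 0 by
        rw [h0, add_zero]
      refine Finset.sum_eq_zero fun m hm => ?_
      refine if_neg fun e => ?_
      rw [e] at hq
      simp only [Finset.mem_insert, Finset.mem_singleton, Finset.mem_compl] at hq hm
      tauto
    · rw [iterCoef_of_notMem_of_ne hD f a hp hq,
        if_neg (c := S = {p.1, q.1}) (fun e => by simp [e] at hq), zero_add]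
      rfl
  rw [Finset.sum_congr rfl h, Finset.sum_add_distrib, Finset.sum_add_distrib,
    Finset.sum_add_distrib, Finset.sum_ite_eq', if_pos (by simp), Finset.sum_ite_eq',
    if_pos (by simp [hpq]), Finset.sum_comm]
  have hZ' : ∀ m ∈ ({p.1, q.1}ᶜ : Finset T),
      ∑ S ∈ (Finset.univ : Finset (Finset T)).filter (p.1 ∈ ·),
        (if S = {p.1, m} then Z m else 0) = Z m := by
    intro m _
    rw [Finset.sum_ite_eq', if_pos (by simp)]
  rw [Finset.sum_congr rfl hZ', hX, hZ]
  by_cases h1 : dg p.1 = 1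
  swap
  · simp [h1]
  by_cases h2 : ({p.1, q.1}ᶜ : Finset T).card = 1 ∧ dg q.1 = 1
  · simp only [h1, h2, if_true, and_self, secondCoef, Finset.sum_add_distrib, add_smul]
    abel
  · have h3 : ¬ (({p.1, q.1}ᶜ : Finset T).card = 1 ∧ dg p.1 = 1 ∧ dg q.1 = 1) := by tauto
    simp only [if_pos h1, if_neg h2, if_neg h3, add_zero]
    abel

/-- The coefficients in the Jacobi identity are symmetric in the two contractions, apart from
those which belong to contractions that vanish or have degree `0`. -/
theorem sum_iterCoef_comm (hD : ∀ a b f, D a (D b f) = D b (D a f)) (f : T → R) (a : T → Fin d)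
    {dg : T → ℕ} (hdg : ∀ s, 1 ≤ dg s) {p q : T × Fin k} (h1 : p.1 = q.1 → dg p.1 ≠ 1)
    (h2 : ∑ s, dg s ≠ 2) :
    ∑ S : Finset T with p.1 ∈ S ∧ ∑ s ∈ S, dg s ≠ 1, iterCoef D φ f a dg S p q =
      ∑ S : Finset T with q.1 ∈ S ∧ ∑ s ∈ S, dg s ≠ 1, iterCoef D φ f a dg S q p := by
  by_cases hpq : p.1 = q.1
  · have hp1 : 2 ≤ dg p.1 := by
      have := h1 hpq
      have := hdg p.1
      omega
    have hle : ∀ S : Finset T, p.1 ∈ S → dg p.1 ≤ ∑ s ∈ S, dg s := fun S hS =>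
      Finset.single_le_sum (f := dg) (fun _ _ => Nat.zero_le _) hS
    -- both contractions concern the same factor, of degree at least two: in this case the sum is
    -- given by a formula whose first part is symmetric by `sum_mainCoef_comm`, and whose second
    -- part is visibly symmetric
    have key : ∀ p' q' : T × Fin k, p'.1 = p.1 → q'.1 = p.1 →
        ∑ S : Finset T with p'.1 ∈ S ∧ ∑ s ∈ S, dg s ≠ 1, iterCoef D φ f a dg S p' q' =
        ∑ S : Finset T with p'.1 ∈ S, mainCoef D φ f a S p' q' +
        ∑ S : Finset T with p.1 ∈ S, if Sᶜ.card = 1 ∧ ∑ s ∈ S, dg s = 2 then ∑ r ∈ Sᶜ,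
          (f p.1 * φ p'.2 * φ q'.2 * D (a p.1) (f r)) • (Pi.single (a r) 1 : Fin d → R)
        else 0 := by
      intro p' q' hp' hq'
      have hfil : (Finset.univ : Finset (Finset T)).filter
          (fun S => p'.1 ∈ S ∧ ∑ s ∈ S, dg s ≠ 1) =
          (Finset.univ : Finset (Finset T)).filter (p.1 ∈ ·) := by
        refine Finset.filter_congr fun S _ => ?_
        rw [hp']
        exact and_iff_left_of_imp fun h => by have := hle S h; omega
      rw [hfil, hp', ← Finset.sum_add_distrib]
      refine Finset.sum_congr rfl fun S hS => ?_
      have hp := (Finset.mem_filter.mp hS).2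
      rw [iterCoef_of_mem hD f a (hq' ▸ hp), Finset.sum_eq_single p.1]
      · have e := coef_self (D := D) (φ := φ) f a dg S p'
        rw [hp'] at e
        rw [e]
        congr 1
        · rw [mainCoef, if_pos (hq' ▸ hp), ← Finset.prod_mul_prod_compl S f, pow_add, hp']
          congr 1
          ring
        · split_ifs with h
          · have hS' : S = {p.1} := by
              refine (Finset.eq_singleton_iff_unique_mem).mpr ⟨hp, fun s hs => ?_⟩
              by_contra hne
              have := Finset.add_le_sum (f := dg) (fun _ _ => Nat.zero_le _) hs hp hne
              have := hdg s
              omega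
            subst hS'
            simp [pd_empty]
          · rfl
      · intro l _ hl
        rw [coef_of_card_ne (hp'.symm ▸ hl) (fun h => by rw [hp'] at h; omega)]
        simp
      · exact fun h => absurd hp h
    rw [key p q rfl hpq.symm, key q p hpq.symm rfl, sum_mainCoef_comm]
    congr 1
    refine Finset.sum_congr rfl fun S _ => ?_
    simp only [mul_right_comm _ (φ p.2) (φ q.2)]
  · -- the terms with `∑ s ∈ S, dg s = 1`, which are left out, are those with `S = {p.1}`
    have key : ∀ p q : T × Fin k, p.1 ≠ q.1 →
        ∑ S : Finset T with p.1 ∈ S ∧ ∑ s ∈ S, dg s ≠ 1, iterCoef D φ f a dg S p q =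
        ∑ S : Finset T with p.1 ∈ S, mainCoef D φ f a S p q +
        (if dg p.1 = 1 then anchorTerm D φ f a p q else 0) +
        (if dg q.1 = 1 then anchorTerm D φ f a q p else 0) +
        (if ({p.1, q.1}ᶜ : Finset T).card = 1 ∧ dg p.1 = 1 ∧ dg q.1 = 1 then
          ∑ r ∈ ({p.1, q.1}ᶜ : Finset T), secondCoef D φ f a p q r else 0) := by
      intro p q hpq
      have hone : ∀ S : Finset T, p.1 ∈ S → (∑ s ∈ S, dg s = 1 ↔ S = {p.1} ∧ dg p.1 = 1) := by
        intro S hS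
        constructor
        · intro h
          have hS' : S = {p.1} := by
            refine (Finset.eq_singleton_iff_unique_mem).mpr ⟨hS, fun s hs => ?_⟩
            by_contra hne
            have := Finset.add_le_sum (f := dg) (fun _ _ => Nat.zero_le _) hs hS hne
            have := hdg s
            have := hdg p.1
            omega
          subst hS'
          exact ⟨rfl, by simpa using h⟩
        · rintro ⟨rfl, h⟩
          simpa using h
      have hsplit := Finset.sum_filter_add_sum_filter_not
        ((Finset.univ : Finset (Finset T)).filter (p.1 ∈ ·)) (fun S => ∑ s ∈ S, dg s ≠ 1)
        (fun S => iterCoef D φ f a dg S p q)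
      rw [sum_iterCoef hD f a hdg hpq, Finset.filter_filter, Finset.filter_filter] at hsplit
      have hrem : ∑ S : Finset T with p.1 ∈ S ∧ ¬ ∑ s ∈ S, dg s ≠ 1, iterCoef D φ f a dg S p q =
          if dg p.1 = 1 then mainCoef D φ f a {p.1} p q else 0 := by
        have hfil : (Finset.univ : Finset (Finset T)).filter
            (fun S => p.1 ∈ S ∧ ¬ ∑ s ∈ S, dg s ≠ 1) = if dg p.1 = 1 then {{p.1}} else ∅ := by
          ext S
          rw [Finset.mem_filter_univ, not_not, and_congr_right_iff.mpr (hone S)]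
          split_ifs with h
          · simp only [h, and_true, Finset.mem_singleton]
            exact and_iff_right_of_imp fun e => by simp [e]
          · simp [h]
        rw [hfil]
        split_ifs with h
        · rw [Finset.sum_singleton, iterCoef_of_notMem_of_ne hD f a (Finset.mem_singleton_self _)
            (by simpa using hpq.symm), Finset.sum_eq_zero, add_zero, ← ite_and, if_neg, add_zero]
          · rintro ⟨e, hq⟩
            refine h2 ?_
            rw [← Finset.add_sum_erase _ _ (Finset.mem_univ q.1), ← e, Finset.sum_singleton, h, hq]
          · intro m hm
            refine if_neg fun e => ?_
            have : m ∈ ({p.1} : Finset T) := e ▸ by simp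
            simp only [Finset.mem_singleton, Finset.mem_compl, Finset.mem_insert] at this hm
            exact hm (Or.inl this)
        · simp
      rw [hrem] at hsplit
      rw [eq_sub_of_add_eq hsplit, ← sum_innerDerivCoef hD f a hpq]
      split_ifs <;> abel
    rw [key p q hpq, key q p (Ne.symm hpq), sum_mainCoef_comm f a p q, Finset.pair_comm q.1 p.1]
    simp only [secondCoef_comm hD f a q p, and_comm (a := dg q.1 = 1)]
    abel

end Coefficients
end KoszulLie

/-! ### Shuffles -/

section Shuffles

variable {n : ℕ}

/-- The set of the values `σ(t)`, for `t < m`. -/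
def shuffleSet (m : ℕ) (σ : Equiv.Perm (Fin n)) : Finset (Fin n) :=
  Finset.univ.filter fun s => (σ.symm s : ℕ) < m

theorem mem_shuffleSet {m : ℕ} {σ : Equiv.Perm (Fin n)} {s : Fin n} :
    s ∈ shuffleSet m σ ↔ (σ.symm s : ℕ) < m := Finset.mem_filter_univ s

theorem apply_mem_shuffleSet {m : ℕ} {σ : Equiv.Perm (Fin n)} {t : Fin n} :
    σ t ∈ shuffleSet m σ ↔ (t : ℕ) < m := by
  rw [mem_shuffleSet, Equiv.symm_apply_apply]

theorem card_shuffleSet {m : ℕ} (hm : m ≤ n) (σ : Equiv.Perm (Fin n)) :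
    (shuffleSet m σ).card = m := by
  have h : shuffleSet m σ = Finset.univ.map ((Fin.castLEEmb hm).trans σ.toEmbedding) := by
    ext s
    simp only [mem_shuffleSet, Finset.mem_map, Finset.mem_univ, true_and]
    constructor
    · intro h
      exact ⟨⟨_, h⟩, by simp [Fin.castLE]⟩
    · rintro ⟨t, rfl⟩
      simp
  rw [h, Finset.card_map, Finset.card_univ, Fintype.card_fin]

/-- A shuffle is determined by the set of its first values. -/
theorem IsShuffle.eq_of_shuffleSet_eq {m : ℕ} (hm : m ≤ n) {σ τ : Equiv.Perm (Fin n)}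
    (hσ : IsShuffle m σ) (hτ : IsShuffle m τ) (h : shuffleSet m σ = shuffleSet m τ) : σ = τ := by
  obtain ⟨r, rfl⟩ := Nat.exists_eq_add_of_le hm
  have hcard := card_shuffleSet hm σ
  have hcard' : (shuffleSet m σ)ᶜ.card = r := by
    rw [Finset.card_compl, hcard, Fintype.card_fin]; omega
  have h1 : ∀ ρ : Equiv.Perm (Fin (m + r)), IsShuffle m ρ → shuffleSet m σ = shuffleSet m ρ →
      (fun t : Fin m => ρ (Fin.castAdd r t)) = (shuffleSet m σ).orderEmbOfFin hcard := by
    intro ρ hρ e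
    refine Finset.orderEmbOfFin_unique hcard (fun t => ?_) fun t t' ht => ?_
    · rw [e, apply_mem_shuffleSet]; simp
    · exact hρ.1 (by simp) (by simp) ht
  have h2 : ∀ ρ : Equiv.Perm (Fin (m + r)), IsShuffle m ρ → shuffleSet m σ = shuffleSet m ρ →
      (fun t : Fin r => ρ (Fin.natAdd m t)) = (shuffleSet m σ)ᶜ.orderEmbOfFin hcard' := by
    intro ρ hρ e
    refine Finset.orderEmbOfFin_unique hcard' (fun t => ?_) fun t t' ht => ?_
    · rw [e, Finset.mem_compl, apply_mem_shuffleSet]; simp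
    · exact hρ.2 (by simp) (by simp) (Nat.add_lt_add_left ht m)
  refine Equiv.ext fun t => ?_
  induction t using Fin.addCases with
  | left t => exact congrFun ((h1 σ hσ rfl).trans (h1 τ hτ h).symm) t
  | right t => exact congrFun ((h2 σ hσ rfl).trans (h2 τ hτ h).symm) t

theorem exists_isShuffle (S : Finset (Fin n)) :
    ∃ σ : Equiv.Perm (Fin n), IsShuffle S.card σ ∧ shuffleSet S.card σ = S := by
  obtain ⟨m, hm⟩ : ∃ m, S.card = m := ⟨_, rfl⟩
  have hle : m ≤ n := by
    rw [← hm]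
    exact (Finset.card_le_univ S).trans_eq (Fintype.card_fin n)
  obtain ⟨r, rfl⟩ := Nat.exists_eq_add_of_le hle
  have hr : Sᶜ.card = r := by
    rw [Finset.card_compl, hm, Fintype.card_fin]; omega
  set σ : Equiv.Perm (Fin (m + r)) := finSumFinEquiv.symm.trans (finSumEquivOfFinset hm hr) with hσ
  have h1 : ∀ t : Fin m, σ (Fin.castAdd r t) = S.orderEmbOfFin hm t := fun t => by simp [hσ]
  have h2 : ∀ t : Fin r, σ (Fin.natAdd m t) = Sᶜ.orderEmbOfFin hr t := fun t => by simp [hσ]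
  refine ⟨σ, ⟨?_, ?_⟩, ?_⟩
  · intro t ht t' ht' htt
    rw [hm] at ht ht'
    have e : t = Fin.castAdd r ⟨t, ht⟩ := rfl
    have e' : t' = Fin.castAdd r ⟨t', ht'⟩ := rfl
    rw [e, e', h1, h1]
    exact (S.orderEmbOfFin hm).strictMono htt
  · intro t ht t' ht' htt
    induction t using Fin.addCases with
    | left t => simp [hm] at ht; omega
    | right t =>
      induction t' using Fin.addCases with
      | left t => simp [hm] at ht'; omega
      | right t' =>
        rw [h2, h2]
        exact (Sᶜ.orderEmbOfFin hr).strictMono (Nat.lt_of_add_lt_add_left htt)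
  · rw [hm]
    ext s
    obtain ⟨t, rfl⟩ := σ.surjective s
    rw [apply_mem_shuffleSet]
    induction t using Fin.addCases with
    | left t => rw [h1]; simp [Finset.orderEmbOfFin_mem]
    | right t =>
      rw [h2]
      have := Finset.orderEmbOfFin_mem Sᶜ hr t
      rw [Finset.mem_compl] at this
      simp [this]

/-- The sum over all shuffles as a sum over the nonempty subsets. -/
theorem sum_shuffles {M : Type*} [AddCommMonoid M] (G : Finset (Fin n) → M) :
    ∑ i : Fin n, ∑ σ : Equiv.Perm (Fin n) with IsShuffle ((i : ℕ) + 1) σ,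
      G (shuffleSet ((i : ℕ) + 1) σ) = ∑ S : Finset (Fin n) with S.Nonempty, G S := by
  rw [Finset.sum_sigma']
  refine Finset.sum_bij (fun x _ => shuffleSet ((x.1 : ℕ) + 1) x.2) ?_ ?_ ?_ fun _ _ => rfl
  · rintro ⟨i, σ⟩ _
    rw [Finset.mem_filter_univ, ← Finset.card_pos, card_shuffleSet (by omega)]
    exact Nat.succ_pos _
  · rintro ⟨i, σ⟩ h ⟨i', σ'⟩ h' e
    simp only [Finset.mem_sigma, Finset.mem_univ, Finset.mem_filter, true_and] at h h' e
    have hi : i = i' := by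
      have := congrArg Finset.card e
      rw [card_shuffleSet (by omega), card_shuffleSet (by omega)] at this
      exact Fin.ext (by omega)
    subst hi
    rw [h.eq_of_shuffleSet_eq (by omega) h' e]
  · intro S hS
    rw [Finset.mem_filter_univ] at hS
    obtain ⟨σ, hσ, hσS⟩ := exists_isShuffle S
    have hpos := Finset.card_pos.mpr hS
    have hle := (Finset.card_le_univ S).trans_eq (Fintype.card_fin n)
    have e : S.card - 1 + 1 = S.card := by omega
    refine ⟨⟨⟨S.card - 1, by omega⟩, σ⟩, ?_, ?_⟩
    · simp only [Finset.mem_sigma, Finset.mem_univ, Finset.mem_filter, true_and, e]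
      exact hσ
    · simp only [e]
      exact hσS

theorem List.prod_ofFn_mul_prod_ofFn {A : Type*} [Monoid A] {m r : ℕ} (h : m + r = n)
    (Y : Fin n → A) :
    (List.ofFn fun t : Fin m => Y ⟨t, by omega⟩).prod *
      (List.ofFn fun t : Fin r => Y ⟨m + t, by omega⟩).prod = (List.ofFn Y).prod := by
  subst h
  rw [← List.prod_append, List.ofFn_add]
  rfl

end Shuffles

namespace KoszulLie

open ExteriorAlgebra

/-! ### The Jacobi identity for pure elements -/

section Jacobi

variable {K R : Type*} [CommRing K] [CommRing R] [Algebra K R] {d k : ℕ}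
  {D : Fin d → Derivation K R R} {φ : Fin k → R} {n : ℕ}

/-- Contracting a factor of degree one twice gives zero, as the contractions with tag `s` only see
the `s`-th factor. -/
theorem dmu_dmu_prod_tag_eq_zero {dg : Fin n → ℕ} {X : Fin n → ExteriorAlgebra R (Fin k → R)}
    (hX : ∀ s, X s ∈ ⋀[R]^(dg s) (Fin k → R)) {p q : Fin n × Fin k} (hpq : p.1 = q.1)
    (hdg : dg p.1 = 1) :
    dmu R q (dmu R p (List.ofFn fun s => tag R s (X s)).prod) = 0 := by
  rw [dmu, dmu, contractLeft_prod_ofFn, map_sum]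
  refine Finset.sum_eq_zero fun l _ => ?_
  by_cases hl : p.1 = l
  · rw [leibnizTerm, contractLeft_prod_ofFn]
    refine Finset.sum_eq_zero fun t _ => leibnizTerm_eq_zero ?_
    have hq : ∀ s, q.1 ≠ s → dmu R q (tag R s (X s)) = 0 := fun s hs =>
      (dmu_tag s q.1 q.2 (X s)).trans (if_neg hs)
    split_ifs with h1 h2
    · have hne : q.1 ≠ t := by
        rintro rfl
        exact absurd h1 (by rw [← hl, hpq]; exact lt_irrefl _)
      rw [involute_of_mem (show tag R t (X t) ∈ _ from map_mem_exteriorPower _ (hX t)), map_zsmul]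
      exact (congrArg _ (hq t hne)).trans (smul_zero _)
    · subst h2
      refine contractLeft_eq_zero_of_mem _ (contractLeft_mem_exteriorPower _ ?_)
      have := map_mem_exteriorPower (tagLin R t) (hX t)
      rw [hl] at hdg
      rwa [hdg] at this
    · exact hq t fun h => h2 (h.symm.trans (hpq.symm.trans hl))
  · rw [leibnizTerm_eq_zero, map_zero]
    exact (dmu_tag l p.1 p.2 (X l)).trans (if_neg hl)

/-- The Jacobi identity on the elements `f_s X_s ⊗ ∂_{a(s)}`. The iterated brackets involve the
contractions of `∏ X_s` by `p` and `q`, which are antisymmetric in `p` and `q`, while the sum of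
their coefficients over all shuffles is symmetric. The Koszul sign of a shuffle is the sign of the
resulting reordering of `∏ X_s`, so that each term only depends on the set of arguments of the inner
bracket. -/
theorem jacobi_pure (hD : ∀ a b f, D a (D b f) = D b (D a f)) (f : Fin n → R) (a : Fin n → Fin d)
    {dg : Fin n → ℕ} (hdg : ∀ s, 1 ≤ dg s) {X : Fin n → ExteriorAlgebra R (Fin k → R)}
    (hX : ∀ s, X s ∈ ⋀[R]^(dg s) (Fin k → R)) (hX' : ∀ s, X s ∈ constants K R k)
    {e : Fin n → ℤ} (he : ∀ s, e s = -(dg s : ℤ))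
    {x : Fin n → Fin d → ExteriorAlgebra R (Fin k → R)}
    (hx : ∀ s, x s = f s • Pi.single (a s) (X s)) :
    ∑ i : Fin n, ∑ σ : Equiv.Perm (Fin n) with IsShuffle ((i : ℕ) + 1) σ,
      (koszulSign e σ : ℤ) • reduce R d k (fullBracket D φ (n - (i + 1) + 1) (Fin.cons
        (reduce R d k (fullBracket D φ (i + 1) (fun t : Fin (i + 1) => x (σ ⟨t, by omega⟩))))
        (fun t : Fin (n - (i + 1)) => x (σ ⟨i + 1 + t, by omega⟩)))) = 0 := by
  obtain rfl : x = fun s => f s • Pi.single (a s) (X s) := funext hx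
  set W := (List.ofFn fun s => tag R s (X s)).prod with hW
  have hWdeg : W ∈ ⋀[R]^(∑ s, dg s) (Fin n × Fin k → R) :=
    prod_ofFn_mem_exteriorPower fun t => map_mem_exteriorPower _ (hX t)
  set G : Finset (Fin n) → Fin d → ExteriorAlgebra R (Fin k → R) := fun S =>
    if ∑ s ∈ S, dg s = 1 then 0 else
      ∑ p : Fin n × Fin k, if p.1 ∈ S then ∑ q : Fin n × Fin k,
        reduce R d k (vecMul R d k (iterCoef D φ f a dg S p q)
          (untag R _ _ (dmu R q (dmu R p W)))) else 0 with hG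
  have hterm : ∀ (i : Fin n) (σ : Equiv.Perm (Fin n)),
      (koszulSign e σ : ℤ) • reduce R d k (fullBracket D φ (n - (i + 1) + 1) (Fin.cons
        (reduce R d k (fullBracket D φ (i + 1) (fun t : Fin (i + 1) =>
          f (σ ⟨t, by omega⟩) • Pi.single (a (σ ⟨t, by omega⟩)) (X (σ ⟨t, by omega⟩)))))
        (fun t : Fin (n - (i + 1)) => f (σ ⟨i + 1 + t, by omega⟩) •
          Pi.single (a (σ ⟨i + 1 + t, by omega⟩)) (X (σ ⟨i + 1 + t, by omega⟩))))) =
      G (shuffleSet ((i : ℕ) + 1) σ) := by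
    intro i σ
    have hi : (i : ℕ) + 1 + (n - (i + 1)) = n := by omega
    set g : Fin ((i : ℕ) + 1) ↪ Fin n := ⟨fun t => σ ⟨t, by omega⟩, fun t t' h => by
      have := σ.injective h
      simpa [Fin.ext_iff] using this⟩ with hg
    set h : Fin (n - ((i : ℕ) + 1)) ↪ Fin n := ⟨fun t => σ ⟨i + 1 + t, by omega⟩, fun t t' h => by
      have := σ.injective h
      simpa [Fin.ext_iff] using this⟩ with hh
    have hgS : Finset.univ.map g = shuffleSet ((i : ℕ) + 1) σ := by
      ext s
      obtain ⟨t, rfl⟩ := σ.surjective s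
      rw [apply_mem_shuffleSet]
      rw [Finset.mem_map]
      constructor
      · rintro ⟨u, -, hu⟩
        rw [← σ.injective hu]
        exact u.2
      · exact fun ht => ⟨⟨t, ht⟩, Finset.mem_univ _, rfl⟩
    have hhS : Finset.univ.map h = (Finset.univ.map g)ᶜ := by
      rw [hgS]
      ext s
      obtain ⟨t, rfl⟩ := σ.surjective s
      rw [Finset.mem_compl, apply_mem_shuffleSet, Finset.mem_map]
      constructor
      · rintro ⟨u, -, hu⟩
        rw [← σ.injective hu]
        exact (Nat.le_add_right _ _).not_gt
      · intro ht
        exact ⟨⟨t - (i + 1), by omega⟩, Finset.mem_univ _,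
          congrArg σ (Fin.ext (Nat.add_sub_of_le (not_lt.mp ht)))⟩
    have hprod : (List.ofFn fun t => tag R (g t) (X (g t))).prod *
        (List.ofFn fun t => tag R (h t) (X (h t))).prod = (koszulSign e σ : ℤ) • W := by
      rw [hW, ← prod_ofFn_perm (Y := fun s => tag R s (X s))
        (fun t => map_mem_exteriorPower _ (hX t)) he σ]
      exact List.prod_ofFn_mul_prod_ofFn hi fun s => tag R (σ s) (X (σ s))
    have key := jacobi_term (φ := φ) hD (Nat.succ_pos _) g h hhS f a hdg hX hX'
    rw [hprod, hgS] at key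
    refine (congrArg (fun z => (koszulSign e σ : ℤ) • reduce R d k z) key).trans ?_
    rw [hG]
    dsimp only
    split_ifs with h1
    · simp
    · rw [map_sum, Finset.smul_sum]
      refine Finset.sum_congr rfl fun p _ => ?_
      split_ifs with h2
      · rw [map_sum, Finset.smul_sum]
        refine Finset.sum_congr rfl fun q _ => ?_
        simp only [map_zsmul]
        rw [smul_smul, koszulSign_mul_self, one_smul]
      · simp
  simp only [hterm]
  rw [sum_shuffles]
  have hZswap : ∀ p q, untag R (Fin n) (Fin k) (dmu R p (dmu R q W)) =
      -untag R (Fin n) (Fin k) (dmu R q (dmu R p W)) := by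
    intro p q
    rw [dmu_comm, map_neg]
  have hsum : ∑ S : Finset (Fin n) with S.Nonempty, G S =
      ∑ x : (Fin n × Fin k) × (Fin n × Fin k), reduce R d k (vecMul R d k
        (∑ S : Finset (Fin n) with x.1.1 ∈ S ∧ ∑ s ∈ S, dg s ≠ 1, iterCoef D φ f a dg S x.1 x.2)
          (untag R _ _ (dmu R x.2 (dmu R x.1 W)))) := by
    simp only [Fintype.sum_prod_type (α₁ := Fin n × Fin k), map_sum, LinearMap.sum_apply]
    rw [Finset.sum_congr rfl fun p _ => Finset.sum_comm, Finset.sum_filter]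
    simp only [Finset.sum_filter]
    rw [Finset.sum_comm]
    refine Finset.sum_congr rfl fun S _ => ?_
    rw [hG]
    dsimp only
    by_cases h1 : ∑ s ∈ S, dg s = 1
    · simp [h1]
    · rw [if_neg h1]
      split_ifs with h2
      · simp [h1]
      · rw [Finset.not_nonempty_iff_eq_empty] at h2
        simp [h2]
  rw [hsum]
  refine Finset.sum_involution (fun x _ => (x.2, x.1)) ?_ ?_ (fun _ _ => Finset.mem_univ _)
    (fun _ _ => rfl)
  · rintro ⟨p, q⟩ _
    dsimp only
    rw [hZswap p q]
    by_cases h1 : p.1 = q.1 ∧ dg p.1 = 1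
    · rw [dmu_dmu_prod_tag_eq_zero hX h1.1 h1.2]
      simp
    by_cases h2 : ∑ s, dg s = 2
    · -- the iterated bracket has degree zero and is discarded
      have hz : untag R (Fin n) (Fin k) (dmu R q (dmu R p W)) ∈ ⋀[R]^0 (Fin k → R) := by
        rw [h2] at hWdeg
        exact map_mem_exteriorPower _
          (contractLeft_mem_exteriorPower _ (contractLeft_mem_exteriorPower _ hWdeg))
      rw [reduce_vecMul_of_mem_zero _ hz, reduce_vecMul_of_mem_zero _ (neg_mem hz), add_zero]
    · rw [sum_iterCoef_comm hD f a hdg (fun h h' => h1 ⟨h, h'⟩) h2, map_neg, map_neg,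
        add_neg_cancel]
  · rintro ⟨p, q⟩ _ h e
    refine h ?_
    obtain rfl : q = p := congrArg Prod.fst e
    dsimp only
    rw [dmu_dmu]
    simp

end Jacobi
end KoszulLie

/-! ### Multilinear maps -/

section

variable {ι : Type*} [Finite ι] [DecidableEq ι] {M : ι → Type*} {N : Type*}
  [∀ i, AddCommMonoid (M i)] [AddCommMonoid N]

/-- A map which is additive in each variable takes values in the submonoid `Q` on the submonoids
generated by sets `s i`, if it does so on the sets `s i`. -/
theorem MultilinearMap.map_mem_of_forall_mem_closure {K : Type*} [Semiring K] [∀ i, Module K (M i)]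
    [Module K N] (B : MultilinearMap K M N) {s : ∀ i, Set (M i)} {Q : AddSubmonoid N}
    (h : ∀ x : ∀ i, M i, (∀ i, x i ∈ s i) → B x ∈ Q) {x : ∀ i, M i}
    (hx : ∀ i, x i ∈ AddSubmonoid.closure (s i)) : B x ∈ Q := by
  classical
  cases nonempty_fintype ι
  suffices H : ∀ (S : Finset ι) (x : ∀ i, M i), (∀ i ∈ S, x i ∈ AddSubmonoid.closure (s i)) →
      (∀ i ∉ S, x i ∈ s i) → B x ∈ Q from H Finset.univ x (fun i _ => hx i) (by simp)
  intro S
  induction S using Finset.induction_on with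
  | empty => exact fun x _ hx => h x fun i => hx i (by simp)
  | insert i S hi ih =>
    intro x hx hx'
    rw [← Function.update_eq_self i x]
    have hxi := hx i (Finset.mem_insert_self _ _)
    generalize x i = y at hxi
    induction hxi using AddSubmonoid.closure_induction with
    | mem y hy =>
      refine ih _ (fun j hj => ?_) fun j hj => ?_
      · have hji : j ≠ i := fun e => hi (e ▸ hj)
        rw [Function.update_of_ne hji]
        exact hx j (Finset.mem_insert_of_mem hj)
      · by_cases hji : j = i
        · subst hji; rwa [Function.update_self]
        · rw [Function.update_of_ne hji]
          exact hx' j (by simp [hji, hj])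
    | zero => rw [B.map_update_zero]; exact zero_mem _
    | add y z _ _ hy hz => rw [B.map_update_add]; exact add_mem hy hz

end

/-- The composition of two multilinear maps at the first argument of the outer one. -/
def MultilinearMap.compFirst {K M : Type*} [CommSemiring K] [AddCommMonoid M] [Module K M]
    {m r n : ℕ} (e : Fin m ⊕ Fin r ≃ Fin n) (B : MultilinearMap K (fun _ : Fin (r + 1) => M) M)
    (B' : MultilinearMap K (fun _ : Fin m => M) M) : MultilinearMap K (fun _ : Fin n => M) M :=
  (MultilinearMap.uncurrySum (N := fun _ => M) (B.curryLeft.compMultilinearMap B')).domDomCongr e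

/-! ### The graded brackets -/

namespace KoszulLie

open ExteriorAlgebra

variable {d k : ℕ}

/-- The partial derivatives. -/
abbrev partials (d : ℕ) : Fin d → Derivation ℂ (PolyFun d) (PolyFun d) :=
  fun a => MvPolynomial.pderiv a

theorem partials_comm (a b : Fin d) (f : PolyFun d) :
    partials d a (partials d b f) = partials d b (partials d a f) := by
  have h : ⁅partials d a, partials d b⁆ = 0 := by
    refine MvPolynomial.derivation_ext fun c => ?_
    rw [Derivation.commutator_apply]
    simp only [MvPolynomial.pderiv_X]
    by_cases h1 : c = a <;> by_cases h2 : c = b <;> simp [Pi.single_apply, h1, h2]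
    all_goals split_ifs <;> simp
  have h' := congrArg (fun δ : Derivation ℂ (PolyFun d) (PolyFun d) => δ f) h
  simp only [Derivation.commutator_apply] at h'
  exact sub_eq_zero.mp h'

/-- The `n`-ary bracket on `⨁_{j ≥ 1} 𝒦_{-j} ⊗ Der(O)`. -/
def koszulBracket (φ : Fin k → PolyFun d) (n : ℕ) :
    MultilinearMap ℂ (fun _ : Fin n => KoszulSum d k) (KoszulSum d k) :=
  ((coordProj d k).restrictScalars ℂ).compMultilinearMap
    ((fullBracket (partials d) φ n).compLinearMap fun _ => (coordIncl d k).restrictScalars ℂ)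

theorem koszulBracket_apply (φ : Fin k → PolyFun d) (n : ℕ) (x : Fin n → KoszulSum d k) :
    koszulBracket φ n x =
      coordProj d k (fullBracket (partials d) φ n fun i => coordIncl d k (x i)) := rfl

theorem coordIncl_coordProj_eq_reduce (ξ : Fin d → KoszulAlgebra d k) :
    coordIncl d k (coordProj d k ξ) = reduce (PolyFun d) d k ξ :=
  funext fun a => coordIncl_coordProj ξ a

theorem coordIncl_koszulBracket (φ : Fin k → PolyFun d) (n : ℕ) (x : Fin n → KoszulSum d k) :
    coordIncl d k (koszulBracket φ n x) = reduce (PolyFun d) d k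
      (fullBracket (partials d) φ n fun i => coordIncl d k (x i)) := coordIncl_coordProj_eq_reduce _

/-- A multiple `f μ_J ⊗ ∂/∂x_a` of a generator, in coordinates. -/
theorem exists_of_mem_pureElements {w : KoszulSum d k} {p : ℤ} (hw : w ∈ pureElements d k p) :
    ∃ (f : PolyFun d) (a : Fin d) (m : ℕ) (X : KoszulAlgebra d k),
      p = -((m + 1 : ℕ) : ℤ) ∧ X ∈ ⋀[PolyFun d]^(m + 1) (Fin k → PolyFun d) ∧
      X ∈ constants ℂ (PolyFun d) k ∧ coordIncl d k w = f • Pi.single a X := by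
  obtain ⟨m, J, a, f, rfl, rfl⟩ := hw
  refine ⟨f, a, m, muMonomial d (List.ofFn J), by push_cast; rfl, ?_, ?_, ?_⟩
  · simpa using muMonomial_mem (d := d) (List.ofFn J)
  · refine list_prod_mem fun y hy => ?_
    obtain ⟨i, -, rfl⟩ := List.mem_map.mp hy
    exact Algebra.subset_adjoin ⟨i, rfl⟩
  · rw [LinearMap.map_smul, coordIncl_koszulGen]

/-- To check that a multilinear expression in homogeneous elements lies in a submonoid, it suffices
to check it for the elements `f μ_J ⊗ ∂/∂x_a`. -/
theorem multilinear_induction {n : ℕ} {N : Type*} [AddCommMonoid N] [Module ℂ N]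
    (B : MultilinearMap ℂ (fun _ : Fin n => KoszulSum d k) N) (Q : AddSubmonoid N)
    {p : Fin n → ℤ} {x : Fin n → KoszulSum d k}
    (hx : ∀ i, HasDegree (E := KoszulVF d k) (p i) (x i))
    (h : ∀ (y : Fin n → KoszulSum d k) (f : Fin n → PolyFun d) (a : Fin n → Fin d) (m : Fin n → ℕ)
      (X : Fin n → KoszulAlgebra d k), (∀ i, p i = -((m i + 1 : ℕ) : ℤ)) →
      (∀ i, X i ∈ ⋀[PolyFun d]^(m i + 1) (Fin k → PolyFun d)) →
      (∀ i, X i ∈ constants ℂ (PolyFun d) k) →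
      (∀ i, coordIncl d k (y i) = f i • Pi.single (a i) (X i)) → B y ∈ Q) : B x ∈ Q := by
  refine B.map_mem_of_forall_mem_closure (s := fun i => pureElements d k (p i)) (fun y hy => ?_)
    fun i => mem_closure_pureElements (hx i)
  choose f a m X h1 h2 h3 h4 using fun i => exists_of_mem_pureElements (hy i)
  exact h y f a m X h1 h2 h3 h4

theorem eq_of_sub_mem_bot {A : Type*} [AddCommGroup A] {x y : A}
    (h : x - y ∈ (⊥ : AddSubmonoid A)) : x = y :=
  sub_eq_zero.mp (AddSubmonoid.mem_bot.mp h)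

section Generic

variable {K R : Type*} [CommRing K] [CommRing R] [Algebra K R]
  {D : Fin d → Derivation K R R} {φ : Fin k → R} {n : ℕ}

/-- The bracket of the elements `f_s X_s ⊗ ∂_{a(s)}`, taken in any order, as a combination of
contractions of the product of the `X_s`. -/
theorem fullBracket_pure_perm (hD : ∀ a b f, D a (D b f) = D b (D a f)) (f : Fin n → R)
    (a : Fin n → Fin d) {dg : Fin n → ℕ} (hdg : ∀ s, 1 ≤ dg s)
    {X : Fin n → ExteriorAlgebra R (Fin k → R)}
    (hX : ∀ s, X s ∈ ⋀[R]^(dg s) (Fin k → R)) (hX' : ∀ s, X s ∈ constants K R k)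
    {e : Fin n → ℤ} (he : ∀ s, e s = -(dg s : ℤ)) (σ : Equiv.Perm (Fin n)) :
    fullBracket D φ n (fun s => f (σ s) • Pi.single (a (σ s)) (X (σ s))) =
      (koszulSign e σ : ℤ) • ∑ q : Fin n × Fin k, ∑ l', vecMul R d k
        (Pi.single (a l') (coef D φ Finset.univ f a dg q l'))
        (untag R _ _ (dmu R q (List.ofFn fun t => tag R t (X t)).prod)) := by
  have := fullBracket_untag (φ := φ) hD σ.toEmbedding id f a (dg := dg)
      (Y := fun s => tag R s (X s))
      (fun t s c hs => (dmu_tag (σ t) s c (X (σ t))).trans (if_neg hs))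
      (fun _ => hdg _) (fun _ => by rw [untag_tag]; exact hX _)
      (fun _ => by rw [untag_tag]; exact hX' _)
  simp only [untag_tag, id, Finset.map_univ_equiv, Equiv.coe_toEmbedding, Finset.mem_univ,
    if_true] at this
  rw [this, prod_ofFn_perm (Y := fun s => tag R s (X s))
        (fun t => map_mem_exteriorPower _ (hX t)) he σ, Finset.smul_sum]
  refine Finset.sum_congr rfl fun q _ => ?_
  rw [Finset.smul_sum]
  refine Finset.sum_congr rfl fun l' _ => ?_
  simp only [map_zsmul]

end Generic

theorem koszulBracket_symm (φ : Fin k → PolyFun d) (n : ℕ) (x : Fin n → KoszulSum d k)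
    (p : Fin n → ℤ) (hx : ∀ i, HasDegree (E := KoszulVF d k) (p i) (x i))
    (σ : Equiv.Perm (Fin n)) : koszulBracket φ n (fun i => x (σ i)) =
      (koszulSign p σ : ℤ) • koszulBracket φ n x := by
  refine eq_of_sub_mem_bot ?_
  refine multilinear_induction ((koszulBracket φ n).domDomCongr σ -
    (koszulSign p σ : ℤ) • koszulBracket φ n) ⊥ hx fun y f a m X h1 h2 h3 h4 => ?_
  rw [AddSubmonoid.mem_bot]
  refine sub_eq_zero.mpr ?_
  change koszulBracket φ n (fun i => y (σ i)) = (koszulSign p σ : ℤ) • koszulBracket φ n y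
  have h := fun σ => fullBracket_pure_perm (φ := φ) partials_comm f a
    (fun s => Nat.succ_pos (m s)) h2 h3 h1 σ
  have h0 := h 1
  simp only [Equiv.Perm.one_apply, koszulSign_one, Units.val_one, one_smul] at h0
  rw [koszulBracket_apply, koszulBracket_apply, ← map_zsmul]
  congr 1
  simp only [h4]
  rw [h σ, h0]

theorem koszulBracket_degree (φ : Fin k → PolyFun d) (n : ℕ) (x : Fin n → KoszulSum d k)
    (p : Fin n → ℤ) (hx : ∀ i, HasDegree (E := KoszulVF d k) (p i) (x i)) :
    HasDegree (E := KoszulVF d k) ((∑ i, p i) + 1) (koszulBracket φ n x) := by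
  let Q : AddSubmonoid (KoszulSum d k) :=
    { carrier := {x | HasDegree (E := KoszulVF d k) ((∑ i, p i) + 1) x}
      add_mem' := fun {u v} hu hv j hj => by
        change u j + v j = 0
        rw [hu j hj, hv j hj, add_zero]
      zero_mem' := fun _ _ => rfl }
  refine multilinear_induction (koszulBracket φ n) Q hx fun y f a m X h1 h2 h3 h4 => ?_
  change HasDegree (E := KoszulVF d k) ((∑ i, p i) + 1) (koszulBracket φ n y)
  have h0 := fullBracket_pure_perm (φ := φ) partials_comm f a
    (fun s => Nat.succ_pos (m s)) h2 h3 h1 1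
  simp only [Equiv.Perm.one_apply, koszulSign_one, Units.val_one, one_smul] at h0
  have hW : (List.ofFn fun t => tag (PolyFun d) t (X t)).prod ∈
      ⋀[PolyFun d]^(∑ i, (m i + 1)) (Fin n × Fin k → PolyFun d) :=
    prod_ofFn_mem_exteriorPower fun t => map_mem_exteriorPower _ (h2 t)
  have hp : ∑ i, p i = -((∑ i, (m i + 1) : ℕ) : ℤ) := by
    rw [Nat.cast_sum, ← Finset.sum_neg_distrib]
    exact Finset.sum_congr rfl fun i _ => h1 i
  have hc := coordIncl_koszulBracket φ n y
  simp only [h4] at hc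
  rw [h0] at hc
  have hzero : ∀ z : KoszulSum d k, coordIncl d k z = 0 → z = 0 := fun z hz =>
    coordIncl_injective (hz.trans (map_zero _).symm)
  -- a contraction of an element of degree zero vanishes, and one of an element of degree one is
  -- discarded
  obtain hs | hs | ⟨e, hs⟩ : ∑ i, (m i + 1) = 0 ∨ ∑ i, (m i + 1) = 1 ∨
      ∃ e, ∑ i, (m i + 1) = e + 1 + 1 := by
    rcases h : ∑ i, (m i + 1) with _ | _ | e
    · exact Or.inl rfl
    · exact Or.inr (Or.inl rfl)
    · exact Or.inr (Or.inr ⟨e, rfl⟩)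
  · rw [hs] at hW
    rw [hzero (koszulBracket φ n y)]
    · exact fun _ _ => rfl
    · rw [hc, map_sum]
      refine Finset.sum_eq_zero fun q _ => ?_
      have : dmu (PolyFun d) q (List.ofFn fun t => tag (PolyFun d) t (X t)).prod = 0 :=
        contractLeft_eq_zero_of_mem _ hW
      simp [this]
  · rw [hs] at hW
    rw [hzero (koszulBracket φ n y)]
    · exact fun _ _ => rfl
    · rw [hc, map_sum]
      refine Finset.sum_eq_zero fun q _ => ?_
      rw [map_sum]
      exact Finset.sum_eq_zero fun l _ => reduce_vecMul_of_mem_zero _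
        (map_mem_exteriorPower _ (contractLeft_mem_exteriorPower _ hW))
  · rw [hs] at hW
    have : (∑ i, p i) + 1 = -((e : ℤ) + 1) := by rw [hp, hs]; push_cast; ring
    rw [this]
    refine hasDegree_of_coordIncl_mem fun b => ?_
    have hmem : ∀ q, untag (PolyFun d) (Fin n) (Fin k)
        (dmu (PolyFun d) q (List.ofFn fun t => tag (PolyFun d) t (X t)).prod) ∈
        ⋀[PolyFun d]^(e + 1) (Fin k → PolyFun d) := fun q =>
      map_mem_exteriorPower _ (contractLeft_mem_exteriorPower _ hW)
    rw [hc, map_sum, Finset.sum_apply]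
    refine sum_mem fun q _ => ?_
    rw [map_sum, Finset.sum_apply]
    refine sum_mem fun l _ => ?_
    rw [reduce_vecMul_of_mem_succ _ (hmem q), vecMul_apply]
    exact Submodule.smul_mem _ _ (hmem q)

theorem koszulBracket_jacobi (φ : Fin k → PolyFun d) (n : ℕ) (x : Fin n → KoszulSum d k)
    (p : Fin n → ℤ) (hx : ∀ i, HasDegree (E := KoszulVF d k) (p i) (x i)) :
    ∑ i : Fin n, ∑ σ : Equiv.Perm (Fin n) with IsShuffle ((i : ℕ) + 1) σ,
      (koszulSign p σ : ℤ) • koszulBracket φ (n - (i + 1) + 1) (Fin.cons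
        (koszulBracket φ (i + 1) (fun t : Fin (i + 1) => x (σ ⟨t, by omega⟩)))
        (fun t : Fin (n - (i + 1)) => x (σ ⟨i + 1 + t, by omega⟩))) = 0 := by
  have hi : ∀ i : Fin n, (i : ℕ) + 1 + (n - (i + 1)) = n := fun i => by omega
  let B : MultilinearMap ℂ (fun _ : Fin n => KoszulSum d k) (KoszulSum d k) :=
    ∑ i : Fin n, ∑ σ : Equiv.Perm (Fin n) with IsShuffle ((i : ℕ) + 1) σ,
      (koszulSign p σ : ℤ) • (koszulBracket φ (n - (i + 1) + 1)).compFirst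
        ((finSumFinEquiv.trans (finCongr (hi i))).trans σ) (koszulBracket φ (i + 1))
  have hB : ∀ y, B y = ∑ i : Fin n, ∑ σ : Equiv.Perm (Fin n) with IsShuffle ((i : ℕ) + 1) σ,
      (koszulSign p σ : ℤ) • koszulBracket φ (n - (i + 1) + 1) (Fin.cons
        (koszulBracket φ (i + 1) (fun t : Fin (i + 1) => y (σ ⟨t, by omega⟩)))
        (fun t : Fin (n - (i + 1)) => y (σ ⟨i + 1 + t, by omega⟩))) := by
    intro y
    simp only [B, sum_apply]
    rfl
  rw [← hB]
  refine AddSubmonoid.mem_bot.mp (multilinear_induction B ⊥ hx fun y f a m X h1 h2 h3 h4 => ?_)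
  rw [AddSubmonoid.mem_bot, hB]
  refine coordIncl_injective ?_
  rw [map_zero, ← jacobi_pure (φ := φ) partials_comm f a (fun s => Nat.succ_pos (m s)) h2 h3 h1 h4,
    map_sum]
  refine Finset.sum_congr rfl fun i _ => ?_
  rw [map_sum]
  refine Finset.sum_congr rfl fun σ _ => ?_
  rw [map_zsmul, coordIncl_koszulBracket]
  congr 3
  funext t
  induction t using Fin.cases with
  | zero => exact coordIncl_koszulBracket _ _ _
  | succ t => rfl

end KoszulLie

/-! ### The anchor and the Leibniz rule -/

namespace KoszulLie

open ExteriorAlgebra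

variable {d k : ℕ} (φ : Fin k → PolyFun d)

theorem koszulBracket_zero : koszulBracket φ 0 = 0 := by
  refine MultilinearMap.ext fun x => coordIncl_injective ?_
  rw [coordIncl_koszulBracket]
  have h : (fullBracket (partials d) φ 0 fun i => coordIncl d k (x i)) = 0 := by
    have := fullBracket_pure (D := partials d) (φ := φ) (m := 0) (fun i => 1) (fun i => i.elim0)
      (dg := fun i => i.elim0) (fun i => i.elim0) (X := fun i => i.elim0) (fun i => i.elim0)
      (fun i => i.elim0)
    rw [Fintype.sum_empty] at this
    rw [← this]
    congr 1
    exact funext fun i => i.elim0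
  rw [h]
  exact (map_zero _).trans (map_zero _).symm

/-- The `O`-multilinear part of the bracket. -/
def koszulLinPart (n : ℕ) :
    MultilinearMap (PolyFun d) (fun _ : Fin n => KoszulSum d k) (KoszulSum d k) :=
  (coordProj d k).compMultilinearMap
    ((linPart (partials d) φ n).compLinearMap fun _ => coordIncl d k)

theorem koszulBracket_eq_of_ne {n : ℕ} (hn : n ≠ 2) (x : Fin n → KoszulSum d k) :
    koszulBracket φ n x = koszulLinPart φ n x := by
  rw [koszulBracket_apply, fullBracket_apply, corrPart_of_ne _ _ hn]
  exact congrArg (coordProj d k) (add_zero _)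

theorem koszulBracket_smul {n : ℕ} (hn : n ≠ 2) (x : Fin n → KoszulSum d k) (i : Fin n)
    (f : PolyFun d) :
    koszulBracket φ n (Function.update x i (f • x i)) = f • koszulBracket φ n x := by
  rw [koszulBracket_eq_of_ne φ hn, koszulBracket_eq_of_ne φ hn, MultilinearMap.map_update_smul,
    Function.update_eq_self]

theorem koszulBracket_two (x y : KoszulSum d k) : koszulBracket φ 2 ![x, y] =
    koszulLinPart φ 2 ![x, y] + coordProj d k
      (anchorDeriv (partials d) φ (coordIncl d k x) (coordIncl d k y) +
        anchorDeriv (partials d) φ (coordIncl d k y) (involuteF (coordIncl d k x))) :=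
  (coordProj d k).map_add _ _

/-- The anchor, which sends `x` to the vector field with coefficients `anchorCoeff φ x`. -/
def koszulAnchor : KoszulVF d k 0 →ₗ[PolyFun d] VF d :=
  (vfCoord d).symm.toLinearMap ∘ₗ anchorCoeff φ ∘ₗ coordIncl d k ∘ₗ
    DirectSum.lof (PolyFun d) ℕ (KoszulVF d k) 0

theorem koszulAnchor_X (x : KoszulVF d k 0) (a : Fin d) : koszulAnchor φ x (MvPolynomial.X a) =
    anchorCoeff φ (coordIncl d k (DirectSum.of (KoszulVF d k) 0 x)) a :=
  congrFun ((vfCoord d).apply_symm_apply _) a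

theorem koszulAnchor_apply (x : KoszulVF d k 0) (f : PolyFun d) : koszulAnchor φ x f =
    ∑ a, anchorCoeff φ (coordIncl d k (DirectSum.of (KoszulVF d k) 0 x)) a * partials d a f := by
  conv_lhs => rw [VF.eq_sum (koszulAnchor φ x)]
  have h : ∀ (s : Finset (Fin d)) (g : Fin d → VF d), (∑ a ∈ s, g a) f = ∑ a ∈ s, g a f :=
    fun s g => map_sum (AddMonoidHom.mk' (fun V : VF d => V f) fun _ _ => rfl) g s
  rw [h]
  refine Finset.sum_congr rfl fun a _ => ?_
  rw [koszulAnchor_X]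
  rfl

theorem anchorCoeff_coordIncl_of_zero (x : KoszulSum d k) :
    anchorCoeff φ (coordIncl d k (DirectSum.of (KoszulVF d k) 0 (x 0))) =
      anchorCoeff φ (coordIncl d k x) := by
  induction x using DirectSum.induction_on with
  | zero =>
    rw [DirectSum.zero_apply, AddMonoidHom.map_zero]
  | add x y hx hy =>
    rw [DirectSum.add_apply, AddMonoidHom.map_add, LinearMap.map_add, LinearMap.map_add,
      LinearMap.map_add, LinearMap.map_add, hx, hy]
  | of j x =>
    obtain _ | j := j
    · rw [DirectSum.of_eq_same]
    · rw [DirectSum.of_eq_of_ne _ _ _ (Nat.succ_ne_zero j).symm, AddMonoidHom.map_zero,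
        LinearMap.map_zero, LinearMap.map_zero]
      symm
      funext a
      rw [anchorCoeff_apply]
      exact algebraMapInv_of_mem
        (koszulD_mem_exteriorPower φ (coordIncl_of_mem (j + 1) x a))

theorem anchorCoeff_reduce (ξ : Fin d → KoszulAlgebra d k) :
    anchorCoeff φ (reduce (PolyFun d) d k ξ) = anchorCoeff φ ξ := by
  funext a
  rw [anchorCoeff_apply, anchorCoeff_apply, reduce_apply, map_sub, koszulD_algebraMap, sub_zero]

theorem koszulAnchor_koszulBracket_apply (n : ℕ) (x : Fin n → KoszulSum d k) (a : Fin d) :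
    koszulAnchor φ (koszulBracket φ n x 0) (MvPolynomial.X a) =
      anchorCoeff φ (fullBracket (partials d) φ n fun i => coordIncl d k (x i)) a := by
  rw [koszulAnchor_X, anchorCoeff_coordIncl_of_zero, coordIncl_koszulBracket, anchorCoeff_reduce]

theorem koszulBracket_leibniz (x y : KoszulSum d k) (f : PolyFun d) :
    koszulBracket φ 2 ![x, f • y] =
      koszulAnchor φ (x 0) f • y + f • koszulBracket φ 2 ![x, y] := by
  have h1 : koszulLinPart φ 2 ![x, f • y] = f • koszulLinPart φ 2 ![x, y] := by
    have := (koszulLinPart φ 2).map_update_smul ![x, y] 1 f y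
    have e : ∀ z, Function.update ![x, y] 1 z = ![x, z] := by
      intro z; funext i; fin_cases i <;> rfl
    rwa [e, e] at this
  rw [koszulBracket_two, koszulBracket_two, h1, LinearMap.map_smul, anchorDeriv_smul_right,
    anchorDeriv_smul_left, koszulAnchor_apply, anchorCoeff_coordIncl_of_zero, smul_add, add_assoc,
    LinearMap.map_add, LinearMap.map_smul, coordProj_coordIncl, LinearMap.map_add,
    LinearMap.map_add, smul_add, LinearMap.map_smul, LinearMap.map_smul]
  abel

/-- The unary bracket is the Koszul differential, in each coordinate. -/
theorem fullBracket_one (ξ : Fin d → KoszulAlgebra d k) (a : Fin d) :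
    fullBracket (partials d) φ 1 ![ξ] a = koszulD φ (ξ a) := by
  have h : fullBracket (partials d) φ 1 ![ξ] = linPart (partials d) φ 1 ![ξ] := by
    rw [fullBracket_apply, corrPart_of_ne _ _ (by norm_num)]
    exact add_zero _
  have hl : ∀ (c : Fin k) (Y : Fin 1 → KoszulAlgebra d k),
      leibnizMultilinear (PolyFun d) 0 c Y = dmu (PolyFun d) c (Y 0) := by
    intro c Y
    rw [leibnizMultilinear_apply, leibnizTerm_zero]
    simp [dmu]
  have he : (Finset.univ : Finset (Fin 1)).erase 0 = ∅ := rfl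
  rw [h, linPart, sum_apply, Finset.sum_apply,
    Fintype.sum_equiv (Equiv.funUnique (Fin 1) (Fin d)) _
      (fun b => (Pi.single b (koszulD φ (ξ b)) : Fin d → KoszulAlgebra d k) a)]
  · simp
  · intro b
    simp only [Fin.sum_univ_one, Fin.isValue, sum_apply, smul_apply,
      LinearMap.compMultilinearMap_apply, MultilinearMap.compLinearMap_apply, hl, he, pd_empty,
      Nat.sub_self, pow_zero, one_mul, koszulD, LinearMap.sum_apply, LinearMap.smul_apply]
    have e : ∀ c, (Pi.single (b 0) (φ c • dmu (PolyFun d) c (ξ (b 0))) :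
        Fin d → KoszulAlgebra d k) =
        φ c • Pi.single (b 0) (dmu (PolyFun d) c (ξ (b 0))) := fun c => Pi.single_smul _ _ _
    have e2 : (Pi.single (b 0) (∑ c, φ c • dmu (PolyFun d) c (ξ (b 0))) :
        Fin d → KoszulAlgebra d k) =
        ∑ c, Pi.single (b 0) (φ c • dmu (PolyFun d) c (ξ (b 0))) :=
      map_sum (AddMonoidHom.single (fun _ => KoszulAlgebra d k) (b 0)) _ _
    change _ = (Pi.single (b 0) (∑ c, φ c • dmu (PolyFun d) c (ξ (b 0))) :
        Fin d → KoszulAlgebra d k) a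
    rw [e2]
    simp only [e]
    rfl

theorem koszulAnchor_bracket_one (x : KoszulVF d k 1) :
    koszulAnchor φ (koszulBracket φ 1 ![DirectSum.of (KoszulVF d k) 1 x] 0) = 0 := by
  refine MvPolynomial.derivation_ext fun a => ?_
  rw [koszulAnchor_koszulBracket_apply]
  have e : (fun i => coordIncl d k (![DirectSum.of (KoszulVF d k) 1 x] i)) =
      ![coordIncl d k (DirectSum.of (KoszulVF d k) 1 x)] := by
    funext i; fin_cases i; rfl
  rw [e, anchorCoeff_apply, fullBracket_one, koszulD_koszulD, map_zero]
  rfl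

theorem koszulVF_projective (j : ℕ) : Module.Projective (PolyFun d) (KoszulVF d k j) := by
  have : Module.Free (PolyFun d) (VF d) := Module.Free.of_equiv (vfCoord d).symm
  infer_instance

theorem mem_closure_of_degree_one (x : KoszulVF d k 0) : x ∈ AddSubmonoid.closure
    {y : KoszulVF d k 0 | ∃ (f : PolyFun d) (i : Fin k) (a : Fin d),
      y = f • koszulGen (fun _ => i) a} := by
  have h : x ∈ Submodule.span (PolyFun d)
      (Set.range fun x : (Fin (0 + 1) → Fin k) × Fin d => koszulGen x.1 x.2) := by
    rw [span_koszulGen]; trivial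
  induction h using Submodule.closure_induction with
  | zero => exact zero_mem _
  | add _ _ _ _ hy hz => exact add_mem hy hz
  | smul_mem f _ hy =>
    obtain ⟨⟨J, a⟩, rfl⟩ := hy
    refine AddSubmonoid.subset_closure ⟨f, J 0, a, ?_⟩
    have : J = fun _ => J 0 := funext fun t => congrArg J (Subsingleton.elim (α := Fin 1) _ _)
    rw [← this]

theorem coordIncl_degree_one (f : PolyFun d) (i : Fin k) (a : Fin d) :
    coordIncl d k (DirectSum.of (KoszulVF d k) 0 (f • koszulGen (fun _ => i) a)) =
      f • Pi.single a (mu (PolyFun d) i) := by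
  have h : DirectSum.of (KoszulVF d k) 0 (f • koszulGen (fun _ => i) a) =
      f • DirectSum.of (KoszulVF d k) 0 (koszulGen (fun _ => i) a) :=
    (DirectSum.lof (PolyFun d) ℕ (KoszulVF d k) 0).map_smul f _
  rw [h, LinearMap.map_smul, coordIncl_koszulGen]
  congr 2
  simp [muMonomial, mu, muVec]

theorem koszulD_mu (i : Fin k) :
    koszulD φ (mu (PolyFun d) i) = algebraMap _ _ (φ i) := by
  have h := koszulD_mu_mul φ i (1 : KoszulAlgebra d k)
  have h1 : koszulD φ (1 : KoszulAlgebra d k) = 0 := by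
    rw [← map_one (algebraMap (PolyFun d) _), koszulD_algebraMap]
  rw [mul_one, h1, mul_zero, sub_zero] at h
  rw [h, Algebra.smul_def, mul_one]

theorem anchorCoeff_single_mu (f : PolyFun d) (i : Fin k) (a : Fin d) :
    anchorCoeff φ (f • Pi.single a (mu (PolyFun d) i)) = Pi.single a (f * φ i) := by
  rw [map_smul]
  funext b
  rw [Pi.smul_apply, anchorCoeff_apply]
  by_cases h : b = a
  · subst h
    rw [Pi.single_eq_same, koszulD_mu, algebraMap_leftInverse, Pi.single_eq_same, smul_eq_mul]
  · rw [Pi.single_eq_of_ne h, Pi.single_eq_of_ne h, map_zero, map_zero, smul_zero]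

theorem koszulAnchor_gen (i : Fin k) (a : Fin d) :
    koszulAnchor φ (koszulGen (fun _ => i) a) = φ i • MvPolynomial.pderiv a := by
  refine MvPolynomial.derivation_ext fun b => ?_
  have h := coordIncl_degree_one (1 : PolyFun d) i a
  rw [one_smul] at h
  rw [koszulAnchor_X, h, anchorCoeff_single_mu, one_mul, Derivation.smul_apply]
  by_cases e : b = a
  · subst e; simp
  · simp [e, MvPolynomial.pderiv_X_of_ne e]

theorem anchorCoeff_vecMul (v : Fin d → PolyFun d) (i : Fin k) :
    anchorCoeff φ (vecMul (PolyFun d) d k v (mu (PolyFun d) i)) = φ i • v := by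
  funext b
  rw [anchorCoeff_apply, vecMul_apply, map_smul, koszulD_mu, map_smul, algebraMap_leftInverse,
    smul_eq_mul, mul_comm]
  rfl

theorem dmu_mu (i j : Fin k) : dmu (PolyFun d) i (mu (PolyFun d) j) = if i = j then 1 else 0 := by
  have h := dmu_mu_mul i j (1 : KoszulAlgebra d k)
  have h1 : dmu (PolyFun d) i (1 : KoszulAlgebra d k) = 0 := CliffordAlgebra.contractLeft_one _ _
  rw [mul_one, h1, mul_zero, sub_zero] at h
  exact h

/-- The coefficients of the commutator of `f φᵢ ∂/∂x_a` and `g φⱼ ∂/∂x_b`. -/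
theorem anchorCoeff_fullBracket_two (f g : PolyFun d) (i j : Fin k) (a b : Fin d) :
    anchorCoeff φ (fullBracket (partials d) φ 2 ![f • Pi.single a (mu (PolyFun d) i),
      g • Pi.single b (mu (PolyFun d) j)]) =
    Pi.single b (f * φ i * partials d a (g * φ j)) -
      Pi.single a (g * φ j * partials d b (f * φ i)) := by
  have hmem : ∀ i : Fin k, mu (PolyFun d) i ∈ ⋀[PolyFun d]^1 (Fin k → PolyFun d) := fun i => by
    rw [ExteriorAlgebra.exteriorPower, pow_one]; exact ⟨_, rfl⟩
  have hconst : ∀ i : Fin k, mu (PolyFun d) i ∈ constants ℂ (PolyFun d) k := fun i =>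
    Algebra.subset_adjoin ⟨i, rfl⟩
  have h := fullBracket_pure (D := partials d) (φ := φ) ![f, g] ![a, b] (dg := fun _ => 1)
    (fun _ => le_rfl) (X := ![mu (PolyFun d) i, mu (PolyFun d) j])
    (fun s => by fin_cases s <;> exact hmem _) (fun s => by fin_cases s <;> exact hconst _)
  have e : (fun s => ![f, g] s • (Pi.single (![a, b] s) (![mu (PolyFun d) i, mu (PolyFun d) j] s) :
      Fin d → KoszulAlgebra d k)) =
      ![f • Pi.single a (mu (PolyFun d) i), g • Pi.single b (mu (PolyFun d) j)] := by
    funext s; fin_cases s <;> rfl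
  have hl0 : ∀ c, leibnizTerm (LinearMap.proj c) 0 ![mu (PolyFun d) i, mu (PolyFun d) j] =
      (if c = i then (1 : PolyFun d) else 0) • mu (PolyFun d) j := by
    intro c
    have : leibnizTerm (LinearMap.proj c) 0 ![mu (PolyFun d) i, mu (PolyFun d) j] =
        dmu (PolyFun d) c (mu (PolyFun d) i) * mu (PolyFun d) j := by
      rw [leibnizTerm_zero]; simp [dmu]
    rw [this, dmu_mu]
    split_ifs <;> simp
  have hl1 : ∀ c, leibnizTerm (LinearMap.proj c) 1 ![mu (PolyFun d) i, mu (PolyFun d) j] =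
      (if c = j then (-1 : PolyFun d) else 0) • mu (PolyFun d) i := by
    intro c
    have : leibnizTerm (LinearMap.proj c) 1 ![mu (PolyFun d) i, mu (PolyFun d) j] =
        CliffordAlgebra.involute (mu (PolyFun d) i) * dmu (PolyFun d) c (mu (PolyFun d) j) := by
      have := leibnizTerm_succ (LinearMap.proj c) 0 ![mu (PolyFun d) i, mu (PolyFun d) j]
      rw [leibnizTerm_zero] at this
      simpa [dmu] using this
    rw [this, dmu_mu, mu, CliffordAlgebra.involute_ι]
    split_ifs <;> simp
  rw [e] at h
  rw [h, Fintype.sum_prod_type]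
  simp only [Fin.sum_univ_two, hl0, hl1, map_smul, map_add, map_sum, anchorCoeff_vecMul]
  have e0 : (Finset.univ : Finset (Fin 2)).erase 0 = {1} := rfl
  have e1 : (Finset.univ : Finset (Fin 2)).erase 1 = {0} := rfl
  simp only [coef, e0, e1, pd, Finset.toList_singleton, List.map_cons, List.map_nil,
    List.foldr_cons, List.foldr_nil, Fin.prod_univ_two, Matrix.cons_val_zero, Matrix.cons_val_one,
    Finset.card_univ, Fintype.card_fin, and_self, if_true, if_false, zero_ne_one, one_ne_zero,
    ite_smul, one_smul, zero_smul, neg_smul, Finset.sum_add_distrib, Finset.sum_ite_eq',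
    Finset.mem_univ]
  funext t
  simp only [Pi.add_apply, Pi.sub_apply, Pi.neg_apply, Pi.smul_apply, Pi.single_apply,
    Derivation.leibniz, smul_eq_mul]
  split_ifs <;> ring

theorem koszulAnchor_bracket_two (x y : KoszulVF d k 0) :
    koszulAnchor φ (koszulBracket φ 2 ![DirectSum.of (KoszulVF d k) 0 x,
      DirectSum.of (KoszulVF d k) 0 y] 0) = ⁅koszulAnchor φ x, koszulAnchor φ y⁆ := by
  have hright : ∀ u v w : KoszulSum d k,
      koszulBracket φ 2 ![u, v + w] = koszulBracket φ 2 ![u, v] + koszulBracket φ 2 ![u, w] := by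
    intro u v w
    have := (koszulBracket φ 2).map_update_add ![u, v] 1 v w
    have e : ∀ z, Function.update ![u, v] 1 z = ![u, z] := by
      intro z; funext i; fin_cases i <;> rfl
    rwa [e, e, e] at this
  have hleft : ∀ u v w : KoszulSum d k,
      koszulBracket φ 2 ![u + v, w] = koszulBracket φ 2 ![u, w] + koszulBracket φ 2 ![v, w] :=
    fun u v w => (koszulBracket φ 2).cons_add ![w] u v
  have hright0 : ∀ u : KoszulSum d k, koszulBracket φ 2 ![u, 0] = 0 := fun u =>
    (koszulBracket φ 2).map_coord_zero 1 rfl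
  have hleft0 : ∀ u : KoszulSum d k, koszulBracket φ 2 ![0, u] = 0 := fun u =>
    (koszulBracket φ 2).map_coord_zero 0 rfl
  induction mem_closure_of_degree_one x using AddSubmonoid.closure_induction with
  | zero =>
    rw [AddMonoidHom.map_zero, hleft0, LinearMap.map_zero, zero_lie]
    exact LinearMap.map_zero _
  | add x x' _ _ hx hx' =>
    rw [AddMonoidHom.map_add, hleft, DirectSum.add_apply, LinearMap.map_add, hx, hx',
      LinearMap.map_add, add_lie]
  | mem x hx =>
    induction mem_closure_of_degree_one y using AddSubmonoid.closure_induction with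
    | zero =>
      rw [AddMonoidHom.map_zero, hright0, LinearMap.map_zero]
      exact (LinearMap.map_zero _).trans (lie_zero (koszulAnchor φ x)).symm
    | add y y' _ _ hy hy' =>
      rw [AddMonoidHom.map_add, hright, DirectSum.add_apply, LinearMap.map_add, hy, hy',
        LinearMap.map_add]
      exact (lie_add (koszulAnchor φ x) (koszulAnchor φ y) (koszulAnchor φ y')).symm
    | mem y hy =>
      obtain ⟨f, i, a, rfl⟩ := hx
      obtain ⟨g, j, b, rfl⟩ := hy
      refine MvPolynomial.derivation_ext fun c => ?_
      rw [koszulAnchor_koszulBracket_apply]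
      have e : (fun s => coordIncl d k
          (![DirectSum.of (KoszulVF d k) 0 (f • koszulGen (fun _ => i) a),
          DirectSum.of (KoszulVF d k) 0 (g • koszulGen (fun _ => j) b)] s)) =
          ![f • Pi.single a (mu (PolyFun d) i), g • Pi.single b (mu (PolyFun d) j)] := by
        funext s
        fin_cases s
        · exact coordIncl_degree_one f i a
        · exact coordIncl_degree_one g j b
      rw [e, anchorCoeff_fullBracket_two, Derivation.commutator_apply, LinearMap.map_smul,
        LinearMap.map_smul, koszulAnchor_gen, koszulAnchor_gen]
      have hX : ∀ a : Fin d, MvPolynomial.pderiv a (MvPolynomial.X c : PolyFun d) =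
          if c = a then 1 else 0 := by
        intro a
        by_cases h : c = a
        · subst h; simp
        · simp [h, MvPolynomial.pderiv_X_of_ne h]
      simp only [Derivation.smul_apply, hX, Pi.sub_apply, Pi.single_apply, smul_eq_mul, mul_ite,
        mul_one, mul_zero, mul_assoc]
      split_ifs <;> simp

/-- The Lie ∞-algebroid on `𝒦 ⊗ Der(O)` attached to `φ`. -/
def koszulAlgebroid : LieInftyAlgebroid ℂ (PolyFun d) (KoszulVF d k) where
  projective := koszulVF_projective
  bracket := koszulBracket φ
  anchor := koszulAnchor φ
  bracket_zero := koszulBracket_zero φ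
  bracket_degree := koszulBracket_degree φ
  bracket_symm := koszulBracket_symm φ
  jacobi := koszulBracket_jacobi φ
  bracket_smul _ hn := koszulBracket_smul φ hn
  leibniz := koszulBracket_leibniz φ
  anchor_bracket_one := koszulAnchor_bracket_one φ
  anchor_bracket_two := koszulAnchor_bracket_two φ

end KoszulLie

/-! ### The brackets of the generators -/

namespace ExteriorAlgebra

variable {R M : Type*} [CommRing R] [AddCommGroup M] [Module R M]

theorem leibnizTerm_mem_exteriorPower {n : ℕ} (δ : Module.Dual R M) (l : Fin n) {m : Fin n → ℕ}
    {Y : Fin n → ExteriorAlgebra R M} (hY : ∀ s, Y s ∈ ⋀[R]^(m s + 1) M) :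
    leibnizTerm δ l Y ∈ ⋀[R]^(∑ s, if s = l then m s else m s + 1) M := by
  refine prod_ofFn_mem_exteriorPower fun s => ?_
  by_cases h1 : s < l
  · rw [if_pos h1, if_neg h1.ne, involute_of_mem (hY s)]
    exact zsmul_mem (hY s) _
  · rw [if_neg h1]
    split_ifs with h2
    · exact contractLeft_mem_exteriorPower δ (hY s)
    · exact hY s

/-- The sign of the `l`-th term of the Leibniz rule, for homogeneous factors. -/
theorem leibnizTerm_eq_smul {n : ℕ} (δ : Module.Dual R M) (l : Fin n) {q : Fin n → ℕ}
    {Y : Fin n → ExteriorAlgebra R M} (hY : ∀ s, Y s ∈ ⋀[R]^(q s) M) :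
    leibnizTerm δ l Y = (-1 : R) ^ (∑ s ∈ Finset.Iio l, q s) •
      MultilinearMap.mkPiAlgebraFin R n (ExteriorAlgebra R M)
        (Function.update Y l (CliffordAlgebra.contractLeft δ (Y l))) := by
  have h : leibnizTerm δ l Y = MultilinearMap.mkPiAlgebraFin R n (ExteriorAlgebra R M)
      (fun s => (if s < l then (-1 : R) ^ q s else 1) •
        Function.update Y l (CliffordAlgebra.contractLeft δ (Y l)) s) := by
    rw [leibnizTerm, MultilinearMap.mkPiAlgebraFin_apply]
    congr 2
    funext s
    split_ifs with h1 h2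
    · rw [Function.update_of_ne h1.ne, involute_of_mem (hY s)]
      rcases neg_one_pow_eq_or ℤ (q s) with h | h <;> rcases Nat.even_or_odd (q s) with h' | h' <;>
        simp [h'.neg_one_pow]
    · subst h2; rw [Function.update_self, one_smul]
    · rw [Function.update_of_ne h2, one_smul]
  rw [h, MultilinearMap.map_smul_univ]
  congr 1
  rw [Finset.prod_ite, Finset.prod_const_one, mul_one, Finset.prod_pow_eq_pow_sum]
  congr 2
  ext s; simp

end ExteriorAlgebra

namespace KoszulLie

open ExteriorAlgebra

variable {d k : ℕ} (φ : Fin k → PolyFun d)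

theorem dmu_muMonomial (c : Fin k) {m : ℕ} (J : Fin m → Fin k) :
    dmu (PolyFun d) c (muMonomial d (List.ofFn J)) =
      ∑ t : Fin m, if J t = c then (-1 : PolyFun d) ^ (t : ℕ) •
        muMonomial d ((List.ofFn J).eraseIdx t) else 0 := by
  induction m with
  | zero => exact CliffordAlgebra.contractLeft_one _ _
  | succ m ih =>
    have hcons : ∀ (i : Fin k) (L : List (Fin k)),
        muMonomial d (i :: L) = mu (PolyFun d) i * muMonomial d L := fun i L => by
      rw [muMonomial, List.map_cons, List.prod_cons]
      rfl
    rw [List.ofFn_succ, hcons, dmu_mu_mul, ih, Fin.sum_univ_succ]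
    simp only [Fin.val_zero, Fin.val_succ, List.eraseIdx_cons_zero, List.eraseIdx_cons_succ, hcons,
      pow_zero, one_smul, pow_succ, mul_neg, mul_one, neg_smul, Finset.mul_sum, mul_ite, mul_zero,
      mul_smul_comm]
    rw [sub_eq_add_neg, ← Finset.sum_neg_distrib]
    congr 1
    · simp only [eq_comm]
    · refine Finset.sum_congr rfl fun t _ => ?_
      split_ifs <;> simp

/-- The iterated derivative in the explicit formula, as an iterated derivative along a set of
indices. -/
theorem iteratedPDeriv_eraseIdx {n : ℕ} (a : Fin n → Fin d) (l : Fin n) (f : PolyFun d) :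
    iteratedPDeriv ((List.ofFn a).eraseIdx l) f = pd (partials d) a (Finset.univ.erase l) f := by
  have h : ((List.finRange n).eraseIdx l).Perm (Finset.univ.erase l : Finset (Fin n)).toList := by
    rw [← List.erase_eq_eraseIdx_of_idxOf (List.idxOf_finRange l)]
    refine (List.perm_ext_iff_of_nodup ((List.nodup_finRange n).erase l)
      (Finset.nodup_toList _)).mpr fun s => ?_
    rw [(List.nodup_finRange n).mem_erase_iff]
    simp
  rw [pd, ← foldr_perm partials_comm (h.map a), List.ofFn_eq_map, List.eraseIdx_map]
  rfl

theorem koszulCoord_sum {α : Type*} (s : Finset α) (g : α → KoszulAlgebra d k ⊗[PolyFun d] VF d) :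
    koszulCoord d k (∑ i ∈ s, g i) = ∑ i ∈ s, koszulCoord d k (g i) :=
  map_sum (koszulCoord d k).toLinearMap.toAddMonoidHom g s

theorem koszulBracket_gen {n : ℕ} (m : Fin n → ℕ) (J : ∀ l, Fin (m l + 1) → Fin k)
    (a : Fin n → Fin d) (hn : 2 ≤ n ∨ ∃ l, 1 ≤ m l) :
    koszulIncl d k (koszulBracket φ n fun l =>
      DirectSum.of (KoszulVF d k) (m l) (koszulGen (J l) (a l))) =
        koszulBracketFormula φ m J a := by
  set X : Fin n → KoszulAlgebra d k := fun l => muMonomial d (List.ofFn (J l)) with hX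
  have hdeg : ∀ l, X l ∈ ⋀[PolyFun d]^(m l + 1) (Fin k → PolyFun d) := fun l => by
    have h := muMonomial_mem (d := d) (List.ofFn (J l))
    rwa [List.length_ofFn] at h
  have hconst : ∀ l, X l ∈ constants ℂ (PolyFun d) k := fun l => by
    refine list_prod_mem fun y hy => ?_
    obtain ⟨i, -, rfl⟩ := List.mem_map.mp hy
    exact Algebra.subset_adjoin ⟨i, rfl⟩
  have hpure := fullBracket_pure (D := partials d) (φ := φ) (fun _ => 1) a
    (fun l => Nat.succ_pos (m l)) hdeg hconst
  -- the generators have coefficient `1`, whose derivatives vanish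
  have hcoef : ∀ (p : Fin n × Fin k) (l' : Fin n),
      coef (partials d) φ Finset.univ (fun _ => 1) a (fun l => m l + 1) p l' =
      if l' = p.1 then
        (-1) ^ (n - 1) * pd (partials d) a (Finset.univ.erase p.1) (φ p.2) else 0 := by
    intro p l'
    simp [coef]
  -- under the hypothesis `hn`, the contractions have positive degree, so that nothing is discarded
  have hred : ∀ (v : Fin d → PolyFun d) (l : Fin n) (c : Fin k),
      reduce (PolyFun d) d k (vecMul (PolyFun d) d k v (leibnizTerm (LinearMap.proj c) l X)) =
        vecMul (PolyFun d) d k v (leibnizTerm (LinearMap.proj c) l X) := by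
    intro v l c
    have h := leibnizTerm_mem_exteriorPower (LinearMap.proj c) l hdeg
    obtain ⟨e, he⟩ : ∃ e, (∑ s, if s = l then m s else m s + 1) = e + 1 := by
      refine ⟨_, (Nat.sub_add_cancel (Nat.pos_of_ne_zero fun h0 => ?_)).symm⟩
      rw [Finset.sum_eq_zero_iff] at h0
      have h0' : ∀ s, s = l ∧ m s = 0 := fun s => by
        have := h0 s (Finset.mem_univ s)
        split_ifs at this with h1
        exact ⟨h1, this⟩
      rcases hn with hn | ⟨s, hs⟩
      · have h1 := (h0' ⟨0, by omega⟩).1.trans (h0' ⟨1, by omega⟩).1.symm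
        exact absurd (congrArg Fin.val h1) (by norm_num)
      · exact absurd (h0' s).2 (by omega)
    rw [he] at h
    exact reduce_vecMul_of_mem_succ v h
  refine (koszulCoord d k).injective ?_
  change coordIncl d k (koszulBracket φ n _) = _
  rw [coordIncl_koszulBracket]
  simp only [coordIncl_koszulGen, one_smul] at hpure ⊢
  rw [hpure, koszulBracketFormula, koszulCoord_sum, map_sum, Fintype.sum_prod_type]
  refine Finset.sum_congr rfl fun l _ => ?_
  have hterm : ∀ c, reduce (PolyFun d) d k (∑ l', vecMul (PolyFun d) d k (Pi.single (a l')
      (coef (partials d) φ Finset.univ (fun _ => 1) a (fun l => m l + 1) (l, c) l'))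
      (leibnizTerm (LinearMap.proj c) l X)) =
      ∑ t : Fin (m l + 1), if J l t = c then
        ((-1) ^ (n - 1) * (-1) ^ ((∑ s ∈ Finset.Iio l, (m s + 1)) + t) *
          pd (partials d) a (Finset.univ.erase l) (φ c)) • (Pi.single (a l)
            (MultilinearMap.mkPiAlgebraFin (PolyFun d) n (KoszulAlgebra d k)
              (Function.update X l (muMonomial d ((List.ofFn (J l)).eraseIdx t)))) :
                Fin d → KoszulAlgebra d k) else 0 := by
    intro c
    rw [Finset.sum_eq_single l]
    · have hup : leibnizTerm (LinearMap.proj c) l X = ∑ t : Fin (m l + 1), if J l t = c then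
          (-1 : PolyFun d) ^ ((∑ s ∈ Finset.Iio l, (m s + 1)) + t) •
            MultilinearMap.mkPiAlgebraFin (PolyFun d) n (KoszulAlgebra d k)
              (Function.update X l (muMonomial d ((List.ofFn (J l)).eraseIdx t))) else 0 := by
        rw [leibnizTerm_eq_smul _ _ hdeg]
        have h1 : CliffordAlgebra.contractLeft (LinearMap.proj c) (X l) = _ :=
          dmu_muMonomial c (J l)
        rw [h1, MultilinearMap.map_update_sum, Finset.smul_sum]
        refine Finset.sum_congr rfl fun t _ => ?_
        split_ifs
        · rw [MultilinearMap.map_update_smul, smul_smul, pow_add]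
        · rw [MultilinearMap.map_update_zero, smul_zero]
      rw [hred, hcoef, if_pos rfl, hup, map_sum]
      refine Finset.sum_congr rfl fun t _ => ?_
      split_ifs
      · rw [map_smul, vecMul_single, smul_smul]
        congr 1
        ring
      · exact map_zero _
    · intro l' _ hl'
      rw [hcoef, if_neg hl', Pi.single_zero, map_zero, LinearMap.zero_apply]
    · simp
  rw [koszulCoord_sum, Finset.sum_congr rfl fun c _ => hterm c, Finset.sum_comm]
  refine Finset.sum_congr rfl fun t _ => ?_
  rw [Finset.sum_ite_eq, if_pos (Finset.mem_univ _), LinearEquiv.map_smul, koszulCoord_tmul_pderiv,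
    iteratedPDeriv_eraseIdx, MultilinearMap.mkPiAlgebraFin_apply]
  congr 4
  funext s
  by_cases h : s = l
  · subst h; simp
  · simp [h, hX]

theorem isKoszulStructure_koszulAlgebroid : IsKoszulStructure φ (koszulAlgebroid φ) where
  anchor_gen := koszulAnchor_gen φ
  bracket_gen _ m J a hn := koszulBracket_gen φ m J a hn

end KoszulLie

namespace KoszulLie

open ExteriorAlgebra

variable {d k : ℕ} {φ : Fin k → PolyFun d}

theorem hasDegree_of (m : ℕ) (x : KoszulVF d k m) :
    HasDegree (E := KoszulVF d k) (-((m : ℤ) + 1)) (DirectSum.of (KoszulVF d k) m x) := by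
  intro j hj
  exact DirectSum.of_eq_of_ne _ _ _ fun h => hj (by rw [h])

theorem koszulIncl_injective : Function.Injective (koszulIncl d k) := fun _ _ h =>
  coordIncl_injective (congrArg (koszulCoord d k) h)

/-- The generator `μ_J ⊗ ∂/∂x_a`, as an element of the direct sum. -/
def genSum (m : ℕ) (J : Fin (m + 1) → Fin k) (a : Fin d) : KoszulSum d k :=
  DirectSum.of (KoszulVF d k) m (koszulGen J a)

theorem hasDegree_genSum (m : ℕ) (J : Fin (m + 1) → Fin k) (a : Fin d) :
    HasDegree (E := KoszulVF d k) (-((m : ℤ) + 1)) (genSum m J a) :=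
  hasDegree_of m _

theorem mem_closure_genSum (x : KoszulSum d k) : x ∈ AddSubmonoid.closure
    {w : KoszulSum d k | ∃ (m : ℕ) (J : Fin (m + 1) → Fin k) (a : Fin d) (f : PolyFun d),
      w = f • genSum m J a} := by
  induction x using DirectSum.induction_on with
  | zero => exact zero_mem _
  | add x y hx hy => exact add_mem hx hy
  | of j x =>
    refine AddSubmonoid.closure_mono ?_ (mem_closure_pureElements (hasDegree_of j x))
    rintro w ⟨m, J, a, f, -, rfl⟩
    exact ⟨m, J, a, f, rfl⟩

/-! ### Uniqueness -/

section Uniqueness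

variable {V W : LieInftyAlgebroid ℂ (PolyFun d) (KoszulVF d k)}

theorem anchor_eq_of_isKoszulStructure (hV : IsKoszulStructure φ V) (hW : IsKoszulStructure φ W) :
    V.anchor = W.anchor := by
  refine LinearMap.ext fun x => ?_
  induction mem_closure_of_degree_one x using AddSubmonoid.closure_induction with
  | zero => rw [LinearMap.map_zero, LinearMap.map_zero]
  | add x y _ _ hx hy => rw [LinearMap.map_add, LinearMap.map_add, hx, hy]
  | mem x hx =>
    obtain ⟨f, i, a, rfl⟩ := hx
    rw [LinearMap.map_smul, LinearMap.map_smul, hV.anchor_gen, hW.anchor_gen]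

theorem eq_zero_of_hasDegree_zero {x : KoszulSum d k} (hx : HasDegree (E := KoszulVF d k) 0 x) :
    x = 0 := DFinsupp.ext fun j => hx j (by omega)

/-- The brackets on generators agree. In the case which `IsKoszulStructure` leaves out, the unary
bracket in degree `-1`, they vanish for degree reasons. -/
theorem bracket_gen_eq_of_isKoszulStructure (hV : IsKoszulStructure φ V)
    (hW : IsKoszulStructure φ W) {n : ℕ} (m : Fin n → ℕ) (J : ∀ l, Fin (m l + 1) → Fin k)
    (a : Fin n → Fin d) :
    V.bracket n (fun l => genSum (m l) (J l) (a l)) =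
      W.bracket n (fun l => genSum (m l) (J l) (a l)) := by
  by_cases hn : 2 ≤ n ∨ ∃ l, 1 ≤ m l
  · exact koszulIncl_injective ((hV.bracket_gen n m J a hn).trans (hW.bracket_gen n m J a hn).symm)
  · push Not at hn
    obtain ⟨hn, hm⟩ := hn
    obtain rfl | rfl : n = 0 ∨ n = 1 := by omega
    · rw [V.bracket_zero, W.bracket_zero]
    · have h : ∀ U : LieInftyAlgebroid ℂ (PolyFun d) (KoszulVF d k),
          U.bracket 1 (fun l => genSum (m l) (J l) (a l)) = 0 := by
        intro U
        have hU := U.bracket_degree 1 (fun l => genSum (m l) (J l) (a l))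
          (fun l => -((m l : ℤ) + 1)) fun l => hasDegree_of _ _
        have e : ∑ l : Fin 1, -((m l : ℤ) + 1) + 1 = 0 := by
          have := hm 0
          simp; omega
        rw [e] at hU
        exact eq_zero_of_hasDegree_zero hU
      rw [h, h]

/-- For `n ≠ 2`, the `n`-ary bracket as an `O`-multilinear map. -/
def bracketLinear (U : LieInftyAlgebroid ℂ (PolyFun d) (KoszulVF d k)) {n : ℕ} (hn : n ≠ 2) :
    MultilinearMap (PolyFun d) (fun _ : Fin n => KoszulSum d k) (KoszulSum d k) :=
  MultilinearMap.mk' (U.bracket n) (fun x i u v => (U.bracket n).map_update_add x i u v)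
    fun x i f u => by
      have h := U.bracket_smul n hn (Function.update x i u) i f
      simpa using h

/-- The Leibniz rule in both arguments: the binary bracket is determined by its values on generators
and by the anchor. -/
theorem bracket_two_smul_smul (U : LieInftyAlgebroid ℂ (PolyFun d) (KoszulVF d k)) {p q : ℤ}
    {x y : KoszulSum d k} (hx : HasDegree (E := KoszulVF d k) p x)
    (hy : HasDegree (E := KoszulVF d k) q y) (f g : PolyFun d) :
    U.bracket 2 ![f • x, g • y] = U.anchor ((f • x) 0) g • y +
      g • (koszulSign ![q, p] (Equiv.swap 0 1) : ℤ) •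
        (U.anchor (y 0) f • x + f • U.bracket 2 ![y, x]) := by
  have h := U.bracket_symm 2 ![y, f • x] ![q, p] (fun i => by
    fin_cases i
    · exact hy
    · intro j hj
      exact (congrArg (f • ·) (hx j hj)).trans (smul_zero f)) (Equiv.swap 0 1)
  have e : (fun i => ![y, f • x] (Equiv.swap 0 1 i)) = ![f • x, y] := by
    funext i; fin_cases i <;> rfl
  rw [e] at h
  rw [U.leibniz, h, U.leibniz]

theorem eq_of_isKoszulStructure (hV : IsKoszulStructure φ V) (hW : IsKoszulStructure φ W) :
    V = W := by
  have hanchor := anchor_eq_of_isKoszulStructure hV hW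
  have hbracket : V.bracket = W.bracket := by
    funext n
    refine MultilinearMap.ext fun x => eq_of_sub_mem_bot ?_
    refine (V.bracket n - W.bracket n).map_mem_of_forall_mem_closure (fun y hy => ?_)
      fun i => mem_closure_genSum (x i)
    rw [AddSubmonoid.mem_bot]
    refine sub_eq_zero.mpr ?_
    choose m J a f h using hy
    obtain rfl : y = fun i => f i • genSum (m i) (J i) (a i) := funext h
    by_cases hn : n = 2
    · subst hn
      have e : ∀ z : Fin 2 → KoszulSum d k, z = ![z 0, z 1] := by
        intro z; funext i; fin_cases i <;> rfl
      have hgen : V.bracket 2 ![genSum (m 1) (J 1) (a 1), genSum (m 0) (J 0) (a 0)] =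
          W.bracket 2 ![genSum (m 1) (J 1) (a 1), genSum (m 0) (J 0) (a 0)] := by
        have := bracket_gen_eq_of_isKoszulStructure hV hW (fun i => m (Equiv.swap 0 1 i))
          (fun i => J (Equiv.swap 0 1 i)) (fun i => a (Equiv.swap 0 1 i))
        rw [e fun l => _] at this
        exact this
      rw [e fun i => _, bracket_two_smul_smul V (hasDegree_genSum _ _ _) (hasDegree_genSum _ _ _),
        bracket_two_smul_smul W (hasDegree_genSum _ _ _) (hasDegree_genSum _ _ _), hanchor]
      exact congrArg (fun z => _ + f 1 • _ • (_ + f 0 • z)) hgen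
    · have hlin : ∀ U : LieInftyAlgebroid ℂ (PolyFun d) (KoszulVF d k),
          U.bracket n (fun i => f i • genSum (m i) (J i) (a i)) =
            (∏ i, f i) • U.bracket n (fun i => genSum (m i) (J i) (a i)) := fun U =>
        (bracketLinear U hn).map_smul_univ f _
      rw [hlin V, hlin W, bracket_gen_eq_of_isKoszulStructure hV hW]
  -- all the other fields are propositions
  cases V
  cases W
  subst hanchor hbracket
  rfl

end Uniqueness

/-! ### Universality -/

section Universality

theorem koszulAlgebroid_differential (j : ℕ) (x : KoszulVF d k (j + 1)) :
    (koszulAlgebroid φ).differential j x =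
      koszulBracket φ 1 ![DirectSum.of (KoszulVF d k) (j + 1) x] j := rfl

theorem koszulBracket_one_of_succ (j : ℕ) (x : KoszulVF d k (j + 1)) :
    koszulBracket φ 1 ![DirectSum.of (KoszulVF d k) (j + 1) x] =
      DirectSum.of (KoszulVF d k) j ((koszulAlgebroid φ).differential j x) := by
  refine eq_of_hasDegree ?_
  have h := koszulBracket_degree φ 1 ![DirectSum.of (KoszulVF d k) (j + 1) x]
    (fun _ => -(((j + 1 : ℕ) : ℤ) + 1)) (fun i => by fin_cases i; exact hasDegree_of _ _)
  have e : ∑ _i : Fin 1, -(((j + 1 : ℕ) : ℤ) + 1) + 1 = -((j : ℤ) + 1) := by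
    simp
  rwa [e] at h

theorem koszulBracket_one_of_zero (x : KoszulVF d k 0) :
    koszulBracket φ 1 ![DirectSum.of (KoszulVF d k) 0 x] = 0 := by
  refine eq_zero_of_hasDegree_zero ?_
  have h := koszulBracket_degree φ 1 ![DirectSum.of (KoszulVF d k) 0 x]
    (fun _ => -(((0 : ℕ) : ℤ) + 1)) (fun i => by fin_cases i; exact hasDegree_of _ _)
  have e : ∑ _i : Fin 1, -(((0 : ℕ) : ℤ) + 1) + 1 = 0 := by simp
  rwa [e] at h

theorem koszulBracket_one_apply (x : KoszulSum d k) (j : ℕ) :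
    koszulBracket φ 1 ![x] j = (koszulAlgebroid φ).differential j (x (j + 1)) := by
  have hadd : ∀ u v : KoszulSum d k,
      koszulBracket φ 1 ![u + v] = koszulBracket φ 1 ![u] + koszulBracket φ 1 ![v] := fun u v =>
    (koszulBracket φ 1).cons_add ![] u v
  have hzero : koszulBracket φ 1 ![0] = 0 := (koszulBracket φ 1).map_coord_zero 0 rfl
  simp only [koszulAlgebroid_differential]
  induction x using DirectSum.induction_on with
  | zero => rw [DirectSum.zero_apply, AddMonoidHom.map_zero]
  | add x y hx hy =>
    rw [hadd, DirectSum.add_apply, DirectSum.add_apply, hx, hy, AddMonoidHom.map_add, hadd,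
      DirectSum.add_apply]
  | of i x =>
    by_cases h : i = j + 1
    · subst h
      rw [DirectSum.of_eq_same]
    · rw [DirectSum.of_eq_of_ne i (j + 1) x (Ne.symm h), AddMonoidHom.map_zero, hzero,
        DirectSum.zero_apply]
      obtain _ | i := i
      · rw [koszulBracket_one_of_zero, DirectSum.zero_apply]
      · rw [koszulBracket_one_of_succ, DirectSum.of_eq_of_ne]
        omega

theorem coordIncl_koszulBracket_one (x : KoszulSum d k) (a : Fin d) :
    coordIncl d k (koszulBracket φ 1 ![x]) a =
      koszulD φ (coordIncl d k x a) -
        algebraMap _ _ (algebraMapInv (koszulD φ (coordIncl d k x a))) := by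
  have e : (fun i => coordIncl d k (![x] i)) = ![coordIncl d k x] := by
    funext i; fin_cases i; rfl
  rw [coordIncl_koszulBracket, reduce_apply, e, fullBracket_one]

theorem differential_differential (j : ℕ) (x : KoszulVF d k (j + 2)) :
    (koszulAlgebroid φ).differential j ((koszulAlgebroid φ).differential (j + 1) x) = 0 := by
  rw [koszulAlgebroid_differential, ← koszulBracket_one_of_succ]
  have h : koszulBracket φ 1 ![koszulBracket φ 1 ![DirectSum.of (KoszulVF d k) (j + 2) x]] = 0 := by
    refine coordIncl_injective (funext fun a => ?_)
    rw [coordIncl_koszulBracket_one, coordIncl_koszulBracket_one, map_sub, koszulD_algebraMap,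
      sub_zero, koszulD_koszulD, map_zero, map_zero, sub_zero, map_zero]
    rfl
  rw [h, DirectSum.zero_apply]

/-- The exactness of the Koszul complex of a regular sequence, in degrees at least one. -/
theorem exists_differential_eq
    (hφ : RingTheory.Sequence.IsWeaklyRegular (PolyFun d) (List.ofFn φ)) (j : ℕ)
    (y : KoszulVF d k j)
    (hy : ∀ a, koszulD φ (coordIncl d k (DirectSum.of (KoszulVF d k) j y) a) = 0) :
    ∃ x, (koszulAlgebroid φ).differential j x = y := by
  have hex : ∀ a, ∃ w, koszulD φ w = coordIncl d k (DirectSum.of (KoszulVF d k) j y) a := fun a =>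
    exists_koszulD_eq φ hφ.mem_span_of_mul_mem _ (hy a) (by
      rw [algebraMapInv_coordIncl]; exact zero_mem _)
  choose w hw using hex
  refine ⟨coordProj d k w (j + 1), ?_⟩
  rw [← koszulBracket_one_apply]
  have h : koszulBracket φ 1 ![coordProj d k w] = DirectSum.of (KoszulVF d k) j y := by
    refine coordIncl_injective (funext fun a => ?_)
    rw [coordIncl_koszulBracket_one, coordIncl_coordProj, map_sub, koszulD_algebraMap, sub_zero,
      hw, algebraMapInv_coordIncl, map_zero, sub_zero]
  rw [h, DirectSum.of_eq_same]

theorem koszulAnchor_mem (x : KoszulVF d k 0) :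
    koszulAnchor φ x ∈ Ideal.span (Set.range φ) • (⊤ : Submodule (PolyFun d) (VF d)) := by
  induction mem_closure_of_degree_one x using AddSubmonoid.closure_induction with
  | zero => rw [LinearMap.map_zero]; exact zero_mem _
  | add x y _ _ hx hy => rw [LinearMap.map_add]; exact add_mem hx hy
  | mem x hx =>
    obtain ⟨f, i, a, rfl⟩ := hx
    rw [LinearMap.map_smul, koszulAnchor_gen]
    exact Submodule.smul_mem _ _ (Submodule.smul_mem_smul (Ideal.subset_span ⟨i, rfl⟩) trivial)

theorem exists_koszulAnchor_eq {X : VF d}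
    (hX : X ∈ Ideal.span (Set.range φ) • (⊤ : Submodule (PolyFun d) (VF d))) :
    ∃ x, koszulAnchor φ x = X := by
  change X ∈ LinearMap.range (koszulAnchor φ)
  induction hX using Submodule.smul_induction_on' with
  | smul r hr Y _ =>
    rw [VF.eq_sum Y, Finset.smul_sum]
    refine sum_mem fun a _ => ?_
    rw [smul_comm]
    refine Submodule.smul_mem _ _ ?_
    induction hr using Submodule.span_induction with
    | mem r hr =>
      obtain ⟨i, rfl⟩ := hr
      exact ⟨_, koszulAnchor_gen φ i a⟩
    | zero => rw [zero_smul]; exact zero_mem _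
    | add r s _ _ hr hs => rw [add_smul]; exact add_mem hr hs
    | smul r s _ hs => rw [smul_assoc]; exact Submodule.smul_mem _ _ hs
  | add _ _ _ _ hX hY => exact add_mem hX hY

theorem koszulD_eq_zero_of_koszulAnchor_eq_zero {y : KoszulVF d k 0} (hy : koszulAnchor φ y = 0)
    (a : Fin d) : koszulD φ (coordIncl d k (DirectSum.of (KoszulVF d k) 0 y) a) = 0 := by
  have h := koszulAnchor_X φ y a
  rw [hy, anchorCoeff_apply] at h
  rw [mem_exteriorPower_zero_iff.mp (koszulD_mem_exteriorPower φ (coordIncl_of_mem 0 y a)), ← h]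
  exact map_zero _

/-- Universality, for a Lie–Rinehart algebra of vector fields which is `I Der(O)`. -/
theorem exists_isUniversalFor
    (hφ : RingTheory.Sequence.IsWeaklyRegular (PolyFun d) (List.ofFn φ))
    (A : LieRinehartSubalgebra (PolyFun d) (VF d))
    (hA : ∀ X, X ∈ A ↔ X ∈ Ideal.span (Set.range φ) • (⊤ : Submodule (PolyFun d) (VF d))) :
    ∃ π : KoszulVF d k 0 →ₗ[PolyFun d] A,
      (∀ x, (π x : VF d) = (koszulAlgebroid φ).anchor x) ∧
        (koszulAlgebroid φ).IsUniversalFor π := by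
  let π : KoszulVF d k 0 →ₗ[PolyFun d] A :=
    { toFun := fun x => ⟨koszulAnchor φ x, (hA _).mpr (koszulAnchor_mem x)⟩
      map_add' := fun x y => Subtype.ext (LinearMap.map_add _ x y)
      map_smul' := fun f x => Subtype.ext (LinearMap.map_smul _ f x) }
  have hπ : ∀ x, (π x : VF d) = koszulAnchor φ x := fun _ => rfl
  refine ⟨π, hπ, ⟨⟨fun x => ?_, fun x y => ?_⟩, ?_, ?_, ?_⟩⟩
  · exact Derivation.ext fun f => rfl
  · refine Subtype.ext ?_
    exact (koszulAnchor_bracket_two φ x y).symm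
  · rintro ⟨X, hX⟩
    obtain ⟨x, hx⟩ := exists_koszulAnchor_eq ((hA X).mp hX)
    exact ⟨x, Subtype.ext hx⟩
  · intro y
    constructor
    · intro hy
      exact exists_differential_eq hφ 0 y fun a =>
        koszulD_eq_zero_of_koszulAnchor_eq_zero (congrArg Subtype.val hy) a
    · rintro ⟨x, rfl⟩
      exact Subtype.ext (koszulAnchor_bracket_one φ x)
  · intro j y
    constructor
    · intro hy
      refine exists_differential_eq hφ (j + 1) y fun a => ?_
      have h : koszulBracket φ 1 ![DirectSum.of (KoszulVF d k) (j + 1) y] = 0 := by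
        rw [koszulBracket_one_of_succ, hy, AddMonoidHom.map_zero]
      have h' := coordIncl_koszulBracket_one (φ := φ) (DirectSum.of (KoszulVF d k) (j + 1) y) a
      rw [h, LinearMap.map_zero, algebraMapInv_of_mem
        (koszulD_mem_exteriorPower φ (coordIncl_of_mem (j + 1) y a)), map_zero, sub_zero] at h'
      exact h'.symm
    · rintro ⟨x, rfl⟩
      exact differential_differential j x

/-- A vector field vanishes along `N` if and only if its coefficients lie in the ideal of `N`. -/
theorem mem_vanishingVF_iff {N : Set (Fin d → ℂ)} {I : Ideal (PolyFun d)}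
    (hI : MvPolynomial.vanishingIdeal ℂ N = I) (X : VF d) :
    X ∈ vanishingVF N ↔ X ∈ I • (⊤ : Submodule (PolyFun d) (VF d)) := by
  have hmem : X ∈ vanishingVF N ↔ ∀ f : PolyFun d, X f ∈ I := by
    rw [← hI]
    exact ⟨fun h f p hp => h p hp f, fun h p hp f => h f p hp⟩
  rw [hmem]
  constructor
  · intro h
    rw [VF.eq_sum X]
    exact sum_mem fun a _ => Submodule.smul_mem_smul (h _) trivial
  · exact fun h f => apply_mem_of_mem_ideal_smul h f

end Universality

end KoszulLie

end

theorem mainTheorem9 {d k : ℕ} (φ : Fin k → MvPolynomial (Fin d) ℂ)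
    (hφ : RingTheory.Sequence.IsRegular (MvPolynomial (Fin d) ℂ) (List.ofFn φ)) :
    ∃ U : LieInftyAlgebroid ℂ (PolyFun d) (KoszulVF d k),
      IsKoszulStructure φ U ∧
      (∀ V : LieInftyAlgebroid ℂ (PolyFun d) (KoszulVF d k), IsKoszulStructure φ V → V = U) ∧
      (∃ π : KoszulVF d k 0 →ₗ[PolyFun d] idealVF (Ideal.span (Set.range φ)),
        (∀ x, (π x : VF d) = U.anchor x) ∧ U.IsUniversalFor π) ∧
      (∀ N : Set (Fin d → ℂ),
        N = MvPolynomial.zeroLocus ℂ (Ideal.span (Set.range φ)) →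
        MvPolynomial.vanishingIdeal ℂ N = Ideal.span (Set.range φ) →
        ∃ π : KoszulVF d k 0 →ₗ[PolyFun d] vanishingVF N,
          (∀ x, (π x : VF d) = U.anchor x) ∧ U.IsUniversalFor π) := by
  have hK := KoszulLie.isKoszulStructure_koszulAlgebroid φ
  exact ⟨KoszulLie.koszulAlgebroid φ, hK, fun V hV => KoszulLie.eq_of_isKoszulStructure hV hK,
    KoszulLie.exists_isUniversalFor hφ.toIsWeaklyRegular _ fun _ => Iff.rfl,
    fun N _ hN => KoszulLie.exists_isUniversalFor hφ.toIsWeaklyRegular _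
      (KoszulLie.mem_vanishingVF_iff hN)⟩
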